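/- **Setting.** Let $\mathfrak g=\mathfrak{sl}_2$ with standard basis $e,h,f$, let $\kappa\in\mathbb C\setminus\{0\}$, $m,n\ge 0$, $r_1,\dots,r_n\ge 0$, and $\lambda^{(a)}_p\in\mathbb C$ ($1\le a\le n$, $0\le p\le r_a$). For $\mathfrak g_{(r)}=\mathfrak g[t]/t^{r+1}\mathfrak g[t]$ and $x[p]=x\otimes t^p$, the confluent Verma module $M(\lambda^{(a)})$ is the $\mathfrak g_{(r_a)}$-module induced from the line $\mathbb C|\lambda^{(a)}\rangle$ with $e[p]|\lambda^{(a)}\rangle=0$, $h[p]|\lambda^{(a)}\rangle=\lambda^{(a)}_p|\lambda^{(a)}\rangle$. Let $\beta(z)\gamma(w)=\frac1{z-w}+\cdots$ be a $\beta\gamma$ system and $\varphi$ a free boson with values in the Cartan subalgebra, $(\lambda,\varphi(z))(\mu,\varphi(w))=\frac{(\lambda,\mu)}{\kappa}\log(z-w)+\cdots$, $(\alpha,\alpha)=2$; the weights are $(\lambda^{(a)})_p=\lambda^{(a)}_p\alpha/2$. For $v_a\in M(\lambda^{(a)})$ put $P_a(x)=\langle\lambda^{(a)}|Z|v_a\rangle$,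 $Z=\exp(\sum_p x_pe[p])$, let $P_a(\gamma(z_a))$ be obtained from it by $x_p\mapsto\partial^p\gamma(z_a)/p!$, and put $S[p]=\partial/\partial x_p$. For $\mathfrak{sl}_2$ the screening current without its exponential factor is $S(t)=\beta(t)$. Let $$\omega=\Big\langle \prod_{i=1}^mS(t_i)\prod_{a=1}^nP_a(\gamma(z_a))\Big\rangle,\qquad \Psi=\Big\langle\prod_{i=1}^m:e^{-\alpha\varphi(t_i)}:\prod_{a=1}^n:\exp\Big(\sum_{p=0}^{r_a}(\lambda^{(a)})_p\frac{\partial^p\varphi(z_a)}{p!}\Big):\Big\rangle ;$$ these are given by the mode expansions on the Fock spaces for radially ordered points, and continued analytically to pairwise distinct points ($\omega$ as a rational function, $\Psi$ as a multivalued function). **Theorem.** (0) There is a unique functional $\langle\lambda^{(a)}|$ on $M(\lambda^{(a)})$ with $\langle\lambda^{(a)}|f[p]=0$, $\langle\lambda^{(a)}|h[p]=\lambda_p^{(a)}\langle\lambda^{(a)}|$, $\langle\lambda^{(a)}|\lambda^{(a)}\rangle=1$, and a unique linear map $u\mapsto\langle u^*|$ from $M(\lambda^{(a)})$ to its dual with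 $|\lambda^{(a)}\rangle\mapsto\langle\lambda^{(a)}|$ that turns the left action of $e[p],f[p],h[p]$ into the right action of $f[p],e[p],h[p]$. (1) On pairwise distinct points, $\omega$ exists, is unique, and $$\omega=\frac1{m!}\sum_{\sigma\in\mathfrak S_m}\sigma\Big(\sum_{(I_1,\dots,I_n)}\prod_{a=1}^nP(a,I_a)\Big),\qquad P(a,\{i_1<\dots<i_k\})=\sum_{p_1,\dots,p_k=0}^{r_a}\frac{[S[p_1]\cdots S[p_k]P_a]}{\prod_{j=1}^k(t_{i_j}-z_a)^{p_j+1}},$$ where $(I_1,\dots,I_n)$ runs over the sequences of pairwise disjoint (possibly empty) sets with union $\{1,\dots,m\}$, $\sigma$ permutes $t_1,\dots,t_m$, and $[\,\cdot\,]$ is the constant term. (2) $S[p_1]\cdots S[p_k]P_a=\langle\lambda^{(a)}|e[p_k]\cdots e[p_1]Z|v_a\rangle$ and $[S[p_1]\cdots S[p_k]P_a]=\langle\lambda^{(a)}|e[p_k]\cdots e[p_1]|v_a\rangle$. In particular, for $v_a=f[q_1]\cdots f[q_s]|\lambda^{(a)}\rangle$ the entries are $\langle\lambda^{(a)}|e[p_k]\cdots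 e[p_1]f[q_1]\cdots f[q_s]|\lambda^{(a)}\rangle$. (3) $\Psi$ equals the master function of Jimbo–Nagoya–Sun, $$\begin{aligned}&\prod_{a<b}(z_a-z_b)^{\frac{\lambda^{(a)}_0\lambda^{(b)}_0}{2\kappa}}\exp\Big(\sum_{p\le r_a,\,q\le r_b,\,p+q>0}\tfrac{\lambda^{(a)}_p\lambda^{(b)}_q}{2\kappa}\tbinom{p+q}{p}\tfrac{(-1)^{p+1}}{p+q}\tfrac1{(z_a-z_b)^{p+q}}\Big)\\ &\times\prod_{i<j}(t_i-t_j)^{\frac2\kappa}\prod_{i,a}(t_i-z_a)^{-\frac{\lambda^{(a)}_0}\kappa}\exp\Big(\sum_{p=1}^{r_a}\tfrac{\lambda_p^{(a)}}{\kappa}\tfrac{1}{p(t_i-z_a)^p}\Big),\end{aligned}$$ with the same branches of the logarithms of the differences on both sides. (4) For every twisted $m$-chain $\Gamma$ in the $t$-space on which the integrals below converge, $$\int_\Gamma\Psi\,\omega\,dt_1\cdots dt_m=\langle u^*|v_1\otimes\cdots\otimes v_n\rangle,\qquad u=\int_\Gamma\Psi\prod_{j=1}^m\Big(\sum_{a=1}^n\sum_{p=0}^{r_a}\frac{f^{(a)}[p]}{(t_j-z_a)^{p+1}}\Big)dt_1\cdots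 dt_m\;|\lambda^{(1)}\rangle\otimes\cdots\otimes|\lambda^{(n)}\rangle ,$$ where $x^{(a)}[p]$ is $x[p]$ acting on the $a$-th tensor factor; $u$ is the Jimbo–Nagoya–Sun integral. (5) Let $\Gamma$ be a twisted cycle for all $(z,\lambda)\in U$, where $U$ is open in the variables $z_a$ and $\lambda^{(a)}_p$, $p\ge1$ (the integrals of $\Psi\eta$ converge locally uniformly in the parameters, and those of $\partial(\Psi\eta)/\partial t_i$ vanish, for all rational $\eta$ in $(t,z)$ regular at pairwise distinct points). Then $u$ solves the confluent KZ equations on $U$: for $1\le a\le n$, $$\kappa\frac{\partial u}{\partial z_a}=G^{(a)}_{-1}u,\qquad \kappa\,(D^{(a)}_k+d^{(a)}_k)u=\big(G^{(a)}_k-c^{(a)}_k\big)u\quad(0\le k\le r_a-1).$$ Here $G_k^{(a)}$ is the coefficient of $(z-z_a)^{-k-2}$ in $\frac12\big(\frac12h(z)^2+e(z)f(z)+f(z)e(z)\big)$ with $x(z)=\sum_{a,p}x^{(a)}[p](z-z_a)^{-p-1}$; $D^{(a)}_k=\sum_{p=1}^{r_a-k}p\lambda^{(a)}_{p+k}\partial/\partial\lambda^{(a)}_p$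 acts on the coefficients of the polynomials in the $f^{(b)}[p]$ that represent $u$; $d^{(a)}_k$ is the derivation with $d_k^{(a)}f^{(b)}[p]=\delta_{ab}\,p\,f^{(a)}[p+k]$ (with $f^{(a)}[q]=0$ for $q>r_a$); and $c^{(a)}_k=\frac14\sum_{p+q=k}\lambda^{(a)}_p\lambda^{(a)}_q+\frac{k+1}2\lambda^{(a)}_k$. -/

import Mathlib

open scoped TensorProduct Polynomial
open Topology MeasureTheory

noncomputable section

namespace ConfluentSl2

/-! ### The truncated current algebra of `sl₂` and confluent Verma modules -/

/-- The Lie algebra `sl₂` over `ℂ`. -/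
abbrev Sl2 : Type := LieAlgebra.SpecialLinear.sl (Fin 2) ℂ

def e : Sl2 := LieAlgebra.SpecialLinear.single (0 : Fin 2) 1 (by decide) (1 : ℂ)
def f : Sl2 := LieAlgebra.SpecialLinear.single (1 : Fin 2) 0 (by decide) (1 : ℂ)
def h : Sl2 := LieAlgebra.SpecialLinear.singleSubSingle (0 : Fin 2) 1 (1 : ℂ)

/-- `ℂ[t] / (t ^ (r + 1))`. -/
abbrev TruncPoly (r : ℕ) : Type := ℂ[X] ⧸ Ideal.span {(Polynomial.X : ℂ[X]) ^ (r + 1)}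

/-- The truncated Lie algebra `sl₂[t] / t ^ (r + 1) sl₂[t]`. -/
abbrev TruncSl2 (r : ℕ) : Type := TruncPoly r ⊗[ℂ] Sl2

/-- The universal enveloping algebra of the truncated Lie algebra. -/
abbrev UTrunc (r : ℕ) : Type := UniversalEnvelopingAlgebra ℂ (TruncSl2 r)

/-- `x[p] = x ⊗ t ^ p`, as an element of the enveloping algebra. It vanishes for `p > r`. -/
def cur (r : ℕ) (x : Sl2) (p : ℕ) : UTrunc r :=
  UniversalEnvelopingAlgebra.ι ℂ
    ((Ideal.Quotient.mk (Ideal.span {(Polynomial.X : ℂ[X]) ^ (r + 1)})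
      (Polynomial.X ^ p) : TruncPoly r) ⊗ₜ[ℂ] x)

/-- The product `x[p_1] ⋯ x[p_k]`. -/
def word (r : ℕ) (x : Sl2) (ps : List (Fin (r + 1))) : UTrunc r :=
  (ps.map fun p : Fin (r + 1) => cur r x (p : ℕ)).prod

/-- The left ideal generated by the `e[p]` and the `h[p] - lam p`, `0 ≤ p ≤ r`. -/
def vermaIdeal {r : ℕ} (lam : Fin (r + 1) → ℂ) : Submodule (UTrunc r) (UTrunc r) :=
  Submodule.span (UTrunc r)
    (Set.range (fun p : Fin (r + 1) => cur r e p) ∪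
      Set.range (fun p : Fin (r + 1) => cur r h p - algebraMap ℂ (UTrunc r) (lam p)))

/-- The confluent Verma module: the module induced from the one-dimensional module of
`b[t] / t ^ (r + 1) b[t]` on which `e[p]` acts by `0` and `h[p]` by `lam p`. -/
abbrev Verma {r : ℕ} (lam : Fin (r + 1) → ℂ) : Type := UTrunc r ⧸ vermaIdeal lam

/-- The highest weight vector `|lam⟩`. -/
def ket {r : ℕ} (lam : Fin (r + 1) → ℂ) : Verma lam := Submodule.Quotient.mk 1

/-- The action of the enveloping algebra on the confluent Verma module. -/
def act {r : ℕ} (lam : Fin (r + 1) → ℂ) : UTrunc r →ₐ[ℂ] Module.End ℂ (Verma lam) :=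
  Algebra.lsmul ℂ ℂ (Verma lam)

/-- `bra` is the generator `⟨lam|` of the dual module: `⟨lam| f[p] = 0`,
`⟨lam| h[p] = lam p ⟨lam|`, `⟨lam|lam⟩ = 1`. -/
structure IsBra {r : ℕ} (lam : Fin (r + 1) → ℂ) (bra : Module.Dual ℂ (Verma lam)) : Prop where
  apply_ket : bra (ket lam) = 1
  apply_f : ∀ (p : Fin (r + 1)) (w : Verma lam), bra (act lam (cur r f p) w) = 0
  apply_h : ∀ (p : Fin (r + 1)) (w : Verma lam), bra (act lam (cur r h p) w) = lam p * bra w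

/-- `D` is the correspondence `u ↦ ⟨u*|` between the confluent Verma module and its dual: it sends
`|lam⟩` to `⟨lam|`, and exchanges `e[p]` and `f[p]`, acting on the left of a vector and on the
right of a dual vector. -/
structure IsDualMap {r : ℕ} (lam : Fin (r + 1) → ℂ) (bra : Module.Dual ℂ (Verma lam))
    (D : Verma lam →ₗ[ℂ] Module.Dual ℂ (Verma lam)) : Prop where
  map_ket : D (ket lam) = bra
  map_e : ∀ (p : Fin (r + 1)) (w : Verma lam), D (act lam (cur r e p) w) = D w ∘ₗ act lam (cur r f p)
  map_f : ∀ (p : Fin (r + 1)) (w : Verma lam), D (act lam (cur r f p) w) = D w ∘ₗ act lam (cur r e p)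
  map_h : ∀ (p : Fin (r + 1)) (w : Verma lam), D (act lam (cur r h p) w) = D w ∘ₗ act lam (cur r h p)

/-! ### The differential realization -/

/-- `∑ p, x_p e[p]` acting on `ℂ[x_0, …, x_r] ⊗ M(lam)`. -/
def xe {r : ℕ} (lam : Fin (r + 1) → ℂ) :
    Module.End ℂ (MvPolynomial (Fin (r + 1)) ℂ ⊗[ℂ] Verma lam) :=
  ∑ p : Fin (r + 1),
    TensorProduct.map (LinearMap.mulLeft ℂ (MvPolynomial.X p)) (act lam (cur r e p))

/-- The polynomial `⟨φ| Z |v⟩`, where `Z = exp (∑ p, x_p e[p])`. The exponential series is a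
finite sum, because the `e[p]` act locally nilpotently. -/
def matZ {r : ℕ} (lam : Fin (r + 1) → ℂ) (φ : Module.Dual ℂ (Verma lam)) (v : Verma lam) :
    MvPolynomial (Fin (r + 1)) ℂ :=
  ∑ᶠ k : ℕ, ((k.factorial : ℂ)⁻¹) •
    TensorProduct.rid ℂ (MvPolynomial (Fin (r + 1)) ℂ)
      (LinearMap.lTensor (MvPolynomial (Fin (r + 1)) ℂ) φ ((xe lam ^ k) (1 ⊗ₜ[ℂ] v)))

/-- The operator `S[p]`, which satisfies `S[p] ⟨lam| Z = ⟨lam| e[p] Z`: for `sl₂` the `e[p]`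
commute, so that it is the partial derivative in `x_p`. -/
def screen {r : ℕ} (p : Fin (r + 1)) : Module.End ℂ (MvPolynomial (Fin (r + 1)) ℂ) :=
  (MvPolynomial.pderiv p).toLinearMap

/-- The operator `S[p_1] ⋯ S[p_k]`. -/
def screenWord {r : ℕ} (ps : List (Fin (r + 1))) : Module.End ℂ (MvPolynomial (Fin (r + 1)) ℂ) :=
  (ps.map screen).prod

/-! ### The `βγ` system and its correlation functions -/

/-- The Fock space: `X (inl k)` is `β_{-1-k}` and `X (inr k)` is `γ_{-k}` (`k ≥ 0`). -/
abbrev Fock : Type := MvPolynomial (ℕ ⊕ ℕ) ℂ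

/-- The modes of `β(z) = ∑ β_k z ^ (-k-1)`. -/
def betaMode (k : ℤ) : Module.End ℂ Fock :=
  if 0 ≤ k then (MvPolynomial.pderiv (Sum.inr k.toNat)).toLinearMap
  else LinearMap.mulLeft ℂ (MvPolynomial.X (Sum.inl (-1 - k).toNat))

/-- The modes of `γ(z) = ∑ γ_k z ^ (-k)`; one has `[β_j, γ_k] = δ_{j+k,0}`, that is,
`β(z) γ(w) = 1 / (z - w) + ⋯`. -/
def gammaMode (k : ℤ) : Module.End ℂ Fock :=
  if 0 < k then -(MvPolynomial.pderiv (Sum.inl (k - 1).toNat)).toLinearMap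
  else LinearMap.mulLeft ℂ (MvPolynomial.X (Sum.inr (-k).toNat))

/-- The terms of the mode expansion of `β(t)`. -/
def betaField (t : ℂ) (k : ℤ) : Module.End ℂ Fock := t ^ (-k - 1) • betaMode k

/-- The terms of the mode expansion of `∂ ^ p γ(z) / p!`. -/
def gammaField (p : ℕ) (z : ℂ) (k : ℤ) : Module.End ℂ Fock :=
  ((Ring.choose (-k) p : ℤ) * z ^ (-k - p) : ℂ) • gammaMode k

/-- The vacuum expectation value `⟨A_1 ⋯ A_N⟩` of a product of fields, given by the terms of their
mode expansions, converges (absolutely) to `c`. -/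
def HasVev (A : List (ℤ → Module.End ℂ Fock)) (c : ℂ) : Prop :=
  HasSum (fun k : Fin A.length → ℤ =>
    MvPolynomial.constantCoeff ((List.ofFn fun i => A.get i (k i)).prod (1 : Fock))) c

/-- The points `t_1, …, t_m, z_1, …, z_n`. -/
abbrev Pts (m n : ℕ) : Type := Fin m ⊕ Fin n → ℂ

/-- The fields `β(t_1) ⋯ β(t_m) ∏ a, ∏ p, (∂ ^ p γ(z_a) / p!) ^ (d a p)`. The screening current of
`sl₂` without its exponential factor is `S(t) = β(t)`. -/
def bgFields {m n : ℕ} {r : Fin n → ℕ} (w : Pts m n) (d : ∀ a, Fin (r a + 1) →₀ ℕ) :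
    List (ℤ → Module.End ℂ Fock) :=
  (List.ofFn fun i : Fin m => betaField (w (Sum.inl i))) ++
    (List.ofFn fun a : Fin n => (List.ofFn fun p : Fin (r a + 1) =>
      List.replicate (d a p) (gammaField p (w (Sum.inr a)))).flatten).flatten

/-- A rational function of the points, regular wherever they are pairwise distinct. -/
def IsRegular {m n : ℕ} (η : Pts m n → ℂ) : Prop :=
  ∃ p q : MvPolynomial (Fin m ⊕ Fin n) ℂ, ∀ w : Pts m n, Function.Injective w →
    MvPolynomial.eval w q ≠ 0 ∧ η w = MvPolynomial.eval w p / MvPolynomial.eval w q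

/-- `ω` is the correlation function `⟨S(t_1) ⋯ S(t_m) ∏ a, P_a(γ(z_a))⟩`, where `x_p` is replaced
with `∂ ^ p γ(z_a) / p!` in `P_a`: the rational function which in the domain `|z_a| < |t_i|` is the
vacuum expectation value, computed from those of the monomials of the `P_a` by linearity. -/
def IsBGCorrelation {m n : ℕ} {r : Fin n → ℕ} (P : ∀ a, MvPolynomial (Fin (r a + 1)) ℂ)
    (ω : Pts m n → ℂ) : Prop :=
  IsRegular ω ∧
  ∀ w : Pts m n, Function.Injective w → (∀ i a, ‖w (Sum.inr a)‖ < ‖w (Sum.inl i)‖) →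
    ∃ c : (∀ a, Fin (r a + 1) →₀ ℕ) → ℂ, (∀ d, HasVev (bgFields w d) (c d)) ∧
      ω w = ∑ d ∈ Fintype.piFinset (fun a => (P a).support),
        (∏ a, MvPolynomial.coeff (d a) (P a)) * c d

/-- The term `P(a, I)` for `I = {i_1 < ⋯ < i_k}`. -/
def partTerm {m r : ℕ} (P : MvPolynomial (Fin (r + 1)) ℂ) (t : Fin m → ℂ) (z : ℂ)
    (I : Finset (Fin m)) : ℂ :=
  ∑ p : Fin I.card → Fin (r + 1),
    MvPolynomial.constantCoeff (screenWord (List.ofFn p) P) /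
      ∏ j, (t (I.orderEmbOfFin rfl j) - z) ^ ((p j : ℕ) + 1)

/-- The sequences `(I_1, …, I_n)` of pairwise disjoint, possibly empty subsets with union
`{1, …, m}`. -/
def partitions (m n : ℕ) : Finset (Fin n → Finset (Fin m)) :=
  {I | (∀ a b, a ≠ b → Disjoint (I a) (I b)) ∧ Finset.univ.biUnion I = Finset.univ}

/-- `∑ (I_1, …, I_n), ∏ a, P(a, I_a)`. -/
def partitionSum {m n : ℕ} {r : Fin n → ℕ} (P : ∀ a, MvPolynomial (Fin (r a + 1)) ℂ)
    (t : Fin m → ℂ) (z : Fin n → ℂ) : ℂ :=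
  ∑ I ∈ partitions m n, ∏ a, partTerm (P a) t (z a) (I a)

/-! ### The correlation function of the free boson and the master function -/

/-- The weights `lam a p = (λ^{(a)})_p (h)`, that is, `(λ^{(a)})_p = lam a p • α / 2`. -/
abbrev Weights {n : ℕ} (r : Fin n → ℕ) : Type := ∀ a : Fin n, Fin (r a + 1) → ℂ

/-- The exponents of the normally ordered exponentials at the points, in units of `α`: the
coefficient of `(α, ∂ ^ p φ / p!)` is `-1` (for `p = 0`) at `t_i` and `lam a p / 2` at `z_a`. -/
def charge {m n : ℕ} {r : Fin n → ℕ} (lam : Weights r) : Fin m ⊕ Fin n → ℕ → ℂ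
  | Sum.inl _, p => if p = 0 then -1 else 0
  | Sum.inr a, p => if hp : p < r a + 1 then lam a ⟨p, hp⟩ / 2 else 0

/-- The largest order of a derivative of `φ` at the points. -/
def order {m n : ℕ} (r : Fin n → ℕ) : Fin m ⊕ Fin n → ℕ
  | Sum.inl _ => 0
  | Sum.inr a => r a

/-- The bilinear form on the weights of `sl₂`, in units of `α`: `(α, α) = 2`. -/
def form (c d : ℂ) : ℂ := 2 * c * d

/-- The branch of `log` near `x₀` with the value `l` at `x₀` (`exp l = x₀ ≠ 0`). -/
def logNear (x₀ l x : ℂ) : ℂ := l + Complex.log (x / x₀)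

/-- `∂_z ^ p ∂_w ^ q log (z - w) / (p! q!)` at `(z₀, w₀)`, where `l` is the value of the logarithm. -/
def propagator (z₀ w₀ l : ℂ) (p q : ℕ) : ℂ :=
  ((p.factorial : ℂ) * (q.factorial : ℂ))⁻¹ *
    iteratedDeriv p (fun z => iteratedDeriv q (fun w => logNear (z₀ - w₀) l (z - w)) w₀) z₀

open Classical in
/-- The correlation function `Ψ` of the normally ordered exponentials
`∏ i, :exp (-αφ(t_i)): ∏ a, :exp (∑ p, (λ^{(a)})_p ∂ ^ p φ(z_a) / p!):` of the free boson with
`(λ, φ(z)) (μ, φ(w)) = (λ, μ) / κ log (z - w) + ⋯`, as a function on the universal family of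
logarithms `l j k` of the differences `w j - w k` (for `j` before `k`). -/
def psi {m n : ℕ} {r : Fin n → ℕ} (κ : ℂ) (lam : Weights r) (w : Pts m n)
    (l : Fin m ⊕ Fin n → Fin m ⊕ Fin n → ℂ) : ℂ :=
  Complex.exp (∑ j : Fin m ⊕ Fin n, ∑ k : Fin m ⊕ Fin n, if toLex j < toLex k then
    ∑ p ∈ Finset.range (order r j + 1), ∑ q ∈ Finset.range (order r k + 1),
      form (charge lam j p) (charge lam k q) / κ * propagator (w j) (w k) (l j k) p q else 0)

/-- States of the free boson `(α, φ(z)) = q + a_0 log z - ∑ k ≠ 0, a_k z ^ (-k) / k`, with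
`[a_j, a_k] = (2 / κ) j δ_{j+k,0}` and `[a_0, q] = 2 / κ`: a momentum `μ`, on which
`a_0 = 2 μ / κ`, and a function of the variables `y_k = a_{-(k+1)}`, on which
`a_{k+1} = (2 / κ) (k + 1) ∂ / ∂ y_k`. -/
abbrev BosonState : Type := ℂ × ((ℕ → ℂ) → ℂ)

/-- The operator `:exp (∑ p ≤ R, c p (α, ∂ ^ p φ(w)) / p!):`, where `l` is the value of `log w`:
the product of the exponential of the creation part, that of `c 0 • q`, that of the part in
`a_0`, and that of the annihilation part, which is a translation of the variables. -/
def vertexOp (κ : ℂ) (c : ℕ → ℂ) (R : ℕ) (w l : ℂ) (s : BosonState) : BosonState :=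
  (s.1 + c 0, fun y =>
    Complex.exp (∑' k : ℕ, y k / (k + 1) *
      ∑ p ∈ Finset.range (R + 1), c p * (Ring.choose ((k : ℤ) + 1) p : ℤ) * w ^ ((k : ℤ) + 1 - p)) *
    Complex.exp (2 * s.1 / κ *
      (c 0 * l + ∑ p ∈ Finset.Icc 1 R, c p * ((-1) ^ (p - 1) / (p * w ^ p)))) *
    s.2 (fun k => y k - 2 / κ *
      ∑ p ∈ Finset.range (R + 1), c p * (Ring.choose (-((k : ℤ) + 1)) p : ℤ) *
        w ^ (-((k : ℤ) + 1) - p)))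

/-- The vacuum expectation value of the product of the normally ordered exponentials, in the order
`t_1, …, t_m, z_1, …, z_n`; `l j` is the value of `log (w j)`. -/
def bosonVev {m n : ℕ} {r : Fin n → ℕ} (κ : ℂ) (lam : Weights r) (w : Pts m n)
    (l : Fin m ⊕ Fin n → ℂ) : ℂ :=
  (((List.ofFn (Sum.inl : Fin m → Fin m ⊕ Fin n)) ++
    (List.ofFn (Sum.inr : Fin n → Fin m ⊕ Fin n))).foldr
      (fun j s => vertexOp κ (charge lam j) (order r j) (w j) (l j) s)
      ((0 : ℂ), fun _ : ℕ → ℂ => (1 : ℂ))).2 0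

/-- The master function of the integral formula for the solutions of the confluent Knizhnik-
Zamolodchikov equations for `sl₂`; `l j k` is the value of the logarithm of `w j - w k`. -/
def master {m n : ℕ} {r : Fin n → ℕ} (κ : ℂ) (lam : Weights r) (w : Pts m n)
    (l : Fin m ⊕ Fin n → Fin m ⊕ Fin n → ℂ) : ℂ :=
  (∏ a : Fin n, ∏ b ∈ Finset.Ioi a,
    (Complex.exp (lam a 0 * lam b 0 / (2 * κ) * l (Sum.inr a) (Sum.inr b)) *
      Complex.exp (∑ p : Fin (r a + 1), ∑ q : Fin (r b + 1),
        if 0 < (p : ℕ) + q then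
          lam a p * lam b q / (2 * κ) * ((p + q : ℕ).choose p : ℂ) *
            ((-1) ^ ((p : ℕ) + 1) / ((p : ℕ) + (q : ℕ) : ℂ)) *
              (1 / (w (Sum.inr a) - w (Sum.inr b)) ^ ((p : ℕ) + q)) else 0))) *
  (∏ i : Fin m, ∏ j ∈ Finset.Ioi i, Complex.exp (2 / κ * l (Sum.inl i) (Sum.inl j))) *
  ∏ i : Fin m, ∏ a : Fin n,
    (Complex.exp (-lam a 0 / κ * l (Sum.inl i) (Sum.inr a)) *
      Complex.exp (∑ p : Fin (r a), lam a p.succ / κ *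
        (1 / (((p : ℕ) + 1 : ℂ) * (w (Sum.inl i) - w (Sum.inr a)) ^ ((p : ℕ) + 1)))))

/-! ### Integration over chains with coefficients in the local system of `Ψ` -/

/-- The data of a twisted `m`-chain: finitely many pieces, parametrized by subsets of `ℝ ^ m`, with
complex coefficients and, depending on `z`, a choice of the logarithms of the differences. -/
structure Chain (m n : ℕ) where
  N : ℕ
  coeff : Fin N → ℂ
  dom : Fin N → Set (Fin m → ℝ)
  map : Fin N → (Fin m → ℝ) → (Fin m → ℂ)
  log : Fin N → (Fin n → ℂ) → (Fin m → ℝ) → Fin m ⊕ Fin n → Fin m ⊕ Fin n → ℂ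

namespace Chain

variable {m n : ℕ} (Γ : Chain m n)

/-- The points `(t, z)`. -/
def pts (i : Fin Γ.N) (z : Fin n → ℂ) (s : Fin m → ℝ) : Pts m n := Sum.elim (Γ.map i s) z

/-- The factor `dt_1 ∧ ⋯ ∧ dt_m = jac • ds_1 ∧ ⋯ ∧ ds_m`. -/
def jac (i : Fin Γ.N) (s : Fin m → ℝ) : ℂ :=
  Matrix.det (Matrix.of fun j k : Fin m => fderiv ℝ (Γ.map i) s (Pi.single k 1) j)

/-- The integrand of `∫ g dt_1 ∧ ⋯ ∧ dt_m` on a piece of the chain. -/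
def integrand (z : Fin n → ℂ) (g : Pts m n → (Fin m ⊕ Fin n → Fin m ⊕ Fin n → ℂ) → ℂ)
    (i : Fin Γ.N) (s : Fin m → ℝ) : ℂ :=
  g (Γ.pts i z s) (Γ.log i z s) * Γ.jac i s

/-- `∫ g dt_1 ∧ ⋯ ∧ dt_m`, for a function `g` of the points and of the logarithms. -/
def integral (z : Fin n → ℂ) (g : Pts m n → (Fin m ⊕ Fin n → Fin m ⊕ Fin n → ℂ) → ℂ) : ℂ :=
  ∑ i, Γ.coeff i * ∫ s in Γ.dom i, Γ.integrand z g i s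

/-- The integral converges. -/
def Converges (z : Fin n → ℂ)
    (g : Pts m n → (Fin m ⊕ Fin n → Fin m ⊕ Fin n → ℂ) → ℂ) : Prop :=
  ∀ i, IntegrableOn (Γ.integrand z g i) (Γ.dom i)

/-- For `z ∈ Z` the pieces are continuously differentiable, the points are pairwise distinct, and
the logarithms are continuous. -/
structure IsTwisted (Z : Set (Fin n → ℂ)) : Prop where
  measurable : ∀ i, MeasurableSet (Γ.dom i)
  smooth : ∀ i, ∀ s ∈ Γ.dom i, ContDiffAt ℝ 1 (Γ.map i) s
  distinct : ∀ i, ∀ z ∈ Z, ∀ s ∈ Γ.dom i, Function.Injective (Γ.pts i z s)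
  exp_log : ∀ i, ∀ z ∈ Z, ∀ s ∈ Γ.dom i, ∀ j k, toLex j < toLex k →
    Complex.exp (Γ.log i z s j k) = Γ.pts i z s j - Γ.pts i z s k
  continuous_log : ∀ i j k, toLex j < toLex k →
    ContinuousOn (fun x : (Fin n → ℂ) × (Fin m → ℝ) => Γ.log i x.1 x.2 j k) (Z ×ˢ Γ.dom i)

end Chain

/-- The parameters `(z, lam)`. -/
abbrev Params {n : ℕ} (r : Fin n → ℕ) : Type := (Fin n → ℂ) × Weights r

/-- `U` is open in the space of the variables `z_a` and `lam a p` (`p ≥ 1`), for all values of the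
parameters `lam a 0`. -/
def IsOpenFor {n : ℕ} {r : Fin n → ℕ} (U : Set (Params r)) : Prop :=
  ∀ x ∈ U, ∀ᶠ y in 𝓝 x, (∀ a, y.2 a 0 = x.2 a 0) → y ∈ U

/-- `∂ (Ψ η) / ∂ t_i` at the point `w`, where `l` gives the branch of `Ψ`. -/
def derivPsi {m n : ℕ} {r : Fin n → ℕ} (κ : ℂ) (lam : Weights r) (η : Pts m n → ℂ) (i : Fin m)
    (w : Pts m n) (l : Fin m ⊕ Fin n → Fin m ⊕ Fin n → ℂ) : ℂ :=
  deriv (fun ζ => psi κ lam (Function.update w (Sum.inl i) ζ)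
      (fun j k => logNear (w j - w k) (l j k)
        (Function.update w (Sum.inl i) ζ j - Function.update w (Sum.inl i) ζ k)) *
    η (Function.update w (Sum.inl i) ζ)) (w (Sum.inl i))

/-- `Γ` is a twisted cycle for all parameters in `U`: the integrals of `Ψ η` for rational `η`
converge locally uniformly in the parameters, and Stokes' formula holds without boundary terms. -/
structure Chain.IsCycle {m n : ℕ} {r : Fin n → ℕ} (Γ : Chain m n) (κ : ℂ) (U : Set (Params r)) :
    Prop extends Γ.IsTwisted (Prod.fst '' U) where
  dominated : ∀ η : Pts m n → ℂ, IsRegular η → ∀ i, ∀ x ∈ U, ∃ V ∈ 𝓝 x, ∃ g : (Fin m → ℝ) → ℝ,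
    IntegrableOn g (Γ.dom i) ∧ ∀ y ∈ V ∩ U, ∀ s ∈ Γ.dom i,
      ‖Γ.integrand y.1 (fun w l => psi κ y.2 w l * η w) i s‖ ≤ g s
  stokes : ∀ η : Pts m n → ℂ, IsRegular η → ∀ i, ∀ x ∈ U,
    Γ.integral x.1 (derivPsi κ x.2 η i) = 0

/-! ### The tensor product of confluent Verma modules and the integral formula -/

/-- `M(λ^{(1)}) ⊗ ⋯ ⊗ M(λ^{(n)})`. -/
abbrev TensorVerma {n : ℕ} {r : Fin n → ℕ} (lam : Weights r) : Type :=
  PiTensorProduct ℂ (fun a : Fin n => Verma (lam a))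

/-- The operator `x^{(a)}[p]`: the action of `x[p]` on the factor with the number `a`. -/
def siteOp {n : ℕ} {r : Fin n → ℕ} (lam : Weights r) (a : Fin n) (x : Sl2) (p : ℕ) :
    Module.End ℂ (TensorVerma lam) :=
  PiTensorProduct.map
    (Function.update (fun b => (LinearMap.id : Verma (lam b) →ₗ[ℂ] Verma (lam b))) a
      (act (lam a) (cur (r a) x p)))

/-- Polynomials in the commuting elements `f^{(a)}[p]`, `0 ≤ p ≤ r a`. -/
abbrev FPoly {n : ℕ} (r : Fin n → ℕ) : Type := MvPolynomial (Σ a : Fin n, Fin (r a + 1)) ℂ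

/-- The vector `u |λ^{(1)}⟩ ⊗ ⋯ ⊗ |λ^{(n)}⟩` for a polynomial `u` in the `f^{(a)}[p]`. This
identifies the modules for different `lam` with a fixed vector space. -/
def toVerma {n : ℕ} {r : Fin n → ℕ} (lam : Weights r) (u : FPoly r) : TensorVerma lam :=
  ∑ d ∈ u.support, MvPolynomial.coeff d u •
    PiTensorProduct.tprod ℂ (fun a : Fin n =>
      act (lam a) ((List.ofFn fun p : Fin (r a + 1) => cur (r a) f p ^ d ⟨a, p⟩).prod) (ket (lam a)))

/-- The integral formula
`u = ∫ master • ∏ j, (∑ a, ∑ p, f^{(a)}[p] / (t_j - z_a) ^ (p + 1)) dt_1 ∧ ⋯ ∧ dt_m`, expanded. -/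
def jnsIntegral {m n : ℕ} {r : Fin n → ℕ} (κ : ℂ) (Γ : Chain m n) (x : Params r) : FPoly r :=
  ∑ c : Fin m → (Σ a : Fin n, Fin (r a + 1)),
    MvPolynomial.C (Γ.integral x.1 (fun w l => master κ x.2 w l *
      ∏ j, 1 / (w (Sum.inl j) - w (Sum.inr (c j).1)) ^ (((c j).2 : ℕ) + 1))) *
    ∏ j, MvPolynomial.X (c j)

/-- The dual vector `⟨u*|` of a vector `u` of the tensor product. -/
def dualVector {n : ℕ} {r : Fin n → ℕ} {lam : Weights r}
    (D : ∀ a, Verma (lam a) →ₗ[ℂ] Module.Dual ℂ (Verma (lam a))) (u : TensorVerma lam) :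
    Module.Dual ℂ (TensorVerma lam) :=
  PiTensorProduct.dualDistrib (PiTensorProduct.map D u)

/-! ### The confluent Knizhnik-Zamolodchikov equations

For each point `z_a` there are `r a + 1` equations, numbered by `K = 0, …, r a`: that with `K = 0`
for `∂ / ∂ z_a`, that with `K = k + 1` for the vector field
`D_k = ∑ p ≥ 1, p λ_{p+k} ∂ / ∂ λ_p` and the derivation `d_k (f[p]) = p f[p + k]`. -/

/-- `h^{(a)}[p] h^{(b)}[q] / 2 + e^{(a)}[p] f^{(b)}[q] + f^{(a)}[p] e^{(b)}[q]`. -/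
def casimir {n : ℕ} {r : Fin n → ℕ} (lam : Weights r) (a b : Fin n) (p q : ℕ) :
    Module.End ℂ (TensorVerma lam) :=
  (1 / 2 : ℂ) • (siteOp lam a h p * siteOp lam b h q) +
    siteOp lam a e p * siteOp lam b f q + siteOp lam a f p * siteOp lam b e q

/-- The confluent Gaudin Hamiltonian: the coefficient of `(z - z_a) ^ (-K - 1)` in
`(h(z)² / 2 + e(z) f(z) + f(z) e(z)) / 2`, where
`x(z) = ∑ a, ∑ p, x^{(a)}[p] / (z - z_a) ^ (p + 1)`. -/
def hamiltonian {n : ℕ} {r : Fin n → ℕ} (x : Params r) (a : Fin n) (K : ℕ) :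
    Module.End ℂ (TensorVerma x.2) :=
  (∑ p ∈ Finset.range K, (1 / 2 : ℂ) • casimir x.2 a a p (K - 1 - p)) +
    ∑ b ∈ Finset.univ.erase a, ∑ p ∈ Finset.Icc K (r a), ∑ q ∈ Finset.range (r b + 1),
      ((-1) ^ (p - K) * ((p - K + q).choose q : ℂ) / (x.1 a - x.1 b) ^ (p - K + q + 1)) •
        casimir x.2 a b p q

/-- The value of `lam p`, extended by `0` for `p > r`. -/
def ext0 {r : ℕ} (lam : Fin (r + 1) → ℂ) (p : ℕ) : ℂ :=
  if hp : p < r + 1 then lam ⟨p, hp⟩ else 0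

/-- The scalar by which the part of the Hamiltonian with both factors at `z_a` acts on the highest
weight vector: `∑ p + q = k, (λ_p, λ_q) / 2 + (k + 1) (ρ, λ_k)`, where `K = k + 1`. -/
def selfTerm {r : ℕ} (lam : Fin (r + 1) → ℂ) (K : ℕ) : ℂ :=
  (∑ p ∈ Finset.range K, ext0 lam p * ext0 lam (K - 1 - p)) / 4 + K * ext0 lam (K - 1) / 2

/-- The line through `x` in the direction of the vector field with the number `K` at `z_a`. -/
def shift {n : ℕ} {r : Fin n → ℕ} (x : Params r) (a : Fin n) (K : ℕ) (s : ℂ) : Params r :=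
  if K = 0 then (Function.update x.1 a (x.1 a + s), x.2)
  else (x.1, Function.update x.2 a
    (fun p => x.2 a p + s * ((p : ℕ) * ext0 (x.2 a) ((p : ℕ) + (K - 1)))))

/-- The derivation `d_k` of the factor with the number `a`, where `K = k + 1`; zero for `K = 0`. -/
def dDer {n : ℕ} (r : Fin n → ℕ) (a : Fin n) (K : ℕ) : Derivation ℂ (FPoly r) (FPoly r) :=
  MvPolynomial.mkDerivation ℂ (fun c =>
    if c.1 = a ∧ 1 ≤ K then
      if hq : (c.2 : ℕ) + (K - 1) < r c.1 + 1 then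
        MvPolynomial.C ((c.2 : ℕ) : ℂ) * MvPolynomial.X ⟨c.1, ⟨(c.2 : ℕ) + (K - 1), hq⟩⟩ else 0
    else 0)

/-- `u` is a solution of the confluent Knizhnik-Zamolodchikov equations on `U`:
`κ ∂u/∂z_a = G_{-1}^{(a)} u` and, for `0 ≤ k < r a`,
`κ (D_k^{(a)} + d_k^{(a)}) u = (G_k^{(a)} - selfTerm_k^{(a)}) u`. -/
def SolvesKZ {n : ℕ} {r : Fin n → ℕ} (κ : ℂ) (U : Set (Params r)) (u : Params r → FPoly r) :
    Prop :=
  ∀ x ∈ U, ∀ a : Fin n, ∀ K ≤ r a, ∃ u' : FPoly r,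
    (∀ d, HasDerivAt (fun s : ℂ => MvPolynomial.coeff d (u (shift x a K s)))
      (MvPolynomial.coeff d u') 0) ∧
    κ • toVerma x.2 (u' + dDer r a K (u x)) =
      hamiltonian x a K (toVerma x.2 (u x)) - selfTerm (x.2 a) K • toVerma x.2 (u x)

end ConfluentSl2

end

noncomputable section

namespace ConfluentSl2

/-! ### Currents -/

section Currents

attribute [local instance] LieRing.ofAssociativeRing

/-! Duality. Polynomials in commuting variables `y_0, …, y_r` carry a realization of the truncated
current algebra: `f[p]` multiplies by `y_p`, `h[p]` is of first order and `e[p]` of second order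
(`exists_realization`). The constant term in this realization is `⟨λ|`. Composing `⟨λ|` with the
anti-involution that exchanges `e[p]` and `f[p]` gives `u ↦ ⟨u*|`; the defining properties of `⟨λ|`
say precisely that the composite kills the left ideal of the Verma module. Both objects are unique
because the words in the `f[p]` applied to `|λ⟩` span.

The function `ω`. Since the `e[p]` commute, `∂/∂x_p` applied to `Z` inserts `e[p]`, which gives the
matrix elements. In a vacuum expectation value `β(t)` acts on polynomials in the fields `∂^p
γ(z_a)/p!` as a derivation: it replaces one of them with its contraction `1/(t - z_a)^{p+1}`
(`wick`, `hasSum_contraction`). Hence `ω` is the constant term of a product of commuting derivations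
applied to `∏ P_a`. The Leibniz rule distributes `t_1, …, t_m` over the factors, which is the sum
over partitions; commutativity makes it symmetric, so that averaging over permutations changes
nothing. A regular rational function is determined by its values at radially ordered points
(`IsRegular.eq_of_radial`).

The function `Ψ`. Each pair of vertex operators contributes a zero-mode term and a binomial or
logarithmic series in the ratio of the points; together they give the derivatives of `log (x - y)`
(`pairTerm_eq`). Evaluating these derivatives yields the master function.

The pairing. Expanded in partial derivatives, each derivation applied to `∏ P_a` becomes some
`e^{(a)}[p]` on `v_a`, that is, `f^{(a)}[p]` on the other side of the pairing. So `ω` is, at every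
point, the pairing of `v` with the dual of `∏ f(t_j)|λ⟩` (`bgCorrelation_matZ`), and integration
against `Ψ` gives the formula.

The KZ equations. The quadratic current `T(ζ)` satisfies `[T(ζ), f(t)] = (F(ζ) h(t) - f(t) H(ζ)) /
(ζ - t)` (`casimir_commutator`). Its polar coefficients at `z_a` give the commutator of a Gaudin
Hamiltonian with `f(t)`, and induction over the factors gives the off-shell Bethe equation
(`apply_prod_offShell`): on `∏ f(t_j)|λ⟩` the Hamiltonian gives a multiple of the vector plus
unwanted terms, in which one `f(t_j)` is replaced with the current whose modes are shifted by `K`.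
Up to `selfTerm`, the multiple is `κ` times the logarithmic derivative of `Ψ` along the KZ vector
field (`logDeriv_inr`), and the coefficient of the unwanted term is `κ ∂ log Ψ/∂t_j`
(`logDeriv_inl`). The derivative of `f(t_j)` along the vector field, together with `d_k`, is minus
the `t_j`-derivative of the shifted current (`sum_kernelDeriv_add_dDer`). So under the integral the
two sides of the equation differ by total derivatives, and Stokes' formula removes these.
Differentiation under the integral sign uses the domination of the integrand and Cauchy's estimate.
-/

lemma sl2_eq (x : Sl2) : x = x.val 0 1 • e + x.val 1 0 • f + x.val 0 0 • h := by
  have htr : x.val 0 0 + x.val 1 1 = 0 := by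
    have := (LieAlgebra.SpecialLinear.sl (Fin 2) ℂ).mem_coe.mp x.2
    have h2 : Matrix.trace x.val = 0 := by simpa [LieAlgebra.SpecialLinear.sl] using this
    simpa [Matrix.trace, Fin.sum_univ_two] using h2
  apply Subtype.ext
  ext i j
  fin_cases i <;> fin_cases j <;>
    simp [e, f, h, Matrix.single, eq_neg_of_add_eq_zero_right htr]

lemma lie_e_f : ⁅e, f⁆ = h := by
  apply Subtype.ext
  rw [LieAlgebra.SpecialLinear.sl_bracket]
  ext i j
  fin_cases i <;> fin_cases j <;> simp [e, f, h, Matrix.single, Matrix.mul_apply]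

lemma lie_h_e : ⁅h, e⁆ = (2 : ℂ) • e := by
  apply Subtype.ext
  rw [LieAlgebra.SpecialLinear.sl_bracket]
  ext i j
  fin_cases i <;> fin_cases j <;>
    (simp [e, h, Matrix.single, Matrix.mul_apply]; try norm_num)

lemma lie_h_f : ⁅h, f⁆ = (-2 : ℂ) • f := by
  apply Subtype.ext
  rw [LieAlgebra.SpecialLinear.sl_bracket]
  ext i j
  fin_cases i <;> fin_cases j <;>
    (simp [f, h, Matrix.single, Matrix.mul_apply]; try norm_num)

/-- The class of `t ^ p` in the truncated polynomial ring. -/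
def tpow (r p : ℕ) : TruncPoly r :=
  Ideal.Quotient.mk (Ideal.span {(Polynomial.X : ℂ[X]) ^ (r + 1)}) (Polynomial.X ^ p)

lemma tpow_mul (r p q : ℕ) : tpow r p * tpow r q = tpow r (p + q) := by
  exact (map_mul _ _ _).symm.trans (congrArg _ (pow_add _ _ _).symm)

lemma mk_monomial (r n : ℕ) (c : ℂ) :
    Ideal.Quotient.mk (Ideal.span {(Polynomial.X : ℂ[X]) ^ (r + 1)}) (Polynomial.monomial n c) =
      c • tpow r n := by
  rw [← Polynomial.smul_X_eq_monomial]; rfl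

lemma cur_eq (r : ℕ) (x : Sl2) (p : ℕ) :
    cur r x p = UniversalEnvelopingAlgebra.ι ℂ (tpow r p ⊗ₜ[ℂ] x : TruncSl2 r) := rfl

lemma bracket_tmul (r : ℕ) (s s' : TruncPoly r) (x y : Sl2) :
    (⁅(s ⊗ₜ[ℂ] x : TruncSl2 r), (s' ⊗ₜ[ℂ] y : TruncSl2 r)⁆ : TruncSl2 r) =
      (s * s') ⊗ₜ[ℂ] ⁅x, y⁆ := rfl

lemma cur_mul_sub (r : ℕ) (x y : Sl2) (p q : ℕ) :
    cur r x p * cur r y q - cur r y q * cur r x p = cur r ⁅x, y⁆ (p + q) := by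
  rw [← LieRing.of_associative_ring_bracket, cur_eq, cur_eq, ← LieHom.map_lie, bracket_tmul,
    tpow_mul, cur_eq]

lemma cur_eq_zero {r : ℕ} (x : Sl2) {p : ℕ} (hp : r < p) : cur r x p = 0 := by
  unfold cur
  have : (Ideal.Quotient.mk (Ideal.span {(Polynomial.X : ℂ[X]) ^ (r + 1)})
      (Polynomial.X ^ p) : TruncPoly r) = 0 := by
    rw [Ideal.Quotient.eq_zero_iff_mem, Ideal.mem_span_singleton]
    exact pow_dvd_pow _ hp
  rw [this, TensorProduct.zero_tmul, map_zero]

lemma cur_add (r : ℕ) (x y : Sl2) (p : ℕ) : cur r (x + y) p = cur r x p + cur r y p := by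
  simp [cur, TensorProduct.tmul_add]

lemma cur_smul (r : ℕ) (c : ℂ) (x : Sl2) (p : ℕ) : cur r (c • x) p = c • cur r x p := by
  simp only [cur, TensorProduct.tmul_smul, map_smul]

lemma cur_zero (r : ℕ) (p : ℕ) : cur r 0 p = 0 := by simp [cur]

lemma cur_ef (r p q : ℕ) : cur r e p * cur r f q = cur r f q * cur r e p + cur r h (p + q) := by
  rw [← lie_e_f, ← cur_mul_sub]; abel

lemma cur_he (r p q : ℕ) :
    cur r h p * cur r e q = cur r e q * cur r h p + (2 : ℂ) • cur r e (p + q) := by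
  rw [← cur_smul, ← lie_h_e, ← cur_mul_sub]; abel

lemma cur_hf (r p q : ℕ) :
    cur r h p * cur r f q = cur r f q * cur r h p - (2 : ℂ) • cur r f (p + q) := by
  rw [sub_eq_add_neg, ← neg_smul, ← cur_smul, ← lie_h_f, ← cur_mul_sub]; abel

lemma cur_comm (r : ℕ) (x : Sl2) (p q : ℕ) : cur r x p * cur r x q = cur r x q * cur r x p := by
  rw [← sub_eq_zero, cur_mul_sub, lie_self, cur_zero]

/-- The enveloping algebra is generated by the currents. -/
lemma adjoin_cur (r : ℕ) :
    Algebra.adjoin ℂ (Set.range (cur r e) ∪ Set.range (cur r f) ∪ Set.range (cur r h)) = ⊤ := by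
  set S := Algebra.adjoin ℂ (Set.range (cur r e) ∪ Set.range (cur r f) ∪ Set.range (cur r h))
  have hι : ∀ x : TruncSl2 r, UniversalEnvelopingAlgebra.ι ℂ x ∈ S := by
    intro x
    induction x using TensorProduct.induction_on with
    | zero => rw [map_zero]; exact S.zero_mem
    | add x y hx hy => rw [map_add]; exact S.add_mem hx hy
    | tmul s x =>
      obtain ⟨s, rfl⟩ := Ideal.Quotient.mk_surjective s
      induction s using Polynomial.induction_on' with
      | add s s' hs hs' =>
        rw [map_add, TensorProduct.add_tmul, map_add]; exact S.add_mem hs hs'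
      | monomial n c =>
        have : UniversalEnvelopingAlgebra.ι ℂ ((c • tpow r n) ⊗ₜ[ℂ] x : TruncSl2 r) =
            c • cur r x n := by
          rw [← TensorProduct.smul_tmul', map_smul, cur_eq]
        rw [mk_monomial, this]
        refine S.smul_mem ?_ c
        rw [sl2_eq x, cur_add, cur_add, cur_smul, cur_smul, cur_smul]
        refine S.add_mem (S.add_mem (S.smul_mem ?_ _) (S.smul_mem ?_ _)) (S.smul_mem ?_ _) <;>
          apply Algebra.subset_adjoin <;> simp
  -- The inclusion of the Lie algebra factors through `S`. By the universal property the induced map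
  -- to `S`, followed by the inclusion of `S`, is the identity, so `S` is everything.
  let g : TruncSl2 r →ₗ⁅ℂ⁆ S :=
    { toFun := fun x => ⟨UniversalEnvelopingAlgebra.ι ℂ x, hι x⟩
      map_add' := fun x y => by ext; simp
      map_smul' := fun c x => by ext; simp
      map_lie' := fun {x y} => by
        ext; simp only [LieHom.map_lie, LieRing.of_associative_ring_bracket]; rfl }
  have key : S.val.comp (UniversalEnvelopingAlgebra.lift ℂ g) = AlgHom.id ℂ (UTrunc r) := by
    apply UniversalEnvelopingAlgebra.hom_ext
    ext x
    change S.val (UniversalEnvelopingAlgebra.lift ℂ g (UniversalEnvelopingAlgebra.ι ℂ x)) = _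
    rw [UniversalEnvelopingAlgebra.lift_ι_apply]
    rfl
  rw [eq_top_iff]
  rintro u -
  have := DFunLike.congr_fun key u
  rw [AlgHom.id_apply] at this
  rw [← this]
  exact (UniversalEnvelopingAlgebra.lift ℂ g u).2

/-- A representation of the truncated current algebra by operators that satisfy its relations. -/
lemma exists_algHom {A : Type*} [Ring A] [Algebra ℂ A] (r : ℕ) (E F H : ℕ → A)
    (hE : ∀ p, r < p → E p = 0) (hF : ∀ p, r < p → F p = 0) (hH : ∀ p, r < p → H p = 0)
    (hEF : ∀ p q, E p * F q = F q * E p + H (p + q))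
    (hHE : ∀ p q, H p * E q = E q * H p + (2 : ℂ) • E (p + q))
    (hHF : ∀ p q, H p * F q = F q * H p - (2 : ℂ) • F (p + q))
    (hEE : ∀ p q, E p * E q = E q * E p) (hFF : ∀ p q, F p * F q = F q * F p)
    (hHH : ∀ p q, H p * H q = H q * H p) :
    ∃ φ : UTrunc r →ₐ[ℂ] A, ∀ p, φ (cur r e p) = E p ∧ φ (cur r f p) = F p ∧
      φ (cur r h p) = H p := by
  -- A sequence that vanishes beyond `r` is the same as a linear map on `TruncPoly r`. Three such
  -- maps, weighted by the matrix entries of `x`, make up `ψ`.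
  have lin : ∀ G : ℕ → A, (∀ p, r < p → G p = 0) → ∃ g : TruncPoly r →ₗ[ℂ] A, ∀ p,
      g (tpow r p) = G p := by
    intro G hG
    let g₀ : ℂ[X] →ₗ[ℂ] A := Polynomial.lsum (fun p => LinearMap.toSpanSingleton ℂ A (G p))
    have hg₀ : ∀ p, g₀ (Polynomial.X ^ p) = G p := by
      intro p
      simp [g₀, Polynomial.lsum_apply, ← Polynomial.monomial_one_right_eq_X_pow]
    let I := (Ideal.span {(Polynomial.X : ℂ[X]) ^ (r + 1)}).restrictScalars ℂ
    have hI : I ≤ LinearMap.ker g₀ := by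
      intro s hs
      obtain ⟨s', rfl⟩ := Ideal.mem_span_singleton'.mp hs
      rw [LinearMap.mem_ker]
      induction s' using Polynomial.induction_on' with
      | add a b ha hb =>
        rw [add_mul, map_add, ha (Ideal.mem_span_singleton'.mpr ⟨_, rfl⟩),
          hb (Ideal.mem_span_singleton'.mpr ⟨_, rfl⟩), add_zero]
      | monomial n c =>
        rw [← Polynomial.smul_X_eq_monomial, smul_mul_assoc, ← pow_add, map_smul, hg₀,
          hG _ (by omega), smul_zero]
    exact ⟨I.liftQ g₀ hI, fun p => (I.liftQ_apply g₀ (Polynomial.X ^ p)).trans (hg₀ p)⟩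
  obtain ⟨gE, hgE⟩ := lin E hE
  obtain ⟨gF, hgF⟩ := lin F hF
  obtain ⟨gH, hgH⟩ := lin H hH
  let ent : Fin 2 → Fin 2 → Sl2 →ₗ[ℂ] ℂ := fun i j =>
    { toFun := fun x => x.val i j, map_add' := fun _ _ => rfl, map_smul' := fun _ _ => rfl }
  let pr : Sl2 →ₗ[ℂ] TruncPoly r →ₗ[ℂ] A :=
    (ent 0 1).smulRight gE + (ent 1 0).smulRight gF + (ent 0 0).smulRight gH
  let ψ : TruncSl2 r →ₗ[ℂ] A := TensorProduct.lift pr.flip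
  have hψ : ∀ (x : Sl2) (p : ℕ), ψ (tpow r p ⊗ₜ[ℂ] x) =
      x.val 0 1 • E p + x.val 1 0 • F p + x.val 0 0 • H p := by
    intro x p
    rw [← hgE, ← hgF, ← hgH]
    exact TensorProduct.lift.tmul _ _
  have hlie : ∀ x y : TruncSl2 r, ψ ⁅x, y⁆ = ψ x * ψ y - ψ y * ψ x := by
    intro x y
    induction x using TensorProduct.induction_on with
    | zero =>
      refine ((congrArg ψ (zero_lie (L := TruncSl2 r) y)).trans (map_zero ψ)).trans ?_
      rw [map_zero, zero_mul, mul_zero, sub_zero]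
    | add x x' hx hx' =>
      refine ((congrArg ψ (add_lie x x' y)).trans (map_add ψ _ _)).trans ?_
      rw [hx, hx', map_add]; noncomm_ring
    | tmul s x =>
    induction y using TensorProduct.induction_on with
    | zero =>
      refine ((congrArg ψ (lie_zero (s ⊗ₜ[ℂ] x : TruncSl2 r))).trans (map_zero ψ)).trans ?_
      rw [map_zero, zero_mul, mul_zero, sub_zero]
    | add y y' hy hy' =>
      refine ((congrArg ψ (lie_add (s ⊗ₜ[ℂ] x : TruncSl2 r) y y')).trans (map_add ψ _ _)).trans ?_
      rw [hy, hy', map_add]; noncomm_ring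
    | tmul s' y =>
    rw [bracket_tmul]
    obtain ⟨s, rfl⟩ := Ideal.Quotient.mk_surjective s
    obtain ⟨s', rfl⟩ := Ideal.Quotient.mk_surjective s'
    induction s using Polynomial.induction_on' with
    | add a b ha hb =>
      rw [map_add, add_mul, TensorProduct.add_tmul, TensorProduct.add_tmul, map_add, ha, hb,
        map_add]; noncomm_ring
    | monomial n c =>
    induction s' using Polynomial.induction_on' with
    | add a b ha hb =>
      rw [map_add, mul_add, TensorProduct.add_tmul, TensorProduct.add_tmul, map_add, ha, hb,
        map_add]; noncomm_ring
    | monomial n' c' =>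
    rw [mk_monomial, mk_monomial, smul_mul_smul_comm, tpow_mul, ← TensorProduct.smul_tmul',
      ← TensorProduct.smul_tmul', ← TensorProduct.smul_tmul', map_smul, map_smul, map_smul,
      hψ, hψ, hψ]
    have hb : ∀ i j, (⁅x, y⁆ : Sl2).val i j =
        x.val i 0 * y.val 0 j + x.val i 1 * y.val 1 j -
          (y.val i 0 * x.val 0 j + y.val i 1 * x.val 1 j) := by
      intro i j
      rw [LieAlgebra.SpecialLinear.sl_bracket]
      simp [Matrix.mul_apply, Fin.sum_univ_two]
    have htr : ∀ z : Sl2, z.val 1 1 = -z.val 0 0 := by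
      intro z
      conv_lhs => rw [sl2_eq z]
      simp [e, f, h, Matrix.single]
    rw [hb, hb, hb, htr, htr]
    simp only [mul_add, add_mul, smul_mul_assoc, mul_smul_comm, smul_smul, smul_add]
    -- The products are normalized so that those of `ψ x * ψ y` and `ψ y * ψ x` cancel and only the
    -- bracket terms remain.
    rw [hEF n n', hHE n n', hHF n n', hEE n n', hFF n n', hHH n n',
      show E n' * F n = F n * E n' + H (n + n') by rw [hEF, add_comm n'],
      show E n * H n' = H n' * E n - (2 : ℂ) • E (n + n') by rw [hHE, add_comm n']; abel,
      show F n * H n' = H n' * F n + (2 : ℂ) • F (n + n') by rw [hHF, add_comm n']; abel]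
    module
  let ψ' : TruncSl2 r →ₗ⁅ℂ⁆ A :=
    { ψ with
      map_lie' := fun {x y} => hlie x y }
  refine ⟨UniversalEnvelopingAlgebra.lift ℂ ψ', fun p => ⟨?_, ?_, ?_⟩⟩ <;>
  · rw [cur_eq, UniversalEnvelopingAlgebra.lift_ι_apply]
    refine (hψ _ p).trans ?_
    simp [e, f, h, Matrix.single]

end Currents

/-! ### The structure of the confluent Verma module -/

section Verma

variable {r : ℕ} (lam : Fin (r + 1) → ℂ)

lemma act_mul (u u' : UTrunc r) (v : Verma lam) :
    act lam (u * u') v = act lam u (act lam u' v) := by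
  rw [map_mul, Module.End.mul_apply]

lemma act_ket (u : UTrunc r) : act lam u (ket lam) = Submodule.Quotient.mk u := by
  change u • (Submodule.Quotient.mk 1 : Verma lam) = _
  rw [← Submodule.Quotient.mk_smul, smul_eq_mul, mul_one]

lemma exists_act_ket (v : Verma lam) : ∃ u : UTrunc r, act lam u (ket lam) = v := by
  obtain ⟨u, rfl⟩ := Submodule.Quotient.mk_surjective _ v
  exact ⟨u, act_ket lam u⟩

lemma act_e_ket (p : ℕ) : act lam (cur r e p) (ket lam) = 0 := by
  by_cases hp : p < r + 1
  · rw [act_ket, Submodule.Quotient.mk_eq_zero]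
    exact Submodule.subset_span (Or.inl ⟨⟨p, hp⟩, rfl⟩)
  · rw [cur_eq_zero e (by omega), map_zero, LinearMap.zero_apply]

lemma act_h_ket (p : ℕ) : act lam (cur r h p) (ket lam) = ext0 lam p • ket lam := by
  by_cases hp : p < r + 1
  · have h1 : (Submodule.Quotient.mk (cur r h p - algebraMap ℂ (UTrunc r) (lam ⟨p, hp⟩)) :
        Verma lam) = 0 := by
      rw [Submodule.Quotient.mk_eq_zero]
      exact Submodule.subset_span (Or.inr ⟨⟨p, hp⟩, rfl⟩)
    rw [← act_ket, map_sub, LinearMap.sub_apply, sub_eq_zero] at h1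
    rw [h1, ext0, dif_pos hp, AlgHom.commutes]
    rfl
  · rw [cur_eq_zero h (by omega), map_zero, LinearMap.zero_apply, ext0, dif_neg hp, zero_smul]

lemma act_ef (p q : ℕ) (v : Verma lam) : act lam (cur r e p) (act lam (cur r f q) v) =
    act lam (cur r f q) (act lam (cur r e p) v) + act lam (cur r h (p + q)) v := by
  rw [← act_mul, cur_ef, map_add, LinearMap.add_apply, act_mul]

lemma act_hf (p q : ℕ) (v : Verma lam) : act lam (cur r h p) (act lam (cur r f q) v) =
    act lam (cur r f q) (act lam (cur r h p) v) - (2 : ℂ) • act lam (cur r f (p + q)) v := by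
  rw [← act_mul, cur_hf, map_sub, LinearMap.sub_apply, act_mul, map_smul, LinearMap.smul_apply]

lemma word_cons (x : Sl2) (p : Fin (r + 1)) (ps : List (Fin (r + 1))) :
    word r x (p :: ps) = cur r x p * word r x ps := by
  rw [word, List.map_cons, List.prod_cons, word]

lemma word_append (x : Sl2) (ps qs : List (Fin (r + 1))) :
    word r x (ps ++ qs) = word r x ps * word r x qs := by
  rw [word, List.map_append, List.prod_append, word, word]

/-- The span of the vectors `f[q_1] ⋯ f[q_k] |lam⟩`. -/
def levelSpan (k : ℕ) : Submodule ℂ (Verma lam) :=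
  Submodule.span ℂ {v | ∃ qs : List (Fin (r + 1)), qs.length = k ∧
    v = act lam (word r f qs) (ket lam)}

lemma act_f_mem_levelSpan (q k : ℕ) {v : Verma lam} (hv : v ∈ levelSpan lam k) :
    act lam (cur r f q) v ∈ levelSpan lam (k + 1) := by
  by_cases hq : q < r + 1
  · induction hv using Submodule.span_induction with
    | mem v hv =>
      obtain ⟨qs, hqs, rfl⟩ := hv
      rw [← act_mul, ← word_cons f ⟨q, hq⟩ qs]
      exact Submodule.subset_span ⟨⟨q, hq⟩ :: qs, by simp [hqs], rfl⟩
    | zero => rw [map_zero]; exact zero_mem _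
    | add v w _ _ hv hw => rw [map_add]; exact add_mem hv hw
    | smul c v _ hv => rw [map_smul]; exact Submodule.smul_mem _ _ hv
  · rw [cur_eq_zero f (by omega), map_zero]; exact zero_mem _

/-- Moving `h[p]` past `f[q]` only produces `f[p + q]` in its place, so the number of factors is
kept; on `|λ⟩` the operator is a scalar. -/
lemma act_h_mem_levelSpan (p k : ℕ) {v : Verma lam} (hv : v ∈ levelSpan lam k) :
    act lam (cur r h p) v ∈ levelSpan lam k := by
  induction hv using Submodule.span_induction with
  | mem v hv =>
    obtain ⟨qs, hqs, rfl⟩ := hv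
    induction qs generalizing k with
    | nil =>
      rw [word, List.map_nil, List.prod_nil, map_one, Module.End.one_apply, act_h_ket]
      exact Submodule.smul_mem _ _ (Submodule.subset_span ⟨[], hqs, by simp [word]⟩)
    | cons q qs ih =>
      subst hqs
      rw [word_cons, act_mul, act_hf]
      refine sub_mem (act_f_mem_levelSpan lam _ _ (ih _ rfl)) (Submodule.smul_mem _ _ ?_)
      exact act_f_mem_levelSpan lam _ _ (Submodule.subset_span ⟨qs, rfl, rfl⟩)
  | zero => rw [map_zero]; exact zero_mem _
  | add v w _ _ hv hw => rw [map_add]; exact add_mem hv hw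
  | smul c v _ hv => rw [map_smul]; exact Submodule.smul_mem _ _ hv

lemma act_e_levelSpan_zero (p : ℕ) {v : Verma lam} (hv : v ∈ levelSpan lam 0) :
    act lam (cur r e p) v = 0 := by
  induction hv using Submodule.span_induction with
  | mem v hv =>
    obtain ⟨qs, hqs, rfl⟩ := hv
    rw [List.length_eq_zero_iff] at hqs
    rw [hqs, word, List.map_nil, List.prod_nil, map_one, Module.End.one_apply, act_e_ket]
  | zero => rw [map_zero]
  | add v w _ _ hv hw => rw [map_add, hv, hw, add_zero]
  | smul c v _ hv => rw [map_smul, hv, smul_zero]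

/-- Moving `e[p]` to the right turns one `f[q]` into `h[p + q]`, and the term in which `e[p]`
reaches `|λ⟩` vanishes. So one factor is lost, and this is why the `e[p]` act locally nilpotently.
-/
lemma act_e_mem_levelSpan (p k : ℕ) {v : Verma lam} (hv : v ∈ levelSpan lam (k + 1)) :
    act lam (cur r e p) v ∈ levelSpan lam k := by
  induction hv using Submodule.span_induction with
  | mem v hv =>
    obtain ⟨qs, hqs, rfl⟩ := hv
    induction qs generalizing k with
    | nil => simp at hqs
    | cons q qs ih =>
      rw [List.length_cons, Nat.succ_inj] at hqs
      subst hqs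
      have hw : act lam (word r f qs) (ket lam) ∈ levelSpan lam qs.length :=
        Submodule.subset_span ⟨qs, rfl, rfl⟩
      rw [word_cons, act_mul, act_ef]
      refine add_mem ?_ (act_h_mem_levelSpan lam _ _ hw)
      rcases hk : qs.length with _ | k
      · rw [act_e_levelSpan_zero lam p (hk ▸ hw), map_zero]; exact zero_mem _
      · exact act_f_mem_levelSpan lam _ _ (ih k hk)
  | zero => rw [map_zero]; exact zero_mem _
  | add v w _ _ hv hw => rw [map_add]; exact add_mem hv hw
  | smul c v _ hv => rw [map_smul]; exact Submodule.smul_mem _ _ hv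

/-- The sum of the levels contains the cyclic vector and is stable under the generators of the
enveloping algebra. -/
lemma iSup_levelSpan : ⨆ k, levelSpan lam k = ⊤ := by
  set W := ⨆ k, levelSpan lam k
  let S : Subalgebra ℂ (UTrunc r) :=
    { carrier := {u | ∀ v ∈ W, act lam u v ∈ W}
      mul_mem' := fun {u u'} hu hu' v hv => by rw [act_mul]; exact hu _ (hu' _ hv)
      add_mem' := fun {u u'} hu hu' v hv => by
        rw [map_add, LinearMap.add_apply]; exact add_mem (hu _ hv) (hu' _ hv)
      algebraMap_mem' := fun c v hv => by
        rw [AlgHom.commutes]; exact Submodule.smul_mem _ c hv }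
  have key : ∀ u : UTrunc r, (∀ k, ∀ v ∈ levelSpan lam k, act lam u v ∈ W) → u ∈ S := by
    intro u hu v hv
    change v ∈ W.comap (act lam u)
    have hle : W ≤ W.comap (act lam u) := iSup_le fun k v hv => hu k v hv
    exact hle hv
  have hle : ∀ k, levelSpan lam k ≤ W := le_iSup _
  have hS : S = ⊤ := by
    rw [eq_top_iff, ← adjoin_cur r, Algebra.adjoin_le_iff]
    rintro u ((⟨p, rfl⟩ | ⟨p, rfl⟩) | ⟨p, rfl⟩) <;> refine key _ fun k v hv => ?_
    · rcases k with _ | k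
      · rw [act_e_levelSpan_zero lam p hv]; exact zero_mem _
      · exact hle _ (act_e_mem_levelSpan lam p k hv)
    · exact hle _ (act_f_mem_levelSpan lam p k hv)
    · exact hle _ (act_h_mem_levelSpan lam p k hv)
  rw [eq_top_iff]
  rintro v -
  obtain ⟨u, rfl⟩ := exists_act_ket lam v
  have hu : u ∈ S := hS ▸ trivial
  exact hu _ (hle 0 (Submodule.subset_span ⟨[], rfl, by simp [word]⟩))

/-- The vectors `f[q_1] ⋯ f[q_k] |lam⟩` span the confluent Verma module. -/
lemma verma_induction {P : Verma lam → Prop} (hket : P (ket lam))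
    (hf : ∀ (q : Fin (r + 1)) v, P v → P (act lam (cur r f q) v))
    (hadd : ∀ v w, P v → P w → P (v + w)) (hsmul : ∀ (c : ℂ) v, P v → P (c • v))
    (v : Verma lam) : P v := by
  let W : Submodule ℂ (Verma lam) :=
    { carrier := {v | P v}
      add_mem' := fun {v w} => hadd v w
      zero_mem' := by simpa using hsmul 0 _ hket
      smul_mem' := hsmul }
  have : (⊤ : Submodule ℂ (Verma lam)) ≤ W := by
    rw [← iSup_levelSpan]
    refine iSup_le fun k => Submodule.span_le.mpr ?_
    rintro _ ⟨qs, -, rfl⟩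
    induction qs with
    | nil => change P _; simpa [word] using hket
    | cons q qs ih => rw [word_cons, act_mul]; exact hf _ _ ih
  exact this (x := v) trivial

/-- Linear maps on the induced module. -/
lemma exists_vermaLift {M : Type*} [AddCommGroup M] [Module ℂ M] (g : UTrunc r →ₗ[ℂ] M)
    (he : ∀ u (p : Fin (r + 1)), g (u * cur r e p) = 0)
    (hh : ∀ u (p : Fin (r + 1)), g (u * cur r h p) = lam p • g u) :
    ∃ G : Verma lam →ₗ[ℂ] M, ∀ u, G (act lam u (ket lam)) = g u := by
  have hker : (vermaIdeal lam).restrictScalars ℂ ≤ LinearMap.ker g := by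
    intro x hx
    -- The factor `u` makes the claim stable under left multiplication, as the induction over a left
    -- ideal requires.
    have : ∀ u, g (u * x) = 0 := by
      rw [Submodule.restrictScalars_mem] at hx
      induction hx using Submodule.span_induction with
      | mem x hx =>
        intro u
        rcases hx with ⟨p, rfl⟩ | ⟨p, rfl⟩
        · exact he u p
        · rw [mul_sub, map_sub, hh, ← Algebra.commutes, ← Algebra.smul_def, map_smul, sub_self]
      | zero => simp
      | add x y _ _ hx hy => intro u; rw [mul_add, map_add, hx, hy, add_zero]
      | smul c x _ hx => intro u; rw [smul_eq_mul, ← mul_assoc, hx]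
    simpa using this 1
  refine ⟨((vermaIdeal lam).restrictScalars ℂ).liftQ g hker, fun u => ?_⟩
  rw [act_ket]
  exact ((vermaIdeal lam).restrictScalars ℂ).liftQ_apply g u

/-- An anti-involution of the enveloping algebra that exchanges `e[p]` and `f[p]`. -/
lemma exists_antiInvolution (r : ℕ) : ∃ τ : UTrunc r →ₐ[ℂ] (UTrunc r)ᵐᵒᵖ, ∀ p,
    τ (cur r e p) = MulOpposite.op (cur r f p) ∧ τ (cur r f p) = MulOpposite.op (cur r e p) ∧
      τ (cur r h p) = MulOpposite.op (cur r h p) := by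
  refine exists_algHom r _ _ _ ?_ ?_ ?_ ?_ ?_ ?_ ?_ ?_ ?_
  · intro p hp; rw [cur_eq_zero f hp, MulOpposite.op_zero]
  · intro p hp; rw [cur_eq_zero e hp, MulOpposite.op_zero]
  · intro p hp; rw [cur_eq_zero h hp, MulOpposite.op_zero]
  · intro p q
    rw [← MulOpposite.op_mul, ← MulOpposite.op_mul, ← MulOpposite.op_add, cur_ef, add_comm q]
  -- Reversing products while exchanging `e` and `f` turns the relation between `h` and `e` into
  -- that between `h` and `f`, and conversely.
  · intro p q
    rw [← MulOpposite.op_mul, ← MulOpposite.op_mul, ← MulOpposite.op_smul, ← MulOpposite.op_add,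
      cur_hf, sub_add_cancel]
  · intro p q
    rw [← MulOpposite.op_mul, ← MulOpposite.op_mul, ← MulOpposite.op_smul, ← MulOpposite.op_sub,
      cur_he, add_sub_cancel_right]
  all_goals intro p q; rw [← MulOpposite.op_mul, ← MulOpposite.op_mul, cur_comm]

end Verma

/-! ### The free field realization -/

section Realization

variable {r : ℕ}

/-- The variable `y_k`, zero for `k > r`. -/
def yVar (r k : ℕ) : MvPolynomial (Fin (r + 1)) ℂ :=
  if hk : k < r + 1 then MvPolynomial.X ⟨k, hk⟩ else 0

lemma yVar_eq (q : Fin (r + 1)) : yVar r q = MvPolynomial.X q := by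
  rw [yVar, dif_pos q.2]

lemma yVar_eq_zero {k : ℕ} (hk : r < k) : yVar r k = 0 := by
  rw [yVar, dif_neg (by omega)]

lemma constantCoeff_yVar (k : ℕ) : MvPolynomial.constantCoeff (yVar r k) = 0 := by
  rw [yVar]; split_ifs <;> simp

/-- The derivation `y_q ↦ y_{k+q}`. -/
def yDer (r k : ℕ) :
    Derivation ℂ (MvPolynomial (Fin (r + 1)) ℂ) (MvPolynomial (Fin (r + 1)) ℂ) :=
  MvPolynomial.mkDerivation ℂ (fun q => yVar r (k + q))

lemma yDer_X (k : ℕ) (q : Fin (r + 1)) : yDer r k (MvPolynomial.X q) = yVar r (k + q) := by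
  rw [yDer, MvPolynomial.mkDerivation_X]

lemma yDer_yVar (k q : ℕ) : yDer r k (yVar r q) = yVar r (k + q) := by
  by_cases hq : q < r + 1
  · rw [← yDer_X k ⟨q, hq⟩, ← yVar_eq]
  · rw [yVar_eq_zero (by omega), map_zero, yVar_eq_zero (by omega)]

lemma constantCoeff_yDer (k : ℕ) (P : MvPolynomial (Fin (r + 1)) ℂ) :
    MvPolynomial.constantCoeff (yDer r k P) = 0 := by
  induction P using MvPolynomial.induction_on with
  | C a => simp [yDer]
  | add P Q hP hQ => rw [map_add, map_add, hP, hQ, add_zero]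
  | mul_X P q hP =>
    rw [Derivation.leibniz, map_add, smul_eq_mul, smul_eq_mul, map_mul, map_mul, yDer_X,
      constantCoeff_yVar, hP, mul_zero, mul_zero, add_zero]

variable (lam : Fin (r + 1) → ℂ)

lemma ext0_eq_zero {k : ℕ} (hk : r < k) : ext0 lam k = 0 := by
  rw [ext0, dif_neg (by omega)]

def fOp (r k : ℕ) : Module.End ℂ (MvPolynomial (Fin (r + 1)) ℂ) := LinearMap.mulLeft ℂ (yVar r k)

/-- The action of `h[k]` on a polynomial in the `f[q]` applied to `|λ⟩`: each `f[q]` becomes `-2 f[k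
+ q]`, and `|λ⟩` contributes the weight. -/
def hOp (k : ℕ) : Module.End ℂ (MvPolynomial (Fin (r + 1)) ℂ) :=
  ext0 lam k • 1 - (2 : ℂ) • (yDer r k).toLinearMap

/-- Obtained by moving `e[k]` through a word in the `f[q]`: one factor `f[q]` becomes `h[k + q]`,
which meets `|λ⟩` or a second factor `f[q']`. In the latter case it leaves `-2 f[k + q + q']`; the
sum over ordered pairs counts each pair of factors twice and absorbs the `2`. -/
def eOp (k : ℕ) : Module.End ℂ (MvPolynomial (Fin (r + 1)) ℂ) :=
  ∑ q : Fin (r + 1), (ext0 lam (k + q) • (MvPolynomial.pderiv q).toLinearMap -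
    ∑ q' : Fin (r + 1), LinearMap.mulLeft ℂ (yVar r (k + q + q')) ∘ₗ
      (MvPolynomial.pderiv q).toLinearMap ∘ₗ (MvPolynomial.pderiv q').toLinearMap)

lemma hOp_f (p q : ℕ) : hOp lam p * fOp r q = fOp r q * hOp lam p - (2 : ℂ) • fOp r (p + q) := by
  refine LinearMap.ext fun P => ?_
  simp only [hOp, fOp, Module.End.mul_apply, LinearMap.sub_apply, LinearMap.smul_apply,
    LinearMap.mulLeft_apply, Module.End.one_apply, Derivation.coeFn_coe,
    Derivation.leibniz, smul_eq_mul, yDer_yVar, MvPolynomial.smul_eq_C_mul]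
  ring

lemma yDer_apply (k : ℕ) (P : MvPolynomial (Fin (r + 1)) ℂ) :
    yDer r k P = ∑ q : Fin (r + 1), yVar r (k + q) * MvPolynomial.pderiv q P := by
  let D : Derivation ℂ (MvPolynomial (Fin (r + 1)) ℂ) (MvPolynomial (Fin (r + 1)) ℂ) :=
    ∑ q : Fin (r + 1), yVar r (k + q) • MvPolynomial.pderiv q
  have hD : ∀ P, D P = ∑ q : Fin (r + 1), yVar r (k + q) * MvPolynomial.pderiv q P := by
    intro P
    rw [← Derivation.coeFnAddMonoidHom_apply, map_sum, Finset.sum_apply]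
    rfl
  rw [← hD]
  congr 1
  refine MvPolynomial.derivation_ext fun q => ?_
  rw [hD, yDer_X, Finset.sum_eq_single q]
  · simp
  · intro b _ hb
    rw [MvPolynomial.pderiv_X_of_ne hb.symm, mul_zero]
  · simp

/-- The second-order part of `eOp` is symmetric in its two derivatives, so its commutator with a
variable yields the same first-order operator twice. This is the coefficient `2` in `hOp`. -/
lemma eOp_X (p : ℕ) (q : Fin (r + 1)) (P : MvPolynomial (Fin (r + 1)) ℂ) :
    eOp lam p (MvPolynomial.X q * P) = MvPolynomial.X q * eOp lam p P + hOp lam (p + q) P := by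
  have h1 : ∀ q' : Fin (r + 1), MvPolynomial.pderiv q' (MvPolynomial.X q * P) =
      MvPolynomial.X q * MvPolynomial.pderiv q' P + if q' = q then P else 0 := by
    intro q'
    rw [Derivation.leibniz, smul_eq_mul, smul_eq_mul]
    split_ifs with hq
    · subst hq; simp
    · rw [MvPolynomial.pderiv_X_of_ne (Ne.symm hq), mul_zero]
  have h2 : ∀ a b : Fin (r + 1), MvPolynomial.pderiv a (MvPolynomial.pderiv b
      (MvPolynomial.X q * P)) =
      MvPolynomial.X q * MvPolynomial.pderiv a (MvPolynomial.pderiv b P) +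
      (if a = q then MvPolynomial.pderiv b P else 0) +
      if b = q then MvPolynomial.pderiv a P else 0 := by
    intro a b
    rw [h1, map_add, Derivation.leibniz, smul_eq_mul, smul_eq_mul]
    congr 1
    · congr 1
      split_ifs with hq
      · subst hq; simp
      · rw [MvPolynomial.pderiv_X_of_ne (Ne.symm hq), mul_zero]
    · split_ifs <;> simp
  simp only [eOp, hOp, LinearMap.sum_apply, LinearMap.sub_apply, LinearMap.smul_apply,
    LinearMap.comp_apply, Derivation.coeFn_coe, LinearMap.mulLeft_apply, h2,
    Module.End.one_apply, yDer_apply]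
  simp only [h1]
  simp only [mul_add, smul_add, Finset.sum_add_distrib, Finset.sum_sub_distrib, Finset.mul_sum,
    mul_sub, mul_ite, mul_zero, smul_ite, smul_zero, Finset.sum_ite_eq', Finset.mem_univ, if_true]
  have h3 : ∑ x : Fin (r + 1), ∑ x' : Fin (r + 1),
      (if x = q then yVar r (p + x + x') * MvPolynomial.pderiv x' P else 0) =
      ∑ x' : Fin (r + 1), yVar r (p + q + x') * MvPolynomial.pderiv x' P := by
    rw [Finset.sum_comm]; simp
  rw [h3]
  simp only [Finset.smul_sum, MvPolynomial.smul_eq_C_mul, add_right_comm p _ (q : ℕ)]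
  have h4 : (MvPolynomial.C (2 : ℂ) : MvPolynomial (Fin (r + 1)) ℂ) = 2 := rfl
  simp only [h4, ← Finset.mul_sum]
  have h5 : ∀ x x' : Fin (r + 1), yVar r (p + x + x') * (MvPolynomial.X q *
      MvPolynomial.pderiv x (MvPolynomial.pderiv x' P)) = MvPolynomial.X q * (yVar r (p + x + x') *
      MvPolynomial.pderiv x (MvPolynomial.pderiv x' P)) := fun _ _ => mul_left_comm _ _ _
  have h6 : ∀ x : Fin (r + 1), MvPolynomial.C (ext0 lam (p + x)) * (MvPolynomial.X q *
      MvPolynomial.pderiv x P) = MvPolynomial.X q * (MvPolynomial.C (ext0 lam (p + x)) *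
      MvPolynomial.pderiv x P) := fun _ => mul_left_comm _ _ _
  simp only [h5, h6, ← Finset.mul_sum]
  ring

lemma eOp_f (p q : ℕ) : eOp lam p * fOp r q = fOp r q * eOp lam p + hOp lam (p + q) := by
  by_cases hq : q < r + 1
  · refine LinearMap.ext fun P => ?_
    have := eOp_X lam p ⟨q, hq⟩ P
    rw [← yVar_eq] at this
    exact this
  · have h1 : fOp r q = 0 := by rw [fOp, yVar_eq_zero (by omega), LinearMap.mulLeft_zero_eq_zero]
    have h2 : hOp lam (p + q) = 0 := by
      refine LinearMap.ext fun P => ?_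
      simp only [hOp, ext0_eq_zero lam (show r < p + q by omega), yDer_apply, zero_smul,
        LinearMap.sub_apply, LinearMap.smul_apply, Derivation.coeFn_coe,
        LinearMap.zero_apply]
      rw [Finset.sum_eq_zero fun x _ => by rw [yVar_eq_zero (by omega), zero_mul]]
      simp
    rw [h1, h2]; simp

/-- An operator that kills `1` and commutes with the variables is zero. -/
lemma eq_zero_of_commute_f {T : Module.End ℂ (MvPolynomial (Fin (r + 1)) ℂ)} (h1 : T 1 = 0)
    (hT : ∀ q : ℕ, T * fOp r q = fOp r q * T) : T = 0 := by
  refine LinearMap.ext fun P => ?_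
  induction P using MvPolynomial.induction_on with
  | C a =>
    rw [← mul_one (MvPolynomial.C a), ← MvPolynomial.smul_eq_C_mul, map_smul, h1, smul_zero]; rfl
  | add P Q hP hQ => rw [map_add, hP, hQ, map_add]
  | mul_X P q hP =>
    have := LinearMap.congr_fun (hT q) P
    simp only [Module.End.mul_apply, fOp, LinearMap.mulLeft_apply, yVar_eq] at this
    rw [mul_comm, this, hP]; simp

lemma eOp_one (p : ℕ) : eOp lam p 1 = 0 := by
  simp [eOp]

lemma hOp_one (p : ℕ) : hOp lam p 1 = ext0 lam p • 1 := by
  simp [hOp]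

/-- By the relations with the `f[s]`, the commutator commutes with the variables (the Jacobi
identity), and it kills `1`; such an operator vanishes. The relations of `e` with `h` and with
itself follow in the same way. -/
lemma hOp_h (p q : ℕ) : hOp lam p * hOp lam q = hOp lam q * hOp lam p := by
  rw [← sub_eq_zero]
  refine eq_zero_of_commute_f ?_ fun s => ?_
  · simp only [LinearMap.sub_apply, Module.End.mul_apply, hOp_one, map_smul, smul_smul]
    rw [mul_comm, sub_self]
  · have h1 := hOp_f lam p s
    have h2 := hOp_f lam q s
    rw [sub_mul, mul_sub, mul_assoc, mul_assoc, h1, h2, mul_sub, mul_sub, mul_smul_comm,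
      mul_smul_comm, ← mul_assoc, ← mul_assoc, h1, h2, hOp_f, hOp_f, sub_mul, sub_mul,
      show q + (p + s) = p + (q + s) by omega]
    simp only [smul_mul_assoc, mul_assoc, smul_sub]
    abel

lemma hOp_e (p q : ℕ) : hOp lam p * eOp lam q = eOp lam q * hOp lam p + (2 : ℂ) • eOp lam (p + q) := by
  rw [← sub_eq_zero]
  refine eq_zero_of_commute_f ?_ fun s => ?_
  · simp [Module.End.mul_apply, hOp_one, eOp_one]
  · have h1 := hOp_f lam p s
    have h2 := eOp_f lam q s
    have h3 := eOp_f lam (p + q) s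
    have h4 := hOp_h lam p (q + s)
    rw [sub_mul, mul_sub, add_mul, mul_add, mul_assoc, mul_assoc, h1, h2, mul_sub, mul_add,
      mul_smul_comm, mul_smul_comm, smul_mul_assoc, h3, ← mul_assoc, ← mul_assoc, h1, h2, eOp_f,
      sub_mul, add_mul, show q + (p + s) = p + q + s by omega, h4]
    simp only [smul_mul_assoc, mul_assoc, smul_sub, smul_add]
    abel

lemma eOp_e (p q : ℕ) : eOp lam p * eOp lam q = eOp lam q * eOp lam p := by
  rw [← sub_eq_zero]
  refine eq_zero_of_commute_f ?_ fun s => ?_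
  · simp [Module.End.mul_apply, eOp_one]
  · have h1 := eOp_f lam p s
    have h2 := eOp_f lam q s
    have h3 := hOp_e lam (p + s) q
    have h4 := hOp_e lam (q + s) p
    rw [sub_mul, mul_sub, mul_assoc, mul_assoc, h1, h2, mul_add, mul_add, ← mul_assoc, ← mul_assoc,
      h1, h2, add_mul, add_mul, h3, h4, show q + s + p = p + s + q by omega]
    simp only [mul_assoc]
    abel

/-- The free field realization of the truncated current algebra. -/
lemma exists_realization : ∃ φ : UTrunc r →ₐ[ℂ] Module.End ℂ (MvPolynomial (Fin (r + 1)) ℂ), ∀ p,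
    φ (cur r e p) = eOp lam p ∧ φ (cur r f p) = fOp r p ∧ φ (cur r h p) = hOp lam p := by
  have hF : ∀ p, r < p → fOp r p = 0 := fun p hp => by
    rw [fOp, yVar_eq_zero hp, LinearMap.mulLeft_zero_eq_zero]
  -- `h[p]` is the commutator of `e[0]` and `f[p]`, so it vanishes together with `f[p]`.
  have hH : ∀ p, r < p → hOp lam p = 0 := fun p hp => by
    have := eOp_f lam 0 p
    rwa [hF p hp, mul_zero, zero_mul, zero_add, zero_add, eq_comm] at this
  refine exists_algHom r _ _ _ ?_ hF hH (eOp_f lam) (hOp_e lam) (hOp_f lam) (eOp_e lam) ?_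
    (hOp_h lam)
  · intro p hp
    refine eq_zero_of_commute_f (eOp_one lam p) fun s => ?_
    rw [eOp_f, hH _ (by omega), add_zero]
  · intro p q
    refine LinearMap.ext fun P => ?_
    exact mul_left_comm _ _ _

end Realization

/-! ### The dual highest weight vector and the correspondence between vectors and dual vectors -/

section Dual

variable {r : ℕ} (lam : Fin (r + 1) → ℂ)

/-- The constant term in the free field realization: `f[p]` multiplies by a variable, hence produces
no constant term, and neither does the derivation in `h[p]`, so that only its scalar part survives.
-/
lemma exists_isBra : ∃ bra, IsBra lam bra := by
  obtain ⟨φ, hφ⟩ := exists_realization lam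
  let g : UTrunc r →ₗ[ℂ] MvPolynomial (Fin (r + 1)) ℂ :=
    (LinearMap.applyₗ (1 : MvPolynomial (Fin (r + 1)) ℂ)) ∘ₗ φ.toLinearMap
  have hg : ∀ u, g u = φ u 1 := fun u => rfl
  obtain ⟨G, hG⟩ := exists_vermaLift lam g
    (fun u p => by rw [hg, map_mul, Module.End.mul_apply, (hφ p).1, eOp_one, map_zero])
    (fun u p => by
      rw [hg, map_mul, Module.End.mul_apply, (hφ p).2.2, hOp_one, map_smul, hg, ext0, dif_pos p.2])
  refine ⟨(MvPolynomial.aeval (0 : Fin (r + 1) → ℂ)).toLinearMap ∘ₗ G, ?_, ?_, ?_⟩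
  · have := hG 1
    rw [map_one, Module.End.one_apply] at this
    rw [LinearMap.comp_apply, this, hg, map_one φ, Module.End.one_apply]
    simp
  · intro p w
    obtain ⟨u, rfl⟩ := exists_act_ket lam w
    rw [LinearMap.comp_apply, ← act_mul, hG, hg, map_mul, Module.End.mul_apply, (hφ p).2.1]
    simp [fOp, yVar_eq]
  · intro p w
    obtain ⟨u, rfl⟩ := exists_act_ket lam w
    rw [LinearMap.comp_apply, LinearMap.comp_apply, ← act_mul, hG, hG, hg, hg, map_mul,
      Module.End.mul_apply, (hφ p).2.2]
    have h0 : ∀ Q : MvPolynomial (Fin (r + 1)) ℂ,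
        MvPolynomial.aeval (0 : Fin (r + 1) → ℂ) Q = MvPolynomial.constantCoeff Q := fun Q => by
      rw [MvPolynomial.aeval_zero]; rfl
    simp only [AlgHom.toLinearMap_apply, h0, hOp, LinearMap.sub_apply, LinearMap.smul_apply,
      Module.End.one_apply, Derivation.coeFn_coe, map_sub, MvPolynomial.constantCoeff_smul,
      constantCoeff_yDer, smul_zero, sub_zero, smul_eq_mul]
    rw [ext0, dif_pos p.2, mul_zero, sub_zero]

/-- The value on `|λ⟩` is prescribed, and every vector of the form `f[q] w` is sent to zero; these
vectors span. -/
lemma isBra_unique {bra bra' : Module.Dual ℂ (Verma lam)} (h1 : IsBra lam bra)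
    (h2 : IsBra lam bra') : bra = bra' := by
  refine LinearMap.ext fun v => verma_induction lam (P := fun v => bra v = bra' v) ?_ ?_ ?_ ?_ v
  · rw [h1.apply_ket, h2.apply_ket]
  · intro q v _; rw [h1.apply_f, h2.apply_f]
  · intro v w hv hw; rw [map_add, map_add, hv, hw]
  · intro c v hv; rw [map_smul, map_smul, hv]

lemma existsUnique_isBra : ∃! bra, IsBra lam bra := by
  obtain ⟨bra, hb⟩ := exists_isBra lam
  exact ⟨bra, hb, fun _ hb' => isBra_unique lam hb' hb⟩

lemma isDualMap_unique {bra : Module.Dual ℂ (Verma lam)}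
    {D D' : Verma lam →ₗ[ℂ] Module.Dual ℂ (Verma lam)} (h1 : IsDualMap lam bra D)
    (h2 : IsDualMap lam bra D') : D = D' := by
  refine LinearMap.ext fun v => verma_induction lam (P := fun v => D v = D' v) ?_ ?_ ?_ ?_ v
  · rw [h1.map_ket, h2.map_ket]
  · intro q v hv; rw [h1.map_f, h2.map_f, hv]
  · intro v w hv hw; rw [map_add, map_add, hv, hw]
  · intro c v hv; rw [map_smul, map_smul, hv]

/-- With the anti-involution `τ`, the vector `u |λ⟩` is sent to `⟨λ| τ(u)`. This is well defined
because `τ(u e[p]) = f[p] τ(u)` and `τ(u h[p]) = h[p] τ(u)`, while `⟨λ|` is killed by `f[p]` and is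
an eigenvector of `h[p]`, acting on the right. -/
lemma existsUnique_isDualMap {bra : Module.Dual ℂ (Verma lam)} (hb : IsBra lam bra) :
    ∃! D, IsDualMap lam bra D := by
  obtain ⟨τ, hτ⟩ := exists_antiInvolution r
  let g : UTrunc r →ₗ[ℂ] Module.Dual ℂ (Verma lam) :=
    { toFun := fun u => bra ∘ₗ act lam (τ u).unop
      map_add' := fun u u' => by
        rw [map_add, MulOpposite.unop_add, map_add, LinearMap.comp_add]
      map_smul' := fun c u => by
        rw [map_smul, MulOpposite.unop_smul, map_smul, LinearMap.comp_smul]; rfl }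
  have hg : ∀ u v, g u v = bra (act lam (τ u).unop v) := fun u v => rfl
  obtain ⟨G, hG⟩ := exists_vermaLift lam g
    (fun u p => by
      refine LinearMap.ext fun v => ?_
      rw [hg, map_mul, (hτ p).1, MulOpposite.unop_mul, MulOpposite.unop_op, act_mul, hb.apply_f]
      rfl)
    (fun u p => by
      refine LinearMap.ext fun v => ?_
      rw [hg, map_mul, (hτ p).2.2, MulOpposite.unop_mul, MulOpposite.unop_op, act_mul, hb.apply_h]
      rfl)
  have hG' : ∀ u v, G (act lam u (ket lam)) v = bra (act lam (τ u).unop v) := fun u v => by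
    rw [hG, hg]
  have key : ∀ u u' : UTrunc r, τ u = MulOpposite.op u' →
      ∀ w, G (act lam u w) = G w ∘ₗ act lam u' := by
    intro u u' hu w
    obtain ⟨u₀, rfl⟩ := exists_act_ket lam w
    refine LinearMap.ext fun v => ?_
    rw [LinearMap.comp_apply, ← act_mul, hG', hG', map_mul, hu, MulOpposite.unop_mul,
      MulOpposite.unop_op, act_mul]
  have hdual : IsDualMap lam bra G := by
    refine ⟨LinearMap.ext fun v => ?_, fun p => key _ _ (hτ p).1, fun p => key _ _ (hτ p).2.1,
      fun p => key _ _ (hτ p).2.2⟩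
    have := hG' 1 v
    rwa [map_one, map_one, Module.End.one_apply, MulOpposite.unop_one, map_one,
      Module.End.one_apply] at this
  exact ⟨G, hdual, fun D' hD' => isDualMap_unique lam hD' hdual⟩

end Dual

/-! ### Matrix elements -/

section MatrixElements

variable {r : ℕ} (lam : Fin (r + 1) → ℂ)

/-- The matrix element `P ⊗ v ↦ φ(v) P`. -/
def evalDual (φ : Module.Dual ℂ (Verma lam)) :
    MvPolynomial (Fin (r + 1)) ℂ ⊗[ℂ] Verma lam →ₗ[ℂ] MvPolynomial (Fin (r + 1)) ℂ :=
  (TensorProduct.rid ℂ (MvPolynomial (Fin (r + 1)) ℂ)).toLinearMap ∘ₗ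
    LinearMap.lTensor (MvPolynomial (Fin (r + 1)) ℂ) φ

lemma evalDual_tmul (φ : Module.Dual ℂ (Verma lam)) (P : MvPolynomial (Fin (r + 1)) ℂ)
    (v : Verma lam) : evalDual lam φ (P ⊗ₜ[ℂ] v) = φ v • P := by
  simp [evalDual]

lemma matZ_def (φ : Module.Dual ℂ (Verma lam)) (v : Verma lam) : matZ lam φ v =
    ∑ᶠ k : ℕ, ((k.factorial : ℂ)⁻¹) • evalDual lam φ ((xe lam ^ k) (1 ⊗ₜ[ℂ] v)) := rfl

lemma xe_tmul (P : MvPolynomial (Fin (r + 1)) ℂ) (v : Verma lam) :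
    xe lam (P ⊗ₜ[ℂ] v) =
      ∑ q : Fin (r + 1), (MvPolynomial.X q * P) ⊗ₜ[ℂ] act lam (cur r e q) v := by
  simp [xe, LinearMap.sum_apply]

/-- Only the summand `x_p e[p]` involves `x_p`, so the commutator with `∂/∂x_p` is `e[p]`. -/
lemma pderiv_xe (p : Fin (r + 1)) :
    LinearMap.rTensor (Verma lam) (MvPolynomial.pderiv p).toLinearMap ∘ₗ xe lam =
      xe lam ∘ₗ LinearMap.rTensor (Verma lam) (MvPolynomial.pderiv p).toLinearMap +
        LinearMap.lTensor (MvPolynomial (Fin (r + 1)) ℂ) (act lam (cur r e p)) := by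
  refine TensorProduct.ext' fun P v => ?_
  rw [LinearMap.comp_apply, LinearMap.add_apply, LinearMap.comp_apply, xe_tmul, map_sum,
    LinearMap.rTensor_tmul, LinearMap.lTensor_tmul, xe_tmul]
  have h1 : ∀ q : Fin (r + 1), LinearMap.rTensor (Verma lam) (MvPolynomial.pderiv p).toLinearMap
      ((MvPolynomial.X q * P) ⊗ₜ[ℂ] act lam (cur r e q) v) =
      (MvPolynomial.X q * MvPolynomial.pderiv p P) ⊗ₜ[ℂ] act lam (cur r e q) v +
        if q = p then P ⊗ₜ[ℂ] act lam (cur r e q) v else 0 := by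
    intro q
    rw [LinearMap.rTensor_tmul, Derivation.coeFn_coe, Derivation.leibniz, smul_eq_mul, smul_eq_mul,
      TensorProduct.add_tmul]
    congr 1
    split_ifs with hq
    · subst hq; simp
    · rw [MvPolynomial.pderiv_X_of_ne hq, mul_zero, TensorProduct.zero_tmul]
  rw [Finset.sum_congr rfl fun q _ => h1 q, Finset.sum_add_distrib]
  simp

lemma act_e_xe (p : Fin (r + 1)) :
    LinearMap.lTensor (MvPolynomial (Fin (r + 1)) ℂ) (act lam (cur r e p)) ∘ₗ xe lam =
      xe lam ∘ₗ LinearMap.lTensor (MvPolynomial (Fin (r + 1)) ℂ) (act lam (cur r e p)) := by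
  refine TensorProduct.ext' fun P v => ?_
  rw [LinearMap.comp_apply, LinearMap.comp_apply, xe_tmul, map_sum, LinearMap.lTensor_tmul, xe_tmul]
  refine Finset.sum_congr rfl fun q _ => ?_
  rw [LinearMap.lTensor_tmul, ← act_mul, ← act_mul, cur_comm]

lemma act_e_xe_pow (p : Fin (r + 1)) (k : ℕ) (v : Verma lam) :
    LinearMap.lTensor (MvPolynomial (Fin (r + 1)) ℂ) (act lam (cur r e p))
      ((xe lam ^ k) (1 ⊗ₜ[ℂ] v)) = (xe lam ^ k) (1 ⊗ₜ[ℂ] act lam (cur r e p) v) := by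
  induction k with
  | zero => rfl
  | succ k ih =>
    rw [pow_succ' (xe lam), Module.End.mul_apply, Module.End.mul_apply, ← ih]
    exact LinearMap.congr_fun (act_e_xe lam p) _

/-- As `e[p]` commutes with `∑ x_q e[q]`, powers are differentiated as in a commutative ring; the
derivative of the initial `1` is zero. -/
lemma pderiv_xe_pow (p : Fin (r + 1)) (k : ℕ) (v : Verma lam) :
    LinearMap.rTensor (Verma lam) (MvPolynomial.pderiv p).toLinearMap
      ((xe lam ^ (k + 1)) (1 ⊗ₜ[ℂ] v)) =
        ((k + 1 : ℕ) : ℂ) • (xe lam ^ k) (1 ⊗ₜ[ℂ] act lam (cur r e p) v) := by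
  have hx : ∀ w, LinearMap.rTensor (Verma lam) (MvPolynomial.pderiv p).toLinearMap (xe lam w) =
      xe lam (LinearMap.rTensor (Verma lam) (MvPolynomial.pderiv p).toLinearMap w) +
        LinearMap.lTensor (MvPolynomial (Fin (r + 1)) ℂ) (act lam (cur r e p)) w :=
    fun w => LinearMap.congr_fun (pderiv_xe lam p) w
  induction k with
  | zero =>
    rw [pow_one, hx, LinearMap.rTensor_tmul, Derivation.coeFn_coe, Derivation.map_one_eq_zero,
      TensorProduct.zero_tmul, map_zero, zero_add, LinearMap.lTensor_tmul]
    simp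
  | succ k ih =>
    rw [pow_succ' (xe lam), Module.End.mul_apply, hx, ih, act_e_xe_pow, map_smul, pow_succ' (xe lam),
      Module.End.mul_apply, Nat.cast_succ (k + 1), add_smul, one_smul]

/-- Each factor lowers the level by one. Hence the exponential series `Z` terminates on every
vector. -/
lemma xe_pow_eq_zero_of_mem {j : ℕ} {v : Verma lam} (hv : v ∈ levelSpan lam j) {k : ℕ} (hk : j < k)
    (P : MvPolynomial (Fin (r + 1)) ℂ) : (xe lam ^ k) (P ⊗ₜ[ℂ] v) = 0 := by
  induction k generalizing j v P with
  | zero => omega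
  | succ k ih =>
    rw [pow_succ (xe lam), Module.End.mul_apply, xe_tmul, map_sum]
    refine Finset.sum_eq_zero fun q _ => ?_
    rcases j with _ | j
    · rw [act_e_levelSpan_zero lam q hv, TensorProduct.tmul_zero, map_zero]
    · exact ih (act_e_mem_levelSpan lam q j hv) (by omega) _

lemma exists_xe_pow_eq_zero (v : Verma lam) :
    ∃ N, ∀ k, N ≤ k → (xe lam ^ k) (1 ⊗ₜ[ℂ] v) = 0 := by
  have hv : v ∈ ⨆ k, levelSpan lam k := by rw [iSup_levelSpan]; trivial
  induction hv using Submodule.iSup_induction' with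
  | mem j v hv => exact ⟨j + 1, fun k hk => xe_pow_eq_zero_of_mem lam hv (by omega) 1⟩
  | zero => exact ⟨0, fun k _ => by rw [TensorProduct.tmul_zero, map_zero]⟩
  | add v w _ _ hv hw =>
    obtain ⟨N, hN⟩ := hv
    obtain ⟨M, hM⟩ := hw
    exact ⟨max N M, fun k hk => by
      rw [TensorProduct.tmul_add, map_add, hN k (by omega), hM k (by omega), add_zero]⟩

lemma matZ_eq_sum (φ : Module.Dual ℂ (Verma lam)) {v : Verma lam} {N : ℕ}
    (hN : ∀ k, N ≤ k → (xe lam ^ k) (1 ⊗ₜ[ℂ] v) = 0) : matZ lam φ v =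
    ∑ k ∈ Finset.range N,
      ((k.factorial : ℂ)⁻¹) • evalDual lam φ ((xe lam ^ k) (1 ⊗ₜ[ℂ] v)) := by
  rw [matZ_def]
  refine finsum_eq_sum_of_support_subset _ fun k hk => ?_
  by_contra hkN
  refine hk ?_
  simp only [Finset.coe_range, Set.mem_Iio, not_lt] at hkN
  beta_reduce
  rw [hN k hkN, map_zero, smul_zero]

lemma screen_matZ (φ : Module.Dual ℂ (Verma lam)) (p : Fin (r + 1)) (v : Verma lam) :
    screen p (matZ lam φ v) = matZ lam φ (act lam (cur r e p) v) := by
  obtain ⟨N, hN⟩ := exists_xe_pow_eq_zero lam v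
  have hN' : ∀ k, N ≤ k → (xe lam ^ k) (1 ⊗ₜ[ℂ] act lam (cur r e p) v) = 0 := fun k hk => by
    rw [← act_e_xe_pow, hN k hk, map_zero]
  have hev : ∀ w, screen p (evalDual lam φ w) = evalDual lam φ
      (LinearMap.rTensor (Verma lam) (MvPolynomial.pderiv p).toLinearMap w) := by
    intro w
    refine LinearMap.congr_fun (f := screen p ∘ₗ evalDual lam φ) (g := evalDual lam φ ∘ₗ
      LinearMap.rTensor (Verma lam) (MvPolynomial.pderiv p).toLinearMap) ?_ w
    refine TensorProduct.ext' fun P v => ?_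
    rw [LinearMap.comp_apply, LinearMap.comp_apply, LinearMap.rTensor_tmul, evalDual_tmul,
      evalDual_tmul, map_smul]
    rfl
  rw [matZ_eq_sum lam φ (N := N + 1) fun k hk => hN k (by omega), matZ_eq_sum lam φ hN',
    Finset.sum_range_succ', map_add, map_sum]
  -- The term of order zero in the exponential is constant in `x`; in the term of order `k + 1` the
  -- derivative cancels one factor of the factorial.
  have h0 : screen p ((((0 : ℕ).factorial : ℂ)⁻¹) • evalDual lam φ ((xe lam ^ 0) (1 ⊗ₜ[ℂ] v))) =
      0 := by
    rw [map_smul, hev, pow_zero, Module.End.one_apply, LinearMap.rTensor_tmul,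
      Derivation.coeFn_coe, Derivation.map_one_eq_zero, TensorProduct.zero_tmul, map_zero,
      smul_zero]
  rw [h0, add_zero]
  refine Finset.sum_congr rfl fun k _ => ?_
  rw [map_smul, hev, pderiv_xe_pow, map_smul, smul_smul, Nat.factorial_succ, Nat.cast_mul, mul_inv,
    mul_comm (_)⁻¹, mul_assoc, inv_mul_cancel₀ (Nat.cast_ne_zero.mpr (Nat.succ_ne_zero k)), mul_one]

/-- `e[p]` commutes with `Z`, so it may be moved from the vector to the dual vector. -/
lemma matZ_act (φ : Module.Dual ℂ (Verma lam)) (p : Fin (r + 1)) (v : Verma lam) :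
    matZ lam φ (act lam (cur r e p) v) = matZ lam (φ ∘ₗ act lam (cur r e p)) v := by
  rw [matZ_def, matZ_def]
  refine finsum_congr fun k => ?_
  congr 1
  rw [← act_e_xe_pow]
  refine LinearMap.congr_fun (f := evalDual lam φ ∘ₗ LinearMap.lTensor _ (act lam (cur r e p)))
    (g := evalDual lam (φ ∘ₗ act lam (cur r e p))) ?_ _
  refine TensorProduct.ext' fun P v => ?_
  rw [LinearMap.comp_apply, LinearMap.lTensor_tmul, evalDual_tmul, evalDual_tmul,
    LinearMap.comp_apply]

/-- `Z` is the identity modulo the variables `x_p`. -/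
lemma constantCoeff_matZ (φ : Module.Dual ℂ (Verma lam)) (v : Verma lam) :
    MvPolynomial.constantCoeff (matZ lam φ v) = φ v := by
  obtain ⟨N, hN⟩ := exists_xe_pow_eq_zero lam v
  rw [matZ_eq_sum lam φ (N := N + 1) fun k hk => hN k (by omega), Finset.sum_range_succ', map_add,
    map_sum]
  have hc : ∀ w, MvPolynomial.constantCoeff (evalDual lam φ (xe lam w)) = 0 := by
    intro w
    induction w using TensorProduct.induction_on with
    | zero => simp
    | add x y hx hy => rw [map_add, map_add, map_add, hx, hy, add_zero]
    | tmul P v =>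
      rw [xe_tmul, map_sum, map_sum]
      refine Finset.sum_eq_zero fun q _ => ?_
      rw [evalDual_tmul, MvPolynomial.constantCoeff_smul, map_mul, MvPolynomial.constantCoeff_X,
        zero_mul, smul_zero]
  rw [Finset.sum_eq_zero fun k _ => by
    rw [MvPolynomial.constantCoeff_smul, pow_succ' (xe lam), Module.End.mul_apply, hc, smul_zero], zero_add]
  rw [pow_zero, Module.End.one_apply, evalDual_tmul]
  simp

lemma screenWord_cons (p : Fin (r + 1)) (ps : List (Fin (r + 1))) :
    screenWord (p :: ps) = screen p * screenWord ps := by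
  rw [screenWord, List.map_cons, List.prod_cons, screenWord]

/-- Every further `S[p]` inserts its `e[p]` directly to the left of `Z`, that is, to the right of
those inserted before; hence the reversal. -/
lemma screenWord_matZ (φ : Module.Dual ℂ (Verma lam)) (ps : List (Fin (r + 1))) (v : Verma lam) :
    screenWord ps (matZ lam φ v) = matZ lam (φ ∘ₗ act lam (word r e ps.reverse)) v := by
  induction ps with
  | nil => simp [screenWord, word, Module.End.one_eq_id]
  | cons p ps ih =>
    rw [screenWord_cons, Module.End.mul_apply, ih, screen_matZ, matZ_act, List.reverse_cons,
      word_append, map_mul, LinearMap.comp_assoc]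
    simp [word, Module.End.mul_eq_comp]

lemma constantCoeff_screenWord_matZ (φ : Module.Dual ℂ (Verma lam)) (ps : List (Fin (r + 1)))
    (v : Verma lam) : MvPolynomial.constantCoeff (screenWord ps (matZ lam φ v)) =
      φ (act lam (word r e ps.reverse) v) := by
  rw [screenWord_matZ, constantCoeff_matZ, LinearMap.comp_apply]

end MatrixElements

/-! ### Operators on the tensor product -/

/-- Subtraction on the tensor product, as an instance that is found by unification. -/
abbrev tensorVermaAddCommGroup {n : ℕ} {r : Fin n → ℕ} (lam : Weights r) :
    AddCommGroup (TensorVerma lam) :=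
  PiTensorProduct.instAddCommGroup (s := fun a => Verma (lam a))

section Sites

attribute [local instance] tensorVermaAddCommGroup

variable {n : ℕ} {r : Fin n → ℕ} (lam : Weights r)

lemma siteOp_tprod (a : Fin n) (x : Sl2) (p : ℕ) (v : ∀ b, Verma (lam b)) :
    siteOp lam a x p (PiTensorProduct.tprod ℂ v) =
      PiTensorProduct.tprod ℂ (Function.update v a (act (lam a) (cur (r a) x p) (v a))) := by
  rw [siteOp, PiTensorProduct.map_tprod]
  congr 1
  funext b
  by_cases hb : b = a
  · subst hb; simp
  · simp [Function.update_of_ne hb]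

lemma end_ext {T T' : Module.End ℂ (TensorVerma lam)}
    (hT : ∀ v, T (PiTensorProduct.tprod ℂ v) = T' (PiTensorProduct.tprod ℂ v)) : T = T' :=
  PiTensorProduct.ext (MultilinearMap.ext hT)

lemma siteOp_comm_of_ne {a b : Fin n} (hab : a ≠ b) (x y : Sl2) (p q : ℕ) :
    siteOp lam a x p * siteOp lam b y q = siteOp lam b y q * siteOp lam a x p := by
  refine end_ext lam fun v => ?_
  rw [Module.End.mul_apply, Module.End.mul_apply, siteOp_tprod, siteOp_tprod, siteOp_tprod,
    siteOp_tprod, Function.update_of_ne hab, Function.update_of_ne hab.symm,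
    Function.update_comm hab]

lemma siteOp_mul_sub (a : Fin n) (x y : Sl2) (p q : ℕ) :
    siteOp lam a x p * siteOp lam a y q - siteOp lam a y q * siteOp lam a x p =
      siteOp lam a ⁅x, y⁆ (p + q) := by
  refine end_ext lam fun v => ?_
  rw [LinearMap.sub_apply, Module.End.mul_apply, Module.End.mul_apply, siteOp_tprod, siteOp_tprod,
    siteOp_tprod, siteOp_tprod, siteOp_tprod, Function.update_self, Function.update_self,
    Function.update_idem, Function.update_idem, ← MultilinearMap.map_update_sub, ← act_mul,
    ← act_mul, ← LinearMap.sub_apply, ← map_sub, cur_mul_sub]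

lemma siteOp_eq_zero (a : Fin n) (x : Sl2) {p : ℕ} (hp : r a < p) : siteOp lam a x p = 0 := by
  refine end_ext lam fun v => ?_
  rw [siteOp_tprod, cur_eq_zero x hp, map_zero, LinearMap.zero_apply, LinearMap.zero_apply]
  exact MultilinearMap.map_coord_zero _ a (Function.update_self _ _ _)

lemma siteOp_smul (a : Fin n) (c : ℂ) (x : Sl2) (p : ℕ) :
    siteOp lam a (c • x) p = c • siteOp lam a x p := by
  refine end_ext lam fun v => ?_
  rw [LinearMap.smul_apply, siteOp_tprod, siteOp_tprod, cur_smul, map_smul, LinearMap.smul_apply,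
    MultilinearMap.map_update_smul]

lemma siteOp_zero (a : Fin n) (p : ℕ) : siteOp lam a 0 p = 0 := by
  rw [← zero_smul ℂ (0 : Sl2), siteOp_smul, zero_smul]

lemma siteOp_comm (a b : Fin n) (x : Sl2) (p q : ℕ) :
    siteOp lam a x p * siteOp lam b x q = siteOp lam b x q * siteOp lam a x p := by
  by_cases hab : a = b
  · subst hab
    rw [← sub_eq_zero, siteOp_mul_sub, lie_self, siteOp_zero]
  · exact siteOp_comm_of_ne lam hab x x p q

/-- The vector `|λ^{(1)}⟩ ⊗ ⋯ ⊗ |λ^{(n)}⟩`. -/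
def vac : TensorVerma lam := PiTensorProduct.tprod ℂ fun a => ket (lam a)

lemma siteOp_e_vac (a : Fin n) (p : ℕ) : siteOp lam a e p (vac lam) = 0 := by
  rw [vac, siteOp_tprod, act_e_ket]
  exact MultilinearMap.map_coord_zero _ a (Function.update_self _ _ _)

lemma siteOp_h_vac (a : Fin n) (p : ℕ) :
    siteOp lam a h p (vac lam) = ext0 (lam a) p • vac lam := by
  rw [vac, siteOp_tprod, act_h_ket, MultilinearMap.map_update_smul, Function.update_eq_self]

/-- The ordered monomial in the `f[p]` with the given exponents. -/
def fMonomial (r : ℕ) (d : Fin (r + 1) → ℕ) : UTrunc r :=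
  (List.ofFn fun p : Fin (r + 1) => cur r f p ^ d p).prod

lemma mul_prod_map_pow {ι A : Type*} [DecidableEq ι] [Monoid A] (g : ι → A)
    (hg : ∀ i j, g i * g j = g j * g i) (q : ι) (d : ι → ℕ) (l : List ι) (hl : l.Nodup)
    (hq : q ∈ l) :
    g q * (l.map fun i => g i ^ d i).prod =
      (l.map fun i => g i ^ (d i + if i = q then 1 else 0)).prod := by
  induction l with
  | nil => simp at hq
  | cons p l ih =>
    rw [List.nodup_cons] at hl
    rw [List.map_cons, List.prod_cons, List.map_cons, List.prod_cons]
    by_cases hpq : p = q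
    · subst hpq
      rw [if_pos rfl, pow_succ', mul_assoc]
      congr 2
      refine congrArg List.prod (List.map_congr_left fun i hi => ?_)
      rw [if_neg (by rintro rfl; exact hl.1 hi), add_zero]
    · have hql : q ∈ l := by
        rcases List.mem_cons.mp hq with h1 | h1
        · exact absurd h1.symm hpq
        · exact h1
      rw [if_neg hpq, add_zero, ← ih hl.2 hql, ← mul_assoc, ← mul_assoc,
        (Commute.pow_right (hg q p : Commute (g q) (g p)) (d p)).eq]

lemma cur_f_mul_fMonomial {r : ℕ} (q : Fin (r + 1)) (d : Fin (r + 1) → ℕ) :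
    cur r f q * fMonomial r d = fMonomial r (fun i => d i + if i = q then 1 else 0) := by
  rw [fMonomial, fMonomial, List.ofFn_eq_map, List.ofFn_eq_map]
  exact mul_prod_map_pow (fun i : Fin (r + 1) => cur r f i) (fun i j => cur_comm r f i j) q d _
    (List.nodup_finRange _) (List.mem_finRange q)

/-- The linear map `u ↦ u |λ^{(1)}⟩ ⊗ ⋯ ⊗ |λ^{(n)}⟩`. -/
def toVermaL : FPoly r →ₗ[ℂ] TensorVerma lam :=
  (MvPolynomial.basisMonomials (Σ a : Fin n, Fin (r a + 1)) ℂ).constr ℂ fun d =>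
    PiTensorProduct.tprod ℂ (fun a : Fin n =>
      act (lam a) (fMonomial (r a) fun p => d ⟨a, p⟩) (ket (lam a)))

lemma toVermaL_monomial (d : (Σ a : Fin n, Fin (r a + 1)) →₀ ℕ) (c : ℂ) :
    toVermaL lam (MvPolynomial.monomial d c) = c • PiTensorProduct.tprod ℂ (fun a : Fin n =>
      act (lam a) (fMonomial (r a) fun p => d ⟨a, p⟩) (ket (lam a))) := by
  have := (MvPolynomial.basisMonomials (Σ a : Fin n, Fin (r a + 1)) ℂ).constr_basis ℂ (fun d =>
    PiTensorProduct.tprod ℂ (fun a : Fin n =>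
      act (lam a) (fMonomial (r a) fun p => d ⟨a, p⟩) (ket (lam a)))) d
  rw [MvPolynomial.coe_basisMonomials] at this
  rw [← mul_one c, ← smul_eq_mul, ← MvPolynomial.smul_monomial, map_smul, toVermaL, this,
    smul_eq_mul, mul_one]

lemma toVerma_eq (u : FPoly r) : toVerma lam u = toVermaL lam u := by
  conv_rhs => rw [u.as_sum, map_sum]
  refine Finset.sum_congr rfl fun d _ => ?_
  rw [toVermaL_monomial]
  rfl

lemma toVermaL_one : toVermaL lam 1 = vac lam := by
  rw [← MvPolynomial.C_1, ← MvPolynomial.monomial_zero', toVermaL_monomial, one_smul, vac]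
  congr 1
  funext a
  simp [fMonomial]

/-- The `f[p]` at one site commute, so one more of them can be sorted into the ordered monomial.
This makes every creation operator a multiplication in `FPoly r`. -/
lemma siteOp_f_toVermaL (a : Fin n) (p : Fin (r a + 1)) (u : FPoly r) :
    siteOp lam a f p (toVermaL lam u) = toVermaL lam (MvPolynomial.X ⟨a, p⟩ * u) := by
  induction u using MvPolynomial.induction_on' with
  | add u v hu hv => rw [map_add, map_add, hu, hv, mul_add, map_add]
  | monomial d c =>
    rw [MvPolynomial.X, MvPolynomial.monomial_mul, one_mul, toVermaL_monomial, toVermaL_monomial,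
      map_smul, siteOp_tprod, ← act_mul, cur_f_mul_fMonomial]
    congr 2
    funext b
    by_cases hb : b = a
    · subst hb
      rw [Function.update_self]
      refine congrArg (fun D => act (lam b) (fMonomial (r b) D) (ket (lam b))) (funext fun q => ?_)
      rw [add_comm, Finsupp.add_apply, Finsupp.single_apply]
      congr 1
      simp [eq_comm]
    · rw [Function.update_of_ne hb]
      refine congrArg (fun D => act (lam b) (fMonomial (r b) D) (ket (lam b))) (funext fun q => ?_)
      rw [Finsupp.add_apply, Finsupp.single_apply, if_neg, zero_add]
      intro hc
      exact hb (Sigma.mk.inj hc).1.symm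

end Sites

/-! ### Currents with several poles -/

section TwoPoint

/-- Used for modes `c[p + q]` that vanish beyond the truncation: the square of indices reduces to a
triangle, which is summed along the antidiagonals. -/
lemma sum_range_sum_range_of_vanish {M : Type*} [AddCommMonoid M] (N : ℕ) (φ : ℕ → ℕ → M)
    (hφ : ∀ p q, N ≤ p + q → φ p q = 0) :
    ∑ p ∈ Finset.range N, ∑ q ∈ Finset.range N, φ p q =
      ∑ s ∈ Finset.range N, ∑ p ∈ Finset.range (s + 1), φ p (s - p) := by
  rw [Finset.sum_range_diag_flip]
  refine Finset.sum_congr rfl fun p _ => ?_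
  refine (Finset.sum_subset (by intro q; simp; omega) fun q _ hq => hφ p q ?_).symm
  rw [Finset.mem_range] at hq; omega

variable {L A : Type*} [CommRing L] [Ring A] [Algebra L A] {n : ℕ} (r : Fin n → ℕ)

/-- `∑ b, ∑ q, (G b) ^ (q + 1) x^{(b)}[q]`. -/
def current (x : Fin n → ℕ → A) (G : Fin n → L) : A :=
  ∑ b, ∑ q ∈ Finset.range (r b + 1), G b ^ (q + 1) • x b q

variable {r}

/-- A geometric sum. The model is `G = 1 / (ζ - z)`, `G' = 1 / (t - z)`, for which the hypothesis
holds with `g = 1 / (ζ - t)`. -/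
lemma sum_pow_mul_pow {g G G' : L} (hg : g * (G - G') = -(G * G')) (s : ℕ) :
    ∑ p ∈ Finset.range (s + 1), G ^ (p + 1) * G' ^ (s - p + 1) =
      -(g * (G ^ (s + 1) - G' ^ (s + 1))) := by
  have h1 := (Commute.all G G').geom_sum₂_mul (s + 1)
  have h2 : ∑ p ∈ Finset.range (s + 1), G ^ (p + 1) * G' ^ (s - p + 1) =
      (G * G') * ∑ p ∈ Finset.range (s + 1), G ^ p * G' ^ (s + 1 - 1 - p) := by
    rw [Finset.mul_sum]
    refine Finset.sum_congr rfl fun p _ => ?_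
    rw [Nat.add_sub_cancel]
    ring
  rw [h2, ← h1, ← neg_neg (G * G'), ← hg]
  ring

/-- The commutator of two currents at different points. -/
lemma current_commutator {x y c : Fin n → ℕ → A} {G G' : Fin n → L} {g : L}
    (hxy : ∀ b p q, x b p * y b q - y b q * x b p = c b (p + q))
    (hne : ∀ b b', b ≠ b' → ∀ p q, x b p * y b' q = y b' q * x b p)
    (hc : ∀ b s, r b < s → c b s = 0)
    (hg : ∀ b, g * (G b - G' b) = -(G b * G' b)) :
    current r x G * current r y G' - current r y G' * current r x G =
      -(g • (current r c G - current r c G')) := by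
  have h1 : current r x G * current r y G' - current r y G' * current r x G =
      ∑ b, ∑ p ∈ Finset.range (r b + 1), ∑ q ∈ Finset.range (r b + 1),
        (G b ^ (p + 1) * G' b ^ (q + 1)) • c b (p + q) := by
    have h2 : current r y G' * current r x G = ∑ b, ∑ b',
        (∑ q ∈ Finset.range (r b' + 1), G' b' ^ (q + 1) • y b' q) *
          ∑ p ∈ Finset.range (r b + 1), G b ^ (p + 1) • x b p := by
      rw [current, current, Finset.sum_mul_sum, Finset.sum_comm]
    rw [h2, current, current, Finset.sum_mul_sum, ← Finset.sum_sub_distrib]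
    refine Finset.sum_congr rfl fun b _ => ?_
    rw [← Finset.sum_sub_distrib, Finset.sum_eq_single b]
    · rw [Finset.sum_mul_sum, Finset.sum_mul_sum, Finset.sum_comm, ← Finset.sum_sub_distrib,
        Finset.sum_comm]
      rw [Finset.sum_comm]
      simp_rw [← Finset.sum_sub_distrib]
      rw [Finset.sum_comm]
      refine Finset.sum_congr rfl fun p _ => Finset.sum_congr rfl fun q _ => ?_
      rw [← hxy, smul_mul_smul_comm, smul_mul_smul_comm, smul_sub, mul_comm (G' b ^ _)]
    · intro b' _ hb'
      rw [sub_eq_zero]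
      refine Commute.sum_left _ _ _ fun p _ => Commute.sum_right _ _ _ fun q _ => ?_
      refine Commute.smul_left (Commute.smul_right ?_ _) _
      exact hne b b' hb'.symm p q
    · simp
  have h3 : -(g • (current r c G - current r c G')) = ∑ b, ∑ s ∈ Finset.range (r b + 1),
      (-(g * (G b ^ (s + 1) - G' b ^ (s + 1)))) • c b s := by
    rw [current, current, ← Finset.sum_sub_distrib, Finset.smul_sum, ← Finset.sum_neg_distrib]
    refine Finset.sum_congr rfl fun b _ => ?_
    rw [← Finset.sum_sub_distrib, Finset.smul_sum, ← Finset.sum_neg_distrib]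
    refine Finset.sum_congr rfl fun s _ => ?_
    rw [← sub_smul, smul_smul, neg_smul]
  rw [h1, h3]
  refine Finset.sum_congr rfl fun b _ => ?_
  rw [sum_range_sum_range_of_vanish _ _ fun p q hpq => by rw [hc b _ (by omega), smul_zero]]
  refine Finset.sum_congr rfl fun s _ => ?_
  rw [← sum_pow_mul_pow (hg b) s, Finset.sum_smul]
  refine Finset.sum_congr rfl fun p hp => ?_
  rw [Finset.mem_range] at hp
  rw [show p + (s - p) = s by omega]

lemma current_commute {x y : Fin n → ℕ → A} {G G' : Fin n → L}
    (hne : ∀ b b', ∀ p q, x b p * y b' q = y b' q * x b p) :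
    current r x G * current r y G' = current r y G' * current r x G := by
  refine Commute.sum_left _ _ _ fun b _ => Commute.sum_left _ _ _ fun p _ => ?_
  refine Commute.sum_right _ _ _ fun b' _ => Commute.sum_right _ _ _ fun q _ => ?_
  exact Commute.smul_left (Commute.smul_right (hne b b' p q) _) _

lemma current_smul (c : L) (x : Fin n → ℕ → A) (G : Fin n → L) :
    current r (fun b q => c • x b q) G = c • current r x G := by
  simp only [current, Finset.smul_sum]
  exact Finset.sum_congr rfl fun b _ => Finset.sum_congr rfl fun q _ => smul_comm _ _ _

/-- The commutator of the quadratic Casimir with a current. -/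
lemma casimir_commutator {E H F f h : A} {g q : L} (hq : 4 * q = 1)
    (h1 : E * f - f * E = -(g • (H - h)))
    (h2 : H * f - f * H = (2 : L) • (g • (F - f)))
    (h3 : h * F - F * h = (2 : L) • (g • (F - f)))
    (h4 : F * f = f * F) :
    (q • (H * H) + (2 * q) • (E * F + F * E)) * f - f * (q • (H * H) + (2 * q) • (E * F + F * E)) =
      g • (F * h - f * H) := by
  have e1 : E * f = f * E - g • (H - h) := by rw [sub_eq_iff_eq_add.mp h1]; abel
  have e2 : H * f = f * H + (2 : L) • (g • (F - f)) := by rw [sub_eq_iff_eq_add.mp h2]; abel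
  have e3 : h * F = F * h + (2 : L) • (g • (F - f)) := by rw [sub_eq_iff_eq_add.mp h3]; abel
  -- The terms quadratic in `g` cancel between `a1` and `a2`, and the products `H F` and `F H`
  -- cancel among the three identities. No commutation relation between the currents at the first
  -- point is needed.
  have a1 : H * H * f = f * (H * H) + (4 * g) • (F * H - f * H) + (2 * g) • (H * F - F * H)
      - (4 * g * g) • (F - f) := by
    rw [mul_assoc, e2, mul_add, ← mul_assoc, e2]
    simp only [add_mul, mul_smul_comm, smul_mul_assoc, mul_sub, sub_mul, smul_sub, smul_smul,
      mul_assoc, e2, smul_add]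
    module
  have a2 : E * F * f = f * (E * F) - g • (H * F) + g • (F * h) + (2 * g * g) • (F - f) := by
    rw [mul_assoc, h4, ← mul_assoc, e1]
    simp only [sub_mul, smul_mul_assoc, e3, mul_assoc, smul_add, smul_sub, smul_smul]
    module
  have a3 : F * E * f = f * (F * E) - g • (F * H) + g • (F * h) := by
    rw [mul_assoc, e1, mul_sub, ← mul_assoc, h4]
    simp only [mul_sub, mul_smul_comm, mul_assoc, smul_sub]
    abel
  rw [add_mul, smul_mul_assoc, smul_mul_assoc, add_mul, a1, a2, a3]
  have e4 : g • (F * h - f * H) = (4 * q) • (g • (F * h - f * H)) := by rw [hq, one_smul]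
  rw [e4]
  simp only [mul_add, mul_smul_comm, smul_add, smul_sub, smul_smul]
  module

end TwoPoint

/-! ### Laurent coefficients of partial fractions -/

section LaurentCoefficients

/-- The expansion of `(ζ + d) ^ (-q - 1)`. -/
def geomSeries (d : ℂ) (q : ℕ) : PowerSeries ℂ :=
  PowerSeries.mk fun k => (-1) ^ k * ((k + q).choose q : ℂ) / d ^ (k + q + 1)

lemma mul_geomSeries_zero {d : ℂ} (hd : d ≠ 0) :
    (PowerSeries.X + PowerSeries.C d) * geomSeries d 0 = 1 := by
  ext k
  rcases k with _ | k
  · simp [geomSeries, hd]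
  · rw [add_mul, map_add, PowerSeries.coeff_succ_X_mul, PowerSeries.coeff_C_mul,
      PowerSeries.coeff_one, if_neg (Nat.succ_ne_zero k)]
    simp [geomSeries]
    field_simp
    ring

/-- Coefficientwise this is Pascal's rule. -/
lemma mul_geomSeries_succ {d : ℂ} (hd : d ≠ 0) (q : ℕ) :
    (PowerSeries.X + PowerSeries.C d) * geomSeries d (q + 1) = geomSeries d q := by
  ext k
  rcases k with _ | k
  · rw [add_mul, map_add, PowerSeries.coeff_zero_X_mul, PowerSeries.coeff_C_mul]
    simp [geomSeries]
    field_simp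
    ring
  · rw [add_mul, map_add, PowerSeries.coeff_succ_X_mul, PowerSeries.coeff_C_mul]
    simp only [geomSeries, PowerSeries.coeff_mk]
    have h1 : ((k + 1 + (q + 1)).choose (q + 1) : ℂ) =
        ((k + 1 + q).choose q : ℂ) + ((k + (q + 1)).choose (q + 1) : ℂ) := by
      rw [show k + 1 + (q + 1) = (k + 1 + q) + 1 by ring, Nat.choose_succ_succ,
        show k + 1 + q = k + (q + 1) by ring]
      push_cast; ring
    rw [h1]
    field_simp
    ring

lemma mul_geomSeries {d : ℂ} (hd : d ≠ 0) (q : ℕ) :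
    (PowerSeries.X + PowerSeries.C d) ^ (q + 1) * geomSeries d q = 1 := by
  induction q with
  | zero => rw [zero_add, pow_one, mul_geomSeries_zero hd]
  | succ q ih => rw [pow_succ, mul_assoc, mul_geomSeries_succ hd, ih]

/-- `1 / (ζ + d)` as a Laurent series in `ζ`. -/
def pole (d : ℂ) : LaurentSeries ℂ := (HahnSeries.single 1 1 + HahnSeries.C d)⁻¹

lemma single_add_C_ne_zero (d : ℂ) :
    (HahnSeries.single 1 1 + HahnSeries.C d : LaurentSeries ℂ) ≠ 0 := by
  intro h0
  have := congrArg (fun x : LaurentSeries ℂ => x.coeff 1) h0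
  simp [HahnSeries.C_apply] at this

/-- The resolvent identity, from which the hypothesis of `current_commutator` is derived for Laurent
series. -/
lemma pole_mul_sub (d d' : ℂ) :
    HahnSeries.C (d' - d) * (pole d * pole d') = pole d - pole d' := by
  have h1 := single_add_C_ne_zero d
  have h2 := single_add_C_ne_zero d'
  rw [pole, pole, map_sub]
  field_simp
  ring

lemma pole_zero : pole 0 = HahnSeries.single (-1) 1 := by
  rw [pole, map_zero, add_zero]
  exact (eq_inv_of_mul_eq_one_left (by simp)).symm

lemma pole_pow {d : ℂ} (hd : d ≠ 0) (q : ℕ) :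
    pole d ^ (q + 1) = ((geomSeries d q : PowerSeries ℂ) : LaurentSeries ℂ) := by
  rw [pole, inv_pow]
  refine inv_eq_of_mul_eq_one_right ?_
  have := congrArg (HahnSeries.ofPowerSeries ℤ ℂ) (mul_geomSeries hd q)
  rw [map_mul, map_pow, map_add, map_one] at this
  simpa using this

/-- The coefficient of `ζ ^ (-K - 1)`. -/
def polarCoeff (K : ℕ) : LaurentSeries ℂ →ₗ[ℂ] ℂ where
  toFun x := x.coeff (-(K : ℤ) - 1)
  map_add' _ _ := rfl
  map_smul' _ _ := rfl

lemma polarCoeff_powerSeries (K : ℕ) (S : PowerSeries ℂ) :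
    polarCoeff K (S : LaurentSeries ℂ) = 0 := by
  change (S : LaurentSeries ℂ).coeff (-(K : ℤ) - 1) = 0
  rw [PowerSeries.coeff_coe, if_pos (by omega)]

lemma polarCoeff_pole_zero_pow (K p : ℕ) :
    polarCoeff K (pole 0 ^ (p + 1)) = if p = K then 1 else 0 := by
  change (pole 0 ^ (p + 1)).coeff (-(K : ℤ) - 1) = _
  rw [pole_zero, HahnSeries.single_pow, one_pow, HahnSeries.coeff_single]
  congr 1
  rw [eq_iff_iff]
  simp
  omega

/-- Multiplication by `ζ ^ (-p - 1)` moves the coefficient of `ζ ^ (p - K)` in the power series of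
the second factor to the polar position; for `p < K` there is no such coefficient. -/
lemma polarCoeff_pole_zero_pow_mul (K p : ℕ) {d : ℂ} (hd : d ≠ 0) (q : ℕ) :
    polarCoeff K (pole 0 ^ (p + 1) * pole d ^ (q + 1)) =
      if K ≤ p then (-1) ^ (p - K) * ((p - K + q).choose q : ℂ) / d ^ (p - K + q + 1) else 0 := by
  change (pole 0 ^ (p + 1) * pole d ^ (q + 1)).coeff (-(K : ℤ) - 1) = _
  rw [pole_zero, HahnSeries.single_pow, one_pow, pole_pow hd]
  have h1 : (-(K : ℤ) - 1) = ((p : ℤ) - K) + ((p + 1) • (-1 : ℤ)) := by simp; ring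
  rw [h1, HahnSeries.coeff_single_mul_add, one_mul, PowerSeries.coeff_coe]
  split_ifs with h2 h3 h3
  · omega
  · rfl
  · rw [geomSeries, PowerSeries.coeff_mk, show ((p : ℤ) - K).natAbs = p - K by omega]
  · omega

lemma polarCoeff_mul_pole_pow (K : ℕ) (S : PowerSeries ℂ) {d : ℂ} (hd : d ≠ 0) (q : ℕ) :
    polarCoeff K ((S : LaurentSeries ℂ) * pole d ^ (q + 1)) = 0 := by
  rw [pole_pow hd, ← PowerSeries.coe_mul, polarCoeff_powerSeries]

end LaurentCoefficients

/-! ### The off-shell Bethe ansatz equation -/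

section OffShell

variable {V C ι : Type*} [AddCommGroup V] [Module ℂ V] [CommRing C] [Algebra ℂ C] [DecidableEq ι]
  (Θ : C →ₗ[ℂ] V) (φ ψ : ι → C)

/-- The action on a product of creation operators `φ j` of an operator `X` with
`[X, φ j] = 2 g j (χ - ψ j)`. -/
lemma apply_prod_of_commutator (fo : ι → Module.End ℂ V) (hfo : ∀ j P, fo j (Θ P) = Θ (φ j * P))
    (χ : C) (X : Module.End ℂ V) (c : ℂ) (g : ι → ℂ) (hvac : X (Θ 1) = c • Θ 1) (S : Finset ι)
    (hX : ∀ j ∈ S, ∀ P, X (Θ (φ j * P)) = fo j (X (Θ P)) + (2 * g j) • Θ ((χ - ψ j) * P)) :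
    X (Θ (∏ j ∈ S, φ j)) = Θ (c • ∏ j ∈ S, φ j +
      ∑ j ∈ S, (2 * g j) • ((χ - ψ j) * ∏ i ∈ S.erase j, φ i)) := by
  induction S using Finset.induction_on with
  | empty => simpa using hvac
  | insert k S hk ih =>
    rw [Finset.prod_insert hk, hX k (Finset.mem_insert_self k S),
      ih fun j hj => hX j (Finset.mem_insert_of_mem hj), hfo, ← map_smul, ← map_add]
    congr 1
    rw [Finset.sum_insert hk, Finset.erase_insert hk, mul_add, mul_smul_comm, Finset.mul_sum,
      add_assoc]
    congr 1
    rw [add_comm]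
    congr 1
    refine Finset.sum_congr rfl fun j hj => ?_
    have hjk : j ≠ k := fun hjk => hk (hjk ▸ hj)
    rw [Finset.erase_insert_of_ne hjk.symm, Finset.prod_insert (fun h1 => hk (Finset.mem_erase.mp h1).2),
      mul_smul_comm]
    congr 1
    ring

/-- The off-shell Bethe ansatz equation for an operator `H` with
`[H, f_j] = f_j H_j - F_j h_j`. -/
lemma apply_prod_offShell (fo Fo ho Ho : ι → Module.End ℂ V) (H : Module.End ℂ V)
    (hfo : ∀ j P, fo j (Θ P) = Θ (φ j * P)) (hFo : ∀ j P, Fo j (Θ P) = Θ (ψ j * P))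
    (g : ι → ι → ℂ) (hg : ∀ i j, g i j = -g j i) (E : ℂ) (lam Lam : ι → ℂ)
    (hH : ∀ j, H * fo j = fo j * H + (fo j * Ho j - Fo j * ho j))
    (hh : ∀ i j, i ≠ j → ho i * fo j = fo j * ho i + (2 * g i j) • (fo i - fo j))
    (hHo : ∀ i j, i ≠ j → Ho i * fo j = fo j * Ho i + (2 * g i j) • (Fo i - Fo j))
    (vacE : H (Θ 1) = E • Θ 1) (vach : ∀ j, ho j (Θ 1) = lam j • Θ 1)
    (vacH : ∀ j, Ho j (Θ 1) = Lam j • Θ 1) (S : Finset ι) :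
    H (Θ (∏ j ∈ S, φ j)) = Θ ((E + ∑ j ∈ S, Lam j) • ∏ j ∈ S, φ j -
      ∑ j ∈ S, (lam j - ∑ i ∈ S.erase j, 2 * g j i) • (ψ j * ∏ i ∈ S.erase j, φ i)) := by
  induction S using Finset.induction_on with
  | empty => simpa using vacE
  | insert k S hk ih =>
    have hne : ∀ j ∈ S, k ≠ j := fun j hj hkj => hk (hkj ▸ hj)
    have hh' := apply_prod_of_commutator Θ φ φ fo hfo (φ k) (ho k) (lam k) (g k) (vach k) S
      (fun j hj P => by
        rw [← hfo, ← Module.End.mul_apply, hh k j (hne j hj), LinearMap.add_apply,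
          LinearMap.smul_apply, LinearMap.sub_apply, hfo, hfo, ← map_sub, ← sub_mul,
          Module.End.mul_apply])
    have hH' := apply_prod_of_commutator Θ φ ψ fo hfo (ψ k) (Ho k) (Lam k) (g k) (vacH k) S
      (fun j hj P => by
        rw [← hfo, ← Module.End.mul_apply, hHo k j (hne j hj), LinearMap.add_apply,
          LinearMap.smul_apply, LinearMap.sub_apply, hFo, hFo, ← map_sub, ← sub_mul,
          Module.End.mul_apply])
    rw [Finset.prod_insert hk, ← hfo, ← Module.End.mul_apply, hH k, LinearMap.add_apply,
      LinearMap.sub_apply, Module.End.mul_apply, Module.End.mul_apply, Module.End.mul_apply, ih,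
      hh', hH', hfo, hfo, hFo, ← map_sub, ← map_add]
    congr 1
    rw [Finset.sum_insert hk, Finset.sum_insert hk, Finset.erase_insert hk]
    -- The new factor `k` changes the coefficient of each old `j` by one interaction term, whose
    -- sign is reversed by the antisymmetry of `g`. It is matched by the `ψ j` part of the
    -- commutator of `Ho k` with the old factors.
    have h1 : ∀ j ∈ S, (lam j - ∑ i ∈ (insert k S).erase j, 2 * g j i) •
        (ψ j * ∏ i ∈ (insert k S).erase j, φ i) =
        φ k * ((lam j - ∑ i ∈ S.erase j, 2 * g j i) • (ψ j * ∏ i ∈ S.erase j, φ i)) +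
          (2 * g k j) • (φ k * (ψ j * ∏ i ∈ S.erase j, φ i)) := by
      intro j hj
      have hkj : k ∉ S.erase j := fun h1 => hk (Finset.mem_erase.mp h1).2
      rw [Finset.erase_insert_of_ne (hne j hj), Finset.prod_insert hkj, Finset.sum_insert hkj,
        hg j k, mul_smul_comm, mul_left_comm (ψ j)]
      module
    have h2 : ∀ j ∈ S, (2 * g k j) • ((φ k - φ j) * ∏ i ∈ S.erase j, φ i) =
        (2 * g k j) • (φ k * ∏ i ∈ S.erase j, φ i) - (2 * g k j) • ∏ i ∈ S, φ i := by
      intro j hj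
      rw [sub_mul, Finset.mul_prod_erase S φ hj, smul_sub]
    have h3 : ∀ j ∈ S, (2 * g k j) • ((ψ k - ψ j) * ∏ i ∈ S.erase j, φ i) =
        (2 * g k j) • (ψ k * ∏ i ∈ S.erase j, φ i) -
          (2 * g k j) • (ψ j * ∏ i ∈ S.erase j, φ i) := by
      intro j hj
      rw [sub_mul, smul_sub]
    rw [Finset.sum_congr rfl h1, Finset.sum_congr rfl h2, Finset.sum_congr rfl h3,
      Finset.sum_sub_distrib, Finset.sum_sub_distrib, Finset.sum_add_distrib, ← Finset.sum_smul]
    simp only [mul_sub, mul_add, Finset.mul_sum, mul_smul_comm]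
    -- The terms containing both `φ k` and `ψ k` come once from `fo k * Ho k` and once from `Fo k *
    -- ho k`, and cancel.
    have h4 : ∑ j ∈ S, (2 * g k j) • (φ k * (ψ k * ∏ i ∈ S.erase j, φ i)) =
        ∑ j ∈ S, (2 * g k j) • (ψ k * (φ k * ∏ i ∈ S.erase j, φ i)) :=
      Finset.sum_congr rfl fun j _ => by rw [mul_left_comm]
    rw [h4]
    module

end OffShell

/-! ### The Gaudin Hamiltonians -/

section Gaudin

attribute [local instance] tensorVermaAddCommGroup

variable {n : ℕ} {r : Fin n → ℕ}

lemma current_mul {L A : Type*} [CommRing L] [Ring A] [Algebra L A] (x y : Fin n → ℕ → A)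
    (G G' : Fin n → L) : current r x G * current r y G' =
      ∑ b, ∑ c, ∑ p ∈ Finset.range (r b + 1), ∑ s ∈ Finset.range (r c + 1),
        (G b ^ (p + 1) * G' c ^ (s + 1)) • (x b p * y c s) := by
  rw [current, current, Finset.sum_mul_sum]
  refine Finset.sum_congr rfl fun b _ => Finset.sum_congr rfl fun c _ => ?_
  rw [Finset.sum_mul_sum]
  refine Finset.sum_congr rfl fun p _ => Finset.sum_congr rfl fun s _ => ?_
  rw [smul_mul_smul_comm]

/-! ### Operators with coefficients in an algebra of functions of the spectral parameter -/

section OpSeries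

variable {L : Type*} [CommRing L] [Algebra ℂ L] (R : L →ₗ[ℂ] ℂ) {E : Type*} [Ring E] [Algebra ℂ E]

/-- The application of a functional to the coefficients. -/
def opCoeff : L ⊗[ℂ] E →ₗ[ℂ] E :=
  (TensorProduct.lid ℂ E).toLinearMap ∘ₗ LinearMap.rTensor E R

/-- The constant functions. -/
def opConst : E →ₐ[ℂ] L ⊗[ℂ] E := Algebra.TensorProduct.includeRight

lemma opCoeff_tmul (l : L) (X : E) : opCoeff R (l ⊗ₜ[ℂ] X) = R l • X := by
  simp [opCoeff]

lemma smul_opConst (l : L) (X : E) : l • (opConst X : L ⊗[ℂ] E) = l ⊗ₜ[ℂ] X := by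
  rw [opConst, Algebra.TensorProduct.includeRight_apply, TensorProduct.smul_tmul', smul_eq_mul,
    mul_one]

lemma opCoeff_smul_opConst (l : L) (X : E) :
    opCoeff R (l • (opConst X : L ⊗[ℂ] E)) = R l • X := by
  rw [smul_opConst, opCoeff_tmul]

/-- Constant operators pass through the extraction of coefficients. So the commutator with a current
at a fixed point may be computed before a coefficient in the spectral parameter is taken. -/
lemma opCoeff_mul_opConst (Y : L ⊗[ℂ] E) (X : E) :
    opCoeff R (Y * opConst X) = opCoeff R Y * X := by
  induction Y using TensorProduct.induction_on with
  | zero => simp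
  | add Y Z hY hZ => rw [add_mul, map_add, hY, hZ, map_add, add_mul]
  | tmul l Y =>
    rw [opConst, Algebra.TensorProduct.includeRight_apply, Algebra.TensorProduct.tmul_mul_tmul,
      opCoeff_tmul, opCoeff_tmul, mul_one, smul_mul_assoc]

lemma opCoeff_opConst_mul (Y : L ⊗[ℂ] E) (X : E) :
    opCoeff R (opConst X * Y) = X * opCoeff R Y := by
  induction Y using TensorProduct.induction_on with
  | zero => simp
  | add Y Z hY hZ => rw [mul_add, map_add, hY, hZ, map_add, mul_add]
  | tmul l Y =>
    rw [opConst, Algebra.TensorProduct.includeRight_apply, Algebra.TensorProduct.tmul_mul_tmul,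
      opCoeff_tmul, opCoeff_tmul, one_mul, mul_smul_comm]

lemma algebraMap_smul_opConst (c : ℂ) (X : E) :
    (algebraMap ℂ L c) • (opConst X : L ⊗[ℂ] E) = opConst (c • X) := by
  rw [map_smul, algebraMap_smul]

lemma current_opConst (x : Fin n → ℕ → E) (u : Fin n → ℂ) :
    current r (fun b q => (opConst (x b q) : L ⊗[ℂ] E)) (fun b => algebraMap ℂ L (u b)) =
      opConst (current r x u) := by
  rw [current, current, map_sum]
  refine Finset.sum_congr rfl fun b _ => ?_
  rw [map_sum]
  refine Finset.sum_congr rfl fun q _ => ?_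
  rw [← map_pow, algebraMap_smul_opConst]

end OpSeries

lemma sum_range_shift {M : Type*} [AddCommMonoid M] (N K : ℕ) (φ : ℕ → ℕ → M)
    (hφ : ∀ p q, N ≤ q → φ p q = 0) :
    ∑ q ∈ Finset.range N, (if K ≤ q then φ (q - K) q else 0) =
      ∑ q ∈ Finset.range N, φ q (K + q) := by
  rw [← Finset.sum_filter]
  have h1 : (Finset.range N).filter (fun q => K ≤ q) = Finset.Ico K N := by
    ext q; simp [and_comm]
  rw [h1, Finset.sum_Ico_eq_sum_range]
  refine Eq.trans ?_ (Finset.sum_subset (s₁ := Finset.range (N - K)) (f := fun q => φ q (K + q))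
    (by intro q; simp; omega)
    fun q _ hq => hφ _ _ (by rw [Finset.mem_range] at hq; omega))
  refine Finset.sum_congr rfl fun q _ => ?_
  rw [Nat.add_sub_cancel_left]

/-- The modes at the point with the number `a`, shifted by `K`. -/
def shifted {M : Type*} [Zero M] (a : Fin n) (K : ℕ) (x : Fin n → ℕ → M) (b : Fin n) (q : ℕ) : M :=
  if b = a then x a (K + q) else 0

lemma current_shifted {L A : Type*} [CommRing L] [Ring A] [Algebra L A] (a : Fin n) (K : ℕ)
    (x : Fin n → ℕ → A) (G : Fin n → L) : current r (shifted a K x) G =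
      ∑ q ∈ Finset.range (r a + 1), G a ^ (q + 1) • x a (K + q) := by
  rw [current, Finset.sum_eq_single a]
  · simp [shifted]
  · intro b _ hb
    simp [shifted, hb]
  · simp

/-- The function `1 / (t - z_b)` of the number of the point. -/
def invDist (z : Fin n → ℂ) (t : ℂ) (b : Fin n) : ℂ := (t - z b)⁻¹


/-! ### Polar coefficients of the currents and of the quadratic current -/

section Residue

variable {L : Type*} [CommRing L] [Algebra ℂ L] (R : L →ₗ[ℂ] ℂ) {E : Type*} [Ring E] [Algebra ℂ E]
  {z : Fin n → ℂ} {t : ℂ} {a : Fin n} {K : ℕ} {G : Fin n → L} {g : L}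

/-- Only the poles of the site `a` contribute. From `g * G a ^ (q + 1)` the functional extracts a
power of `1 / (t - z_a)` whose order is lowered by `K`, so the mode `K + q` ends up with the weight
that belongs to the mode `q`. -/
lemma opCoeff_smul_current
    (hR4 : ∀ q, R (g * G a ^ (q + 1)) = if K ≤ q then -(invDist z t a ^ (q - K + 1)) else 0)
    (hR5 : ∀ b q, b ≠ a → R (g * G b ^ (q + 1)) = 0)
    (x : Fin n → ℕ → E) (hx : ∀ q, r a < q → x a q = 0) :
    opCoeff R (g • current r (fun b q => (opConst (x b q) : L ⊗[ℂ] E)) G) =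
        -current r (shifted a K x) (invDist z t) := by
  rw [current_shifted, current, Finset.smul_sum, map_sum, Finset.sum_eq_single a]
  · rw [Finset.smul_sum, map_sum, ← Finset.sum_neg_distrib, ← sum_range_shift (r a + 1) K
      (fun q s => -(invDist z t a ^ (q + 1) • x a s))
      (fun p q hq => by rw [hx q (by omega), smul_zero, neg_zero])]
    refine Finset.sum_congr rfl fun q _ => ?_
    rw [smul_smul, opCoeff_smul_opConst, hR4]
    split_ifs with hKq
    · rw [neg_smul]
    · rw [zero_smul]
  · intro b _ hb
    rw [Finset.smul_sum, map_sum]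
    refine Finset.sum_eq_zero fun q _ => ?_
    rw [smul_smul, opCoeff_smul_opConst, hR5 b q hb, zero_smul]
  · simp

/-- The generic form of `casimir`. -/
def cas (e h f : Fin n → ℕ → E) (b c : Fin n) (p q : ℕ) : E :=
  (1 / 2 : ℂ) • (h b p * h c q) + e b p * f c q + f b p * e c q

/-- The generic form of `hamiltonian`. -/
def gaudin (r : Fin n → ℕ) (e h f : Fin n → ℕ → E) (z : Fin n → ℂ) (a : Fin n) (K : ℕ) : E :=
  (∑ p ∈ Finset.range K, (1 / 2 : ℂ) • cas e h f a a p (K - 1 - p)) +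
    ∑ b ∈ Finset.univ.erase a, ∑ p ∈ Finset.Icc K (r a), ∑ q ∈ Finset.range (r b + 1),
      ((-1) ^ (p - K) * ((p - K + q).choose q : ℂ) / (z a - z b) ^ (p - K + q + 1)) •
        cas e h f a b p q

/-- In the double sum over sites, the terms with both sites at `a` contribute on one antidiagonal,
and those with no site at `a` have no pole there. The mixed terms occur in both orders and agree by
`hsymm`, so their two halves add up. -/
lemma opCoeff_casimir {e h f : Fin n → ℕ → E} (hK : K ≤ r a + 1)
    (hsymm : ∀ b c p q, b ≠ c → cas e h f b c p q = cas e h f c b q p)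
    (hR1 : ∀ p q, R (G a ^ (p + 1) * G a ^ (q + 1)) = if p + q + 1 = K then 1 else 0)
    (hR2 : ∀ b p q, b ≠ a → R (G a ^ (p + 1) * G b ^ (q + 1)) =
      if K ≤ p then (-1) ^ (p - K) * ((p - K + q).choose q : ℂ) / (z a - z b) ^ (p - K + q + 1)
      else 0)
    (hR3 : ∀ b c p q, b ≠ a → c ≠ a → R (G b ^ (p + 1) * G c ^ (q + 1)) = 0) :
    opCoeff R (algebraMap ℂ L (1 / 4) • (current r (fun b q => (opConst (h b q) : L ⊗[ℂ] E)) G *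
        current r (fun b q => opConst (h b q)) G) +
      (2 * algebraMap ℂ L (1 / 4)) • (current r (fun b q => opConst (e b q)) G *
          current r (fun b q => opConst (f b q)) G +
        current r (fun b q => opConst (f b q)) G * current r (fun b q => opConst (e b q)) G)) =
      gaudin r e h f z a K := by
  have h1 : algebraMap ℂ L (1 / 4) • (current r (fun b q => (opConst (h b q) : L ⊗[ℂ] E)) G *
        current r (fun b q => opConst (h b q)) G) +
      (2 * algebraMap ℂ L (1 / 4)) • (current r (fun b q => opConst (e b q)) G *
          current r (fun b q => opConst (f b q)) G +
        current r (fun b q => opConst (f b q)) G * current r (fun b q => opConst (e b q)) G) =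
      ∑ b, ∑ c, ∑ p ∈ Finset.range (r b + 1), ∑ q ∈ Finset.range (r c + 1),
        (G b ^ (p + 1) * G c ^ (q + 1)) • opConst ((1 / 2 : ℂ) • cas e h f b c p q) := by
    have h2 : (2 * algebraMap ℂ L (1 / 4)) = algebraMap ℂ L (1 / 2) := by
      rw [show (1 / 2 : ℂ) = 2 * (1 / 4) by norm_num, map_mul, map_ofNat]
    rw [h2, current_mul, current_mul, current_mul]
    simp only [smul_add, Finset.smul_sum, ← Finset.sum_add_distrib]
    refine Finset.sum_congr rfl fun b _ => Finset.sum_congr rfl fun c _ =>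
      Finset.sum_congr rfl fun p _ => Finset.sum_congr rfl fun q _ => ?_
    rw [smul_comm _ (G b ^ (p + 1) * G c ^ (q + 1)), smul_comm _ (G b ^ (p + 1) * G c ^ (q + 1)),
      smul_comm _ (G b ^ (p + 1) * G c ^ (q + 1)), ← smul_add, ← smul_add, ← map_mul, ← map_mul,
      ← map_mul, algebraMap_smul_opConst, algebraMap_smul_opConst, algebraMap_smul_opConst,
      ← map_add, ← map_add, cas, smul_add, smul_add, smul_smul, add_assoc]
    norm_num
  have h3 : ∀ b c, opCoeff R (∑ p ∈ Finset.range (r b + 1), ∑ q ∈ Finset.range (r c + 1),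
      (G b ^ (p + 1) * G c ^ (q + 1)) • opConst ((1 / 2 : ℂ) • cas e h f b c p q)) =
      ∑ p ∈ Finset.range (r b + 1), ∑ q ∈ Finset.range (r c + 1),
        R (G b ^ (p + 1) * G c ^ (q + 1)) • ((1 / 2 : ℂ) • cas e h f b c p q) := by
    intro b c
    simp only [map_sum, opCoeff_smul_opConst]
  have hIcc : ∀ (φ : ℕ → E), ∑ p ∈ Finset.range (r a + 1), (if K ≤ p then φ p else 0) =
      ∑ p ∈ Finset.Icc K (r a), φ p := by
    intro φ
    rw [← Finset.sum_filter]
    refine Finset.sum_congr ?_ fun _ _ => rfl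
    ext p; simp; omega
  have hab : ∀ b, b ≠ a → ∑ p ∈ Finset.range (r a + 1), ∑ q ∈ Finset.range (r b + 1),
        R (G a ^ (p + 1) * G b ^ (q + 1)) • ((1 / 2 : ℂ) • cas e h f a b p q) =
      (1 / 2 : ℂ) • ∑ p ∈ Finset.Icc K (r a), ∑ q ∈ Finset.range (r b + 1),
      ((-1) ^ (p - K) * ((p - K + q).choose q : ℂ) / (z a - z b) ^ (p - K + q + 1)) •
        cas e h f a b p q := by
    intro b hb
    rw [← hIcc, Finset.smul_sum]
    refine Finset.sum_congr rfl fun p _ => ?_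
    split_ifs with hp
    · rw [Finset.smul_sum]
      refine Finset.sum_congr rfl fun q _ => ?_
      rw [hR2 b p q hb, if_pos hp, smul_comm]
    · rw [smul_zero]
      refine Finset.sum_eq_zero fun q _ => ?_
      rw [hR2 b p q hb, if_neg hp, zero_smul]
  have hba : ∀ b, b ≠ a → ∑ p ∈ Finset.range (r b + 1), ∑ q ∈ Finset.range (r a + 1),
        R (G b ^ (p + 1) * G a ^ (q + 1)) • ((1 / 2 : ℂ) • cas e h f b a p q) =
      (1 / 2 : ℂ) • ∑ p ∈ Finset.Icc K (r a), ∑ q ∈ Finset.range (r b + 1),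
      ((-1) ^ (p - K) * ((p - K + q).choose q : ℂ) / (z a - z b) ^ (p - K + q + 1)) •
        cas e h f a b p q := by
    intro b hb
    rw [← hab b hb, Finset.sum_comm]
    refine Finset.sum_congr rfl fun p _ => Finset.sum_congr rfl fun q _ => ?_
    rw [mul_comm, hsymm b a q p hb]
  rw [h1, map_sum]
  simp only [map_sum (opCoeff R) _ Finset.univ, h3]
  rw [← Finset.add_sum_erase _ _ (Finset.mem_univ a), ← Finset.add_sum_erase _ _ (Finset.mem_univ a),
    gaudin, add_assoc]
  congr 1
  · have hd := Finset.sum_range_diag_flip K fun p q => (1 / 2 : ℂ) • cas e h f a a p q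
    have : ∀ p ∈ Finset.range (r a + 1), ∑ q ∈ Finset.range (r a + 1),
        R (G a ^ (p + 1) * G a ^ (q + 1)) • ((1 / 2 : ℂ) • cas e h f a a p q) =
        if p < K then (1 / 2 : ℂ) • cas e h f a a p (K - 1 - p) else 0 := by
      intro p hp
      simp only [hR1, ite_smul, one_smul, zero_smul]
      split_ifs with hpK
      · rw [Finset.sum_eq_single (K - 1 - p)]
        · rw [if_pos (by omega)]
        · intro q _ hq
          rw [if_neg (by omega)]
        · intro hq
          rw [Finset.mem_range] at hq
          omega
      · refine Finset.sum_eq_zero fun q _ => ?_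
        rw [if_neg (by omega)]
    rw [Finset.sum_congr rfl this, ← Finset.sum_filter]
    refine Finset.sum_congr ?_ fun _ _ => rfl
    ext p; simp; omega
  · rw [← Finset.sum_add_distrib]
    refine Finset.sum_congr rfl fun b hb => ?_
    have hb' := Finset.ne_of_mem_erase hb
    rw [Finset.sum_eq_single a, hab b hb', hba b hb', ← add_smul]
    · norm_num
    · intro c _ hc
      refine Finset.sum_eq_zero fun p _ => Finset.sum_eq_zero fun q _ => ?_
      rw [hR3 b c p q hb' hc, zero_smul]
    · simp

end Residue

end Gaudin

/-! ### Commutators of the Gaudin Hamiltonians and of the Cartan currents with creation operators -/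

section GaudinCommutator

variable {n : ℕ} {r : Fin n → ℕ} {E : Type*} [Ring E] [Algebra ℂ E]

/-- The commutator of a Gaudin Hamiltonian with a creation operator. -/
lemma gaudin_commutator {L : Type*} [CommRing L] [Algebra ℂ L] (R : L →ₗ[ℂ] ℂ)
    {z : Fin n → ℂ} {t : ℂ} {a : Fin n} {K : ℕ} {G : Fin n → L} {g : L} (hK : K ≤ r a + 1)
    (hg : ∀ b, g * (G b - algebraMap ℂ L (invDist z t b)) =
      -(G b * algebraMap ℂ L (invDist z t b)))
    (hR1 : ∀ p q, R (G a ^ (p + 1) * G a ^ (q + 1)) = if p + q + 1 = K then 1 else 0)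
    (hR2 : ∀ b p q, b ≠ a → R (G a ^ (p + 1) * G b ^ (q + 1)) =
      if K ≤ p then (-1) ^ (p - K) * ((p - K + q).choose q : ℂ) / (z a - z b) ^ (p - K + q + 1)
      else 0)
    (hR3 : ∀ b c p q, b ≠ a → c ≠ a → R (G b ^ (p + 1) * G c ^ (q + 1)) = 0)
    (hR4 : ∀ q, R (g * G a ^ (q + 1)) = if K ≤ q then -(invDist z t a ^ (q - K + 1)) else 0)
    (hR5 : ∀ b q, b ≠ a → R (g * G b ^ (q + 1)) = 0)
    {e h f : Fin n → ℕ → E}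
    (hef : ∀ b p q, e b p * f b q - f b q * e b p = h b (p + q))
    (hhf : ∀ b p q, h b p * f b q - f b q * h b p = (-2 : ℂ) • f b (p + q))
    (hef' : ∀ b c p q, b ≠ c → e b p * f c q = f c q * e b p)
    (hhf' : ∀ b c p q, b ≠ c → h b p * f c q = f c q * h b p)
    (hff : ∀ b c p q, f b p * f c q = f c q * f b p)
    (hhh : ∀ b c p q, h b p * h c q = h c q * h b p)
    (hh0 : ∀ b q, r b < q → h b q = 0) (hf0 : ∀ b q, r b < q → f b q = 0) :
    gaudin r e h f z a K * current r f (invDist z t) -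
        current r f (invDist z t) * gaudin r e h f z a K =
      current r f (invDist z t) * current r (shifted a K h) (invDist z t) -
        current r (shifted a K f) (invDist z t) * current r h (invDist z t) := by
  have hcas := opCoeff_casimir R (e := e) (h := h) (f := f) (z := z) hK (fun b c p q hbc => by
    rw [cas, cas, hhh b c, hef' b c p q hbc, ← hef' c b q p hbc.symm]
    abel) hR1 hR2 hR3
  -- The capital currents are those at the spectral parameter, with coefficients `G`; the small ones
  -- sit at `t` and have constant coefficients.
  have key := casimir_commutator (A := L ⊗[ℂ] E) (g := g) (q := algebraMap ℂ L (1 / 4))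
    (E := current r (fun b q => opConst (e b q)) G) (H := current r (fun b q => opConst (h b q)) G)
    (F := current r (fun b q => opConst (f b q)) G)
    (f := current r (fun b q => opConst (f b q)) (fun b => algebraMap ℂ L (invDist z t b)))
    (h := current r (fun b q => opConst (h b q)) (fun b => algebraMap ℂ L (invDist z t b)))
    (by rw [← map_ofNat (algebraMap ℂ L), ← map_mul, ← map_one (algebraMap ℂ L)]; norm_num)
    (current_commutator (c := fun b q => opConst (h b q))
      (fun b p q => by rw [← map_mul, ← map_mul, ← map_sub, hef])
      (fun b b' hb p q => by rw [← map_mul, ← map_mul, hef' b b' p q hb])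
      (fun b s hs => by rw [hh0 b s hs, map_zero]) hg)
    (by
      rw [current_commutator (c := fun b q => (-2 : L) • opConst (f b q))
        (fun b p q => by
          rw [← map_mul, ← map_mul, ← map_sub, hhf, ← algebraMap_smul_opConst, map_neg, map_ofNat])
        (fun b b' hb p q => by rw [← map_mul, ← map_mul, hhf' b b' p q hb])
        (fun b s hs => by rw [hf0 b s hs, map_zero, smul_zero]) hg, current_smul, current_smul]
      module)
    (by
      -- The two points have exchanged their roles, which changes the sign of `g`.
      rw [current_commutator (g := -g) (c := fun b q => (-2 : L) • opConst (f b q))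
        (fun b p q => by
          rw [← map_mul, ← map_mul, ← map_sub, hhf, ← algebraMap_smul_opConst, map_neg, map_ofNat])
        (fun b b' hb p q => by rw [← map_mul, ← map_mul, hhf' b b' p q hb])
        (fun b s hs => by rw [hf0 b s hs, map_zero, smul_zero])
        (fun b => by linear_combination hg b), current_smul, current_smul]
      module)
    (current_commute fun b b' p q => by rw [← map_mul, ← map_mul, hff])
  -- After extraction the currents at `t` factor out, and the products of `g` with the currents at
  -- the spectral parameter become minus the currents at `t` with shifted modes.
  have h1 := congrArg (opCoeff R) key
  rw [current_opConst, current_opConst, map_sub, opCoeff_mul_opConst, opCoeff_opConst_mul, hcas,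
    smul_sub, map_sub, ← smul_mul_assoc, ← mul_smul_comm, opCoeff_mul_opConst,
    opCoeff_opConst_mul, opCoeff_smul_current R hR4 hR5 f (hf0 a),
    opCoeff_smul_current R hR4 hR5 h (hh0 a)] at h1
  rw [h1]
  simp only [neg_mul, mul_neg, sub_neg_eq_add]
  abel

/-- `gaudin_commutator`, in terms of a ring homomorphism and a function. -/
lemma gaudin_commutator_of_ringHom {L : Type*} [CommRing L] (C : ℂ →+* L) (R : L → ℂ)
    (hadd : ∀ x y, R (x + y) = R x + R y) (hsmul : ∀ c x, R (C c * x) = c * R x)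
    {z : Fin n → ℂ} {t : ℂ} {a : Fin n} {K : ℕ} {G : Fin n → L} {g : L} (hK : K ≤ r a + 1)
    (hg : ∀ b, g * (G b - C (invDist z t b)) = -(G b * C (invDist z t b)))
    (hR1 : ∀ p q, R (G a ^ (p + 1) * G a ^ (q + 1)) = if p + q + 1 = K then 1 else 0)
    (hR2 : ∀ b p q, b ≠ a → R (G a ^ (p + 1) * G b ^ (q + 1)) =
      if K ≤ p then (-1) ^ (p - K) * ((p - K + q).choose q : ℂ) / (z a - z b) ^ (p - K + q + 1)
      else 0)
    (hR3 : ∀ b c p q, b ≠ a → c ≠ a → R (G b ^ (p + 1) * G c ^ (q + 1)) = 0)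
    (hR4 : ∀ q, R (g * G a ^ (q + 1)) = if K ≤ q then -(invDist z t a ^ (q - K + 1)) else 0)
    (hR5 : ∀ b q, b ≠ a → R (g * G b ^ (q + 1)) = 0)
    {e h f : Fin n → ℕ → E}
    (hef : ∀ b p q, e b p * f b q - f b q * e b p = h b (p + q))
    (hhf : ∀ b p q, h b p * f b q - f b q * h b p = (-2 : ℂ) • f b (p + q))
    (hef' : ∀ b c p q, b ≠ c → e b p * f c q = f c q * e b p)
    (hhf' : ∀ b c p q, b ≠ c → h b p * f c q = f c q * h b p)
    (hff : ∀ b c p q, f b p * f c q = f c q * f b p)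
    (hhh : ∀ b c p q, h b p * h c q = h c q * h b p)
    (hh0 : ∀ b q, r b < q → h b q = 0) (hf0 : ∀ b q, r b < q → f b q = 0) :
    gaudin r e h f z a K * current r f (invDist z t) -
        current r f (invDist z t) * gaudin r e h f z a K =
      current r f (invDist z t) * current r (shifted a K h) (invDist z t) -
        current r (shifted a K f) (invDist z t) * current r h (invDist z t) := by
  -- With the scalar action taken from `C`, the linearity of `R` is literally `hadd` and `hsmul`.
  let _ : Algebra ℂ L := C.toAlgebra
  exact gaudin_commutator (L := L)
    { toFun := R, map_add' := hadd, map_smul' := fun c x => by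
        rw [Algebra.smul_def]; exact hsmul c x }
    hK hg hR1 hR2 hR3 hR4 hR5 hef hhf hef' hhf' hff hhh hh0 hf0

lemma invDist_mul_sub {z : Fin n → ℂ} {t s : ℂ} (hts : t ≠ s) (ht : ∀ b, t ≠ z b)
    (hs : ∀ b, s ≠ z b) (b : Fin n) :
    (t - s)⁻¹ * (invDist z t b - invDist z s b) = -(invDist z t b * invDist z s b) := by
  have h1 := sub_ne_zero.mpr hts
  have h2 := sub_ne_zero.mpr (ht b)
  have h3 := sub_ne_zero.mpr (hs b)
  rw [invDist, invDist]
  field_simp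
  ring

lemma current_h_mul {h f : Fin n → ℕ → E} {z : Fin n → ℂ} {t s : ℂ} (hts : t ≠ s)
    (ht : ∀ b, t ≠ z b) (hs : ∀ b, s ≠ z b)
    (hhf : ∀ b p q, h b p * f b q - f b q * h b p = (-2 : ℂ) • f b (p + q))
    (hhf' : ∀ b c p q, b ≠ c → h b p * f c q = f c q * h b p)
    (hf0 : ∀ b q, r b < q → f b q = 0) :
    current r h (invDist z t) * current r f (invDist z s) =
      current r f (invDist z s) * current r h (invDist z t) + (2 * (t - s)⁻¹) •
        (current r f (invDist z t) - current r f (invDist z s)) := by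
  have := current_commutator (r := r) (c := fun b q => (-2 : ℂ) • f b q) hhf
    (fun b b' hb p q => hhf' b b' p q hb) (fun b q hq => by rw [hf0 b q hq, smul_zero])
    (invDist_mul_sub hts ht hs)
  rw [sub_eq_iff_eq_add'.mp this, current_smul, current_smul]
  module

/-- Shifting the modes of `h` by `K` shifts those of its brackets with `f` in the same way, so the
two-point commutator applies with the shifted `f` on the right-hand side. -/
lemma current_shifted_h_mul {h f : Fin n → ℕ → E} {z : Fin n → ℂ} {t s : ℂ} (a : Fin n) (K : ℕ)
    (hts : t ≠ s) (ht : ∀ b, t ≠ z b) (hs : ∀ b, s ≠ z b)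
    (hhf : ∀ b p q, h b p * f b q - f b q * h b p = (-2 : ℂ) • f b (p + q))
    (hhf' : ∀ b c p q, b ≠ c → h b p * f c q = f c q * h b p)
    (hf0 : ∀ b q, r b < q → f b q = 0) :
    current r (shifted a K h) (invDist z t) * current r f (invDist z s) =
      current r f (invDist z s) * current r (shifted a K h) (invDist z t) + (2 * (t - s)⁻¹) •
        (current r (shifted a K f) (invDist z t) - current r (shifted a K f) (invDist z s)) := by
  have := current_commutator (r := r) (x := shifted a K h) (y := f)
    (c := fun b q => (-2 : ℂ) • shifted a K f b q)
    (fun b p q => by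
      by_cases hb : b = a
      · subst hb; simp only [shifted, if_true]; rw [hhf, add_assoc]
      · simp [shifted, hb])
    (fun b b' hb p q => by
      by_cases hba : b = a
      · subst hba; simp only [shifted, if_true]; rw [hhf' _ _ _ _ hb]
      · simp [shifted, hba])
    (fun b q hq => by
      by_cases hba : b = a
      · subst hba; simp only [shifted, if_true]; rw [hf0 _ _ (by omega), smul_zero]
      · simp [shifted, hba])
    (invDist_mul_sub hts ht hs)
  rw [sub_eq_iff_eq_add'.mp this, current_smul, current_smul]
  module

end GaudinCommutator

/-! ### The Hamiltonians on the tensor product of Verma modules and their off-shell Bethe equation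
-/

section Hamiltonian

attribute [local instance] tensorVermaAddCommGroup

variable {n : ℕ} {r : Fin n → ℕ}

lemma siteOp_hf (lam : Weights r) (b : Fin n) (p q : ℕ) :
    siteOp lam b h p * siteOp lam b f q - siteOp lam b f q * siteOp lam b h p =
      (-2 : ℂ) • siteOp lam b f (p + q) := by
  rw [siteOp_mul_sub, lie_h_f, ← siteOp_smul]

lemma siteOp_ef (lam : Weights r) (b : Fin n) (p q : ℕ) :
    siteOp lam b e p * siteOp lam b f q - siteOp lam b f q * siteOp lam b e p =
      siteOp lam b h (p + q) := by
  rw [siteOp_mul_sub, lie_e_f]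

lemma hamiltonian_eq_gaudin (x : Params r) (a : Fin n) (K : ℕ) : hamiltonian x a K =
    gaudin r (fun b q => siteOp x.2 b e q) (fun b q => siteOp x.2 b h q)
      (fun b q => siteOp x.2 b f q) x.1 a K := by
  rfl

/-- The commutator of a Gaudin Hamiltonian with a creation operator. -/
lemma hamiltonian_commutator (x : Params r) (hz : Function.Injective x.1) {t : ℂ}
    (ht : ∀ b, t ≠ x.1 b) (a : Fin n) {K : ℕ} (hK : K ≤ r a) :
    hamiltonian x a K * current r (fun b q => siteOp x.2 b f q) (invDist x.1 t) =
      current r (fun b q => siteOp x.2 b f q) (invDist x.1 t) * hamiltonian x a K +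
      (current r (fun b q => siteOp x.2 b f q) (invDist x.1 t) *
          current r (shifted a K fun b q => siteOp x.2 b h q) (invDist x.1 t) -
        current r (shifted a K fun b q => siteOp x.2 b f q) (invDist x.1 t) *
          current r (fun b q => siteOp x.2 b h q) (invDist x.1 t)) := by
  refine sub_eq_iff_eq_add'.mp ?_
  rw [hamiltonian_eq_gaudin]
  have hd : x.1 a - t ≠ 0 := sub_ne_zero.mpr (ht a).symm
  have hser : ∀ d : ℂ, d ≠ 0 → pole d = ((geomSeries d 0 : PowerSeries ℂ) : LaurentSeries ℂ) := by
    intro d hd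
    rw [← pole_pow hd, zero_add, pow_one]
  -- In the local coordinate `ζ` at `z_a`, the functions `G b` and `g` are the Laurent expansions of
  -- `1 / (ζ + z_a - z_b)` and `1 / (ζ + z_a - t)`.
  refine gaudin_commutator_of_ringHom (HahnSeries.C : ℂ →+* LaurentSeries ℂ)
    (fun y => polarCoeff K y) (fun y y' => map_add _ y y')
    (fun c y => by rw [HahnSeries.C_mul_eq_smul]; exact map_smul _ c y) (z := x.1) (t := t) (a := a)
    (e := fun b q => siteOp x.2 b e q) (h := fun b q => siteOp x.2 b h q)
    (f := fun b q => siteOp x.2 b f q) (G := fun b => pole (x.1 a - x.1 b)) (g := pole (x.1 a - t)) (by omega) (fun b => ?_)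
    (fun p q => ?_) (fun b p q hb => ?_) (fun b c p q hb hc => ?_) (fun q => ?_) (fun b q hb => ?_)
    (siteOp_ef x.2) (siteOp_hf x.2) (fun b c p q hb => siteOp_comm_of_ne x.2 hb e f p q)
    (fun b c p q hb => siteOp_comm_of_ne x.2 hb h f p q) (fun b c p q => siteOp_comm x.2 b c f p q)
    (fun b c p q => siteOp_comm x.2 b c h p q) (fun b q hq => siteOp_eq_zero x.2 b h hq)
    (fun b q hq => siteOp_eq_zero x.2 b f hq)
  · have h1 := pole_mul_sub (x.1 a - t) (x.1 a - x.1 b)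
    have h2 : (HahnSeries.C (invDist x.1 t b) : LaurentSeries ℂ) *
        HahnSeries.C (x.1 a - x.1 b - (x.1 a - t)) = 1 := by
      rw [← map_mul, invDist, show x.1 a - x.1 b - (x.1 a - t) = t - x.1 b by ring,
        inv_mul_cancel₀ (sub_ne_zero.mpr (ht b)), map_one]
    change pole (x.1 a - t) * (pole (x.1 a - x.1 b) - HahnSeries.C (invDist x.1 t b)) =
      -(pole (x.1 a - x.1 b) * HahnSeries.C (invDist x.1 t b))
    linear_combination (HahnSeries.C (invDist x.1 t b) : LaurentSeries ℂ) * h1 -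
      (pole (x.1 a - t) * pole (x.1 a - x.1 b)) * h2
  · change polarCoeff K (pole (x.1 a - x.1 a) ^ (p + 1) * pole (x.1 a - x.1 a) ^ (q + 1)) = _
    rw [sub_self, ← pow_add, show p + 1 + (q + 1) = (p + q + 1) + 1 by ring,
      polarCoeff_pole_zero_pow]
  · change polarCoeff K (pole (x.1 a - x.1 a) ^ (p + 1) * pole (x.1 a - x.1 b) ^ (q + 1)) = _
    rw [sub_self, polarCoeff_pole_zero_pow_mul _ _ (sub_ne_zero.mpr (hz.ne hb.symm))]
  · change polarCoeff K (pole (x.1 a - x.1 b) ^ (p + 1) * pole (x.1 a - x.1 c) ^ (q + 1)) = _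
    rw [pole_pow (sub_ne_zero.mpr (hz.ne hb.symm)),
      polarCoeff_mul_pole_pow K _ (sub_ne_zero.mpr (hz.ne hc.symm))]
  · change polarCoeff K (pole (x.1 a - t) * pole (x.1 a - x.1 a) ^ (q + 1)) = _
    have h1 := polarCoeff_pole_zero_pow_mul K q hd 0
    rw [zero_add, pow_one] at h1
    rw [sub_self, mul_comm, h1]
    split_ifs with hKq
    · rw [invDist, inv_pow, add_zero, Nat.choose_zero_right, Nat.cast_one, mul_one,
        ← neg_sub t (x.1 a), neg_pow (t - x.1 a), pow_succ (-1 : ℂ)]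
      have : (-1 : ℂ) ^ (q - K) ≠ 0 := pow_ne_zero _ (by norm_num)
      have : t - x.1 a ≠ 0 := sub_ne_zero.mpr (ht a)
      field_simp
    · rfl
  · change polarCoeff K (pole (x.1 a - t) * pole (x.1 a - x.1 b) ^ (q + 1)) = _
    rw [hser _ hd, polarCoeff_mul_pole_pow K _ (sub_ne_zero.mpr (hz.ne hb.symm))]

/-- The variable `f^{(b)}[q]`, extended by zero. -/
def fVar (r : Fin n → ℕ) (b : Fin n) (q : ℕ) : FPoly r :=
  if hq : q < r b + 1 then MvPolynomial.X ⟨b, ⟨q, hq⟩⟩ else 0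

lemma siteOp_f_toVermaL_nat (lam : Weights r) (b : Fin n) (q : ℕ) (u : FPoly r) :
    siteOp lam b f q (toVermaL lam u) = toVermaL lam (fVar r b q * u) := by
  rw [fVar]
  split_ifs with hq
  · exact siteOp_f_toVermaL lam b ⟨q, hq⟩ u
  · rw [siteOp_eq_zero lam b f (by omega), zero_mul, map_zero, LinearMap.zero_apply]

lemma current_apply_toVermaL (lam : Weights r) {X : Fin n → ℕ → Module.End ℂ (TensorVerma lam)}
    {ξ : Fin n → ℕ → FPoly r} (hX : ∀ b q u, X b q (toVermaL lam u) = toVermaL lam (ξ b q * u))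
    (G : Fin n → ℂ) (u : FPoly r) :
    current r X G (toVermaL lam u) = toVermaL lam (current r ξ G * u) := by
  rw [current, current, Finset.sum_mul, map_sum, LinearMap.sum_apply]
  refine Finset.sum_congr rfl fun b _ => ?_
  rw [Finset.sum_mul, map_sum, LinearMap.sum_apply]
  refine Finset.sum_congr rfl fun q _ => ?_
  rw [LinearMap.smul_apply, hX, smul_mul_assoc, map_smul]

lemma current_apply_vac (lam : Weights r) {X : Fin n → ℕ → Module.End ℂ (TensorVerma lam)}
    {ξ : Fin n → ℕ → ℂ} (hX : ∀ b q, X b q (vac lam) = ξ b q • vac lam) (G : Fin n → ℂ) :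
    current r X G (vac lam) = current r ξ G • vac lam := by
  rw [current, current, LinearMap.sum_apply, Finset.sum_smul]
  refine Finset.sum_congr rfl fun b _ => ?_
  rw [LinearMap.sum_apply, Finset.sum_smul]
  refine Finset.sum_congr rfl fun q _ => ?_
  rw [LinearMap.smul_apply, hX, smul_smul, smul_eq_mul]

/-- The linear term comes from `e[p] f[q] = f[q] e[p] + h[p + q]`. It is absent for two different
sites, where these operators commute. -/
lemma casimir_self_vac (lam : Weights r) (a : Fin n) (p q : ℕ) :
    casimir lam a a p q (vac lam) =
      (ext0 (lam a) p * ext0 (lam a) q / 2 + ext0 (lam a) (p + q)) • vac lam := by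
  rw [casimir, LinearMap.add_apply, LinearMap.add_apply, LinearMap.smul_apply,
    sub_eq_iff_eq_add.mp (siteOp_ef lam a p q), LinearMap.add_apply, Module.End.mul_apply,
    Module.End.mul_apply, Module.End.mul_apply, siteOp_e_vac, siteOp_e_vac, map_zero, map_zero,
    siteOp_h_vac, siteOp_h_vac, map_smul, siteOp_h_vac]
  module

lemma casimir_vac (lam : Weights r) {a b : Fin n} (hab : a ≠ b) (p q : ℕ) :
    casimir lam a b p q (vac lam) = (ext0 (lam a) p * ext0 (lam b) q / 2) • vac lam := by
  rw [casimir, LinearMap.add_apply, LinearMap.add_apply, LinearMap.smul_apply,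
    siteOp_comm_of_ne lam hab e f, Module.End.mul_apply,
    Module.End.mul_apply, Module.End.mul_apply, siteOp_e_vac, siteOp_e_vac, map_zero, map_zero,
    siteOp_h_vac, map_smul, siteOp_h_vac]
  module

/-- The part of the vacuum eigenvalue of the Hamiltonian which comes from the other points. -/
def crossTerm (x : Params r) (a : Fin n) (K : ℕ) : ℂ :=
  ∑ b ∈ Finset.univ.erase a, ∑ p ∈ Finset.Icc K (r a), ∑ q ∈ Finset.range (r b + 1),
    ((-1) ^ (p - K) * ((p - K + q).choose q : ℂ) / (x.1 a - x.1 b) ^ (p - K + q + 1)) *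
      (ext0 (x.2 a) p * ext0 (x.2 b) q / 2)

lemma hamiltonian_vac (x : Params r) (a : Fin n) (K : ℕ) :
    hamiltonian x a K (vac x.2) = (selfTerm (x.2 a) K + crossTerm x a K) • vac x.2 := by
  rw [hamiltonian, LinearMap.add_apply, add_smul, crossTerm, selfTerm]
  congr 1
  · rw [LinearMap.sum_apply]
    have : ∀ p ∈ Finset.range K, ((1 / 2 : ℂ) • casimir x.2 a a p (K - 1 - p)) (vac x.2) =
        (ext0 (x.2 a) p * ext0 (x.2 a) (K - 1 - p) / 4 + ext0 (x.2 a) (K - 1) / 2) • vac x.2 := by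
      intro p hp
      rw [Finset.mem_range] at hp
      rw [LinearMap.smul_apply, casimir_self_vac, show p + (K - 1 - p) = K - 1 by omega]
      module
    rw [Finset.sum_congr rfl this, ← Finset.sum_smul, Finset.sum_add_distrib, Finset.sum_const,
      Finset.card_range, Finset.sum_div, nsmul_eq_mul, mul_div_assoc]
  · rw [LinearMap.sum_apply, Finset.sum_smul]
    refine Finset.sum_congr rfl fun b hb => ?_
    rw [LinearMap.sum_apply, Finset.sum_smul]
    refine Finset.sum_congr rfl fun p _ => ?_
    rw [LinearMap.sum_apply, Finset.sum_smul]
    refine Finset.sum_congr rfl fun q _ => ?_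
    rw [LinearMap.smul_apply, casimir_vac x.2 (Finset.ne_of_mem_erase hb).symm, smul_smul]

/-- The off-shell Bethe ansatz equation for the confluent Gaudin model. -/
theorem hamiltonian_toVermaL {m : ℕ} (x : Params r) (t : Fin m → ℂ)
    (hw : Function.Injective (Sum.elim t x.1)) (a : Fin n) {K : ℕ} (hK : K ≤ r a) :
    hamiltonian x a K (toVermaL x.2 (∏ j, current r (fVar r) (invDist x.1 (t j)))) =
      toVermaL x.2 ((selfTerm (x.2 a) K + crossTerm x a K +
          ∑ j, current r (shifted a K fun b q => ext0 (x.2 b) q) (invDist x.1 (t j))) •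
          ∏ j, current r (fVar r) (invDist x.1 (t j)) -
        ∑ j, (current r (fun b q => ext0 (x.2 b) q) (invDist x.1 (t j)) -
            ∑ i ∈ Finset.univ.erase j, 2 * (t j - t i)⁻¹) •
          (current r (shifted a K (fVar r)) (invDist x.1 (t j)) *
            ∏ i ∈ Finset.univ.erase j, current r (fVar r) (invDist x.1 (t i)))) := by
  have hz : Function.Injective x.1 := fun b c hbc =>
    Sum.inr_injective (hw (a₁ := Sum.inr b) (a₂ := Sum.inr c) hbc)
  have hts : ∀ i j, i ≠ j → t i ≠ t j := fun i j hij h1 =>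
    hij (Sum.inl_injective (hw (a₁ := Sum.inl i) (a₂ := Sum.inl j) h1))
  have htz : ∀ i b, t i ≠ x.1 b := fun i b h1 =>
    Sum.inl_ne_inr (hw (a₁ := Sum.inl i) (a₂ := Sum.inr b) h1)
  refine apply_prod_offShell (toVermaL x.2) (fun j => current r (fVar r) (invDist x.1 (t j)))
    (fun j => current r (shifted a K (fVar r)) (invDist x.1 (t j)))
    (fun j => current r (fun b q => siteOp x.2 b f q) (invDist x.1 (t j)))
    (fun j => current r (shifted a K fun b q => siteOp x.2 b f q) (invDist x.1 (t j)))
    (fun j => current r (fun b q => siteOp x.2 b h q) (invDist x.1 (t j)))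
    (fun j => current r (shifted a K fun b q => siteOp x.2 b h q) (invDist x.1 (t j)))
    (hamiltonian x a K)
    (fun j P => current_apply_toVermaL x.2 (siteOp_f_toVermaL_nat x.2) _ P)
    (fun j P => current_apply_toVermaL x.2 (fun b q u => ?_) _ P)
    (fun i j => (t i - t j)⁻¹) (fun i j => by rw [← neg_sub, inv_neg]) _ _ _
    (fun j => hamiltonian_commutator x hz (htz j) a hK)
    (fun i j hij => current_h_mul (hts i j hij) (htz i) (htz j) (siteOp_hf x.2)
      (fun b c p q hb => siteOp_comm_of_ne x.2 hb h f p q)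
      (fun b q hq => siteOp_eq_zero x.2 b f hq))
    (fun i j hij => current_shifted_h_mul a K (hts i j hij) (htz i) (htz j) (siteOp_hf x.2)
      (fun b c p q hb => siteOp_comm_of_ne x.2 hb h f p q)
      (fun b q hq => siteOp_eq_zero x.2 b f hq))
    (by rw [toVermaL_one]; exact hamiltonian_vac x a K)
    (fun j => by
      rw [toVermaL_one]
      exact current_apply_vac x.2 (siteOp_h_vac x.2) _)
    (fun j => by
      rw [toVermaL_one]
      refine current_apply_vac x.2 (fun b q => ?_) _
      by_cases hb : b = a
      · subst hb; simp only [shifted, if_true]; exact siteOp_h_vac x.2 _ _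
      · simp [shifted, hb]) Finset.univ
  by_cases hb : b = a
  · subst hb; simp only [shifted, if_true]; exact siteOp_f_toVermaL_nat x.2 _ _ _
  · simp [shifted, hb]

end Hamiltonian

/-! ### The propagator and the master function -/

section Propagator

/-- The induction needs the identity on a whole open set, since the next derivative depends on the
germ. -/
lemma iteratedDeriv_eq_of_hasDerivAt {U : Set ℂ} (hU : IsOpen U) {φ : ℂ → ℂ} {f : ℕ → ℂ → ℂ}
    (h0 : ∀ x ∈ U, φ x = f 0 x) (hf : ∀ k, ∀ x ∈ U, HasDerivAt (f k) (f (k + 1) x) x) (k : ℕ) :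
    ∀ x ∈ U, iteratedDeriv k φ x = f k x := by
  induction k with
  | zero => simpa using h0
  | succ k ih =>
    intro x hx
    rw [iteratedDeriv_succ]
    have h1 : iteratedDeriv k φ =ᶠ[𝓝 x] f k := by
      filter_upwards [hU.mem_nhds hx] with y hy using ih y hy
    rw [h1.deriv_eq]
    exact (hf k x hx).deriv

/-- The derivatives of `log`, where `l` is the value of the logarithm. -/
def logDer (x₀ l : ℂ) (k : ℕ) (x : ℂ) : ℂ :=
  if k = 0 then logNear x₀ l x else (-1) ^ (k + 1) * ((k - 1).factorial : ℂ) / x ^ k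

lemma hasDerivAt_logDer {x₀ l x : ℂ} (hx : x / x₀ ∈ Complex.slitPlane) (k : ℕ) :
    HasDerivAt (logDer x₀ l k) (logDer x₀ l (k + 1) x) x := by
  have hx0 : x ≠ 0 := by
    rintro rfl
    simp at hx
  have hx1 : x₀ ≠ 0 := by
    rintro rfl
    simp at hx
  rcases k with _ | k
  · have h1 := ((hasDerivAt_id x).div_const x₀).clog hx
    have h2 := h1.const_add l
    have e : (fun y => l + Complex.log (id y / x₀)) = logDer x₀ l 0 := by
      funext y; simp [logDer, logNear]
    rw [e] at h2
    refine h2.congr_deriv ?_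
    simp [logDer]
    field_simp
  · have h1 := (hasDerivAt_pow (k + 1) x).inv (pow_ne_zero _ hx0)
    have h2 := h1.const_mul ((-1) ^ (k + 1 + 1) * (k.factorial : ℂ))
    have e : (fun y => (-1) ^ (k + 1 + 1) * (k.factorial : ℂ) * ((fun x => x ^ (k + 1))⁻¹ : ℂ → ℂ) y) =
        logDer x₀ l (k + 1) := by
      funext y; simp [logDer, div_eq_mul_inv]
    rw [e] at h2
    refine h2.congr_deriv ?_
    simp [logDer, Nat.factorial_succ]
    field_simp
    ring

/-- The value of the propagator. -/
def propValue (l x : ℂ) (p q : ℕ) : ℂ :=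
  if p + q = 0 then l
  else (-1) ^ (p + 1) * ((p + q).choose p : ℂ) / (p + q : ℕ) / x ^ (p + q)

lemma choose_div_add (p q : ℕ) (hpq : p + q ≠ 0) :
    ((p + q).choose p : ℂ) / (p + q : ℕ) =
      ((p.factorial : ℂ) * q.factorial)⁻¹ * ((p + q - 1).factorial : ℂ) := by
  have h1 : ((p + q).choose p : ℂ) * (p.factorial * q.factorial) = (p + q).factorial := by
    have := Nat.choose_mul_factorial_mul_factorial (Nat.le_add_right p q)
    rw [Nat.add_sub_cancel_left] at this
    rw [← mul_assoc]
    exact_mod_cast this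
  have h2 : ((p + q).factorial : ℂ) = (p + q : ℕ) * ((p + q - 1).factorial : ℂ) := by
    rw [← Nat.cast_mul, Nat.mul_factorial_pred hpq]
  have h3 : ((p + q : ℕ) : ℂ) ≠ 0 := Nat.cast_ne_zero.mpr hpq
  have h4 : (p.factorial : ℂ) ≠ 0 := Nat.cast_ne_zero.mpr p.factorial_ne_zero
  have h5 : (q.factorial : ℂ) ≠ 0 := Nat.cast_ne_zero.mpr q.factorial_ne_zero
  rw [h2] at h1
  field_simp
  linear_combination h1

/-- The logarithm depends on `z - w` only, and each derivative in `w` brings a sign; the signs `(-1)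
^ q` and `(-1) ^ (p + q + 1)` combine to `(-1) ^ (p + 1)`. The condition with `slitPlane` describes
the neighbourhood on which the chosen branch is holomorphic. -/
lemma propagator_eq {z₀ w₀ : ℂ} (h : z₀ ≠ w₀) (l : ℂ) (p q : ℕ) :
    propagator z₀ w₀ l p q = propValue l (z₀ - w₀) p q := by
  have hx₀ : z₀ - w₀ ≠ 0 := sub_ne_zero.mpr h
  set x₀ := z₀ - w₀ with hx₀_def
  have hopen : ∀ φ : ℂ → ℂ, Continuous φ → IsOpen {w | φ w / x₀ ∈ Complex.slitPlane} :=
    fun φ hφ => Complex.isOpen_slitPlane.preimage (hφ.div_const _)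
  have h1 : ∀ z, (z - w₀) / x₀ ∈ Complex.slitPlane →
      iteratedDeriv q (fun w => logNear x₀ l (z - w)) w₀ = (-1) ^ q * logDer x₀ l q (z - w₀) := by
    intro z hz
    refine iteratedDeriv_eq_of_hasDerivAt (U := {w | (z - w) / x₀ ∈ Complex.slitPlane})
      (f := fun k w => (-1) ^ k * logDer x₀ l k (z - w)) (hopen _ (by fun_prop)) ?_ ?_ q w₀ hz
    · intro w _
      simp [logDer]
    · intro k w hw
      have h2 := HasDerivAt.comp w (hasDerivAt_logDer (l := l) hw k) ((hasDerivAt_id w).const_sub z)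
      exact (h2.const_mul ((-1) ^ k)).congr_deriv (by ring)
  have h2 := iteratedDeriv_eq_of_hasDerivAt (U := {z | (z - w₀) / x₀ ∈ Complex.slitPlane})
      (φ := fun z => iteratedDeriv q (fun w => logNear x₀ l (z - w)) w₀)
      (f := fun k z => (-1) ^ q * logDer x₀ l (q + k) (z - w₀)) (hopen _ (by fun_prop)) h1 (by
        intro k z hz
        have h2 := HasDerivAt.comp z (hasDerivAt_logDer (l := l) hz (q + k))
          ((hasDerivAt_id z).sub_const w₀)
        exact (h2.const_mul ((-1) ^ q)).congr_deriv (by rw [mul_one, add_assoc])) p z₀ (by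
        rw [Set.mem_ofPred_eq]
        rw [← hx₀_def, div_self hx₀]
        exact Complex.one_mem_slitPlane)
  rw [propagator, ← hx₀_def, h2, propValue, ← hx₀_def]
  by_cases hpq : p + q = 0
  · obtain ⟨rfl, rfl⟩ : p = 0 ∧ q = 0 := by omega
    simp [logDer, logNear, hx₀]
  · rw [if_neg hpq, mul_div_assoc, choose_div_add p q hpq, logDer, if_neg (by omega), add_comm q p]
    have : ((-1 : ℂ) ^ q) * (-1) ^ (p + q + 1) = (-1) ^ (p + 1) := by
      rw [← pow_add, show q + (p + q + 1) = 2 * q + (p + 1) by ring, pow_add, pow_mul]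
      simp
    rw [← this]
    ring

end Propagator

/-! ### Comparison of the free boson correlation function with the master function -/

section Master

variable {m n : ℕ} {r : Fin n → ℕ}

open Classical in
/-- The exponent of `psi`, in closed form. -/
def psiExponent (κ : ℂ) (lam : Weights r) (w : Pts m n)
    (l : Fin m ⊕ Fin n → Fin m ⊕ Fin n → ℂ) : ℂ :=
  ∑ j : Fin m ⊕ Fin n, ∑ k : Fin m ⊕ Fin n, if toLex j < toLex k then
    ∑ p ∈ Finset.range (order r j + 1), ∑ q ∈ Finset.range (order r k + 1),
      form (charge lam j p) (charge lam k q) / κ * propValue (l j k) (w j - w k) p q else 0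

lemma psi_eq_exp (κ : ℂ) (lam : Weights r) {w : Pts m n} (hw : Function.Injective w)
    (l : Fin m ⊕ Fin n → Fin m ⊕ Fin n → ℂ) :
    psi κ lam w l = Complex.exp (psiExponent κ lam w l) := by
  rw [psi, psiExponent]
  congr 1
  refine Finset.sum_congr rfl fun j _ => Finset.sum_congr rfl fun k _ => ?_
  split_ifs with hjk
  · refine Finset.sum_congr rfl fun p _ => Finset.sum_congr rfl fun q _ => ?_
    rw [propagator_eq (hw.ne fun hjk' => hjk.ne (congrArg toLex hjk'))]
  · rfl

lemma charge_inr (lam : Weights r) (a : Fin n) (p : ℕ) :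
    charge (m := m) lam (Sum.inr a) p = ext0 (lam a) p / 2 := by
  rw [charge, ext0]
  split_ifs
  · rfl
  · rw [zero_div]

lemma sum_Ioi_eq {N : ℕ} (a : Fin N) (φ : Fin N → ℂ) :
    ∑ b ∈ Finset.Ioi a, φ b = ∑ b, if a < b then φ b else 0 := by
  rw [← Finset.sum_filter]
  refine Finset.sum_congr ?_ fun _ _ => rfl
  ext b; simp

/-- The ordered pairs of points are of three kinds: two `z`, two `t`, or a `t` followed by a `z`.
For each pair the term `p = q = 0` of the exponent gives the power of the difference, and the other
terms give the exponential factor, which is trivial for two `t`. -/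
theorem psi_eq_master (κ : ℂ) (lam : Weights r) {w : Pts m n} (hw : Function.Injective w)
    (l : Fin m ⊕ Fin n → Fin m ⊕ Fin n → ℂ) : psi κ lam w l = master κ lam w l := by
  rw [psi_eq_exp κ lam hw, master]
  simp only [← Complex.exp_add, ← Complex.exp_sum]
  congr 1
  rw [psiExponent, Fintype.sum_sum_type]
  simp only [Fintype.sum_sum_type, Sum.Lex.inl_lt_inl_iff, Sum.Lex.inr_lt_inr_iff,
    Sum.Lex.inl_lt_inr, Sum.Lex.not_inr_lt_inl, if_true, if_false, Finset.sum_const_zero, zero_add]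
  rw [Finset.sum_add_distrib, add_comm, add_assoc]
  congr 1
  · refine Finset.sum_congr rfl fun a _ => ?_
    rw [sum_Ioi_eq]
    refine Finset.sum_congr rfl fun b _ => ?_
    split_ifs with hab
    · simp only [order, charge_inr]
      rw [Finset.sum_range]
      simp only [Finset.sum_range (n := r b + 1)]
      have h1 : ∀ (p : Fin (r a + 1)) (q : Fin (r b + 1)),
          form (ext0 (lam a) p / 2) (ext0 (lam b) q / 2) / κ *
            propValue (l (Sum.inr a) (Sum.inr b)) (w (Sum.inr a) - w (Sum.inr b)) p q =
          (if (p : ℕ) + q = 0 then lam a 0 * lam b 0 / (2 * κ) * l (Sum.inr a) (Sum.inr b) else 0) +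
          if 0 < (p : ℕ) + q then
          lam a p * lam b q / (2 * κ) * ((p + q : ℕ).choose p : ℂ) *
            ((-1) ^ ((p : ℕ) + 1) / ((p : ℕ) + (q : ℕ) : ℂ)) *
              (1 / (w (Sum.inr a) - w (Sum.inr b)) ^ ((p : ℕ) + q)) else 0 := by
        intro p q
        rw [ext0, dif_pos p.2, ext0, dif_pos q.2, propValue]
        by_cases hpq : (p : ℕ) + q = 0
        · have hp : p = 0 := Fin.ext (by rw [Fin.val_zero]; omega)
          have hq : q = 0 := Fin.ext (by rw [Fin.val_zero]; omega)
          subst hp; subst hq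
          simp [form]
          left
          ring
        · rw [if_neg hpq, if_neg hpq, if_pos (by omega), form]
          push_cast
          ring
      simp only [h1, Finset.sum_add_distrib]
      congr 1
      rw [Finset.sum_eq_single 0, Finset.sum_eq_single 0]
      · simp
      · intro q _ hq
        rw [if_neg]
        intro h2
        exact hq (Fin.ext (by rw [Fin.val_zero]; omega))
      · simp
      · intro p _ hp
        refine Finset.sum_eq_zero fun q _ => ?_
        rw [if_neg]
        intro h2
        exact hp (Fin.ext (by rw [Fin.val_zero]; omega))
      · simp
    · rfl
  · congr 1
    · refine Finset.sum_congr rfl fun i _ => ?_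
      rw [sum_Ioi_eq]
      refine Finset.sum_congr rfl fun j _ => ?_
      simp [order, charge, form, propValue]
    · refine Finset.sum_congr rfl fun i _ => Finset.sum_congr rfl fun a _ => ?_
      simp only [order, charge_inr]
      rw [zero_add, Finset.sum_range_one, Finset.sum_range, Fin.sum_univ_succ]
      congr 1
      · rw [Fin.val_zero, ext0, dif_pos (Nat.succ_pos _)]
        simp [charge, form, propValue]
        left
        ring
      · refine Finset.sum_congr rfl fun p _ => ?_
        rw [ext0, dif_pos p.succ.2, Fin.eta]
        simp [charge, form, propValue]
        ring

end Master

/-! ### The correlation function of the free boson -/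

section Boson

lemma hasSum_of_eq {β : Type*} {f g : β → ℂ} {a b : ℂ} (h : HasSum f a) (hfg : ∀ k, g k = f k)
    (hab : b = a) : HasSum g b := by
  rw [hab, funext hfg]
  exact h

lemma cast_choose_right (a b : ℕ) :
    ((a + b).choose b : ℂ) = (a + b).factorial / (a.factorial * b.factorial) := by
  rw [← Nat.choose_symm_add, Nat.cast_add_choose]

lemma choose_neg_succ (k p : ℕ) :
    ((Ring.choose (-((k : ℤ) + 1)) p : ℤ) : ℂ) = (-1) ^ p * ((k + p).choose p : ℂ) := by
  have h1 : (Ring.choose (-((k : ℤ) + 1)) p : ℤ) = (-1) ^ p * ((k + p).choose p : ℤ) := by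
    rw [Ring.choose_neg, show (k : ℤ) + 1 + p - 1 = ((k + p : ℕ) : ℤ) by push_cast; ring,
      Ring.choose_natCast, Units.smul_def, Int.negOnePow_def, zpow_natCast,
      Units.val_pow_eq_pow_val, smul_eq_mul]
    simp
  rw [h1]
  push_cast
  ring

lemma choose_cast_succ (k q : ℕ) :
    ((Ring.choose ((k : ℤ) + 1) q : ℤ) : ℂ) = ((k + 1).choose q : ℂ) := by
  rw [show (k : ℤ) + 1 = ((k + 1 : ℕ) : ℤ) by push_cast; ring, Ring.choose_natCast]
  simp

/-- The terms of the expansion of the nonzero modes of the propagator. -/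
def modeTerm (x y : ℂ) (p q k : ℕ) : ℂ :=
  -(1 / ((k : ℂ) + 1)) * ((Ring.choose (-((k : ℤ) + 1)) p : ℤ) * x ^ (-((k : ℤ) + 1) - p)) *
    ((Ring.choose ((k : ℤ) + 1) q : ℤ) * y ^ ((k : ℤ) + 1 - q))

lemma modeTerm_eq {x y : ℂ} (hx : x ≠ 0) (p q k : ℕ) (hq : q ≤ k + 1) :
    modeTerm x y p q k = (-1) ^ (p + 1) * (((k + p).choose p : ℂ) * ((k + 1).choose q : ℂ) / (k + 1)) *
      (y / x) ^ (k + 1 - q) / x ^ (p + q) := by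
  rw [modeTerm, choose_neg_succ, choose_cast_succ]
  obtain ⟨s, hs⟩ := Nat.exists_eq_add_of_le hq
  have h1 : y ^ ((k : ℤ) + 1 - q) = y ^ s := by
    rw [← zpow_natCast]; congr 1; omega
  have h2 : x ^ (-((k : ℤ) + 1) - p) = (x ^ (k + 1 + p))⁻¹ := by
    rw [← zpow_natCast, ← zpow_neg]; congr 1; push_cast; ring
  rw [h1, h2, hs, Nat.add_sub_cancel_left, div_pow]
  have : (k : ℂ) + 1 ≠ 0 := by exact_mod_cast Nat.succ_ne_zero k
  rw [pow_add x (q + s), pow_add x q, pow_add x p]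
  field_simp
  ring

/-- The Taylor series of `log (1 - y / x)`; its term of order zero vanishes, so nothing is lost by
starting at order one. -/
lemma hasSum_modeTerm_zero_zero {x y : ℂ} (hx : x ≠ 0) (hxy : ‖y‖ < ‖x‖) :
    HasSum (modeTerm x y 0 0) (Complex.log (1 - y / x)) := by
  have hu : ‖y / x‖ < 1 := by
    rw [norm_div]
    exact (div_lt_one (norm_pos_iff.mpr hx)).mpr hxy
  have h1 := (hasSum_nat_add_iff' 1).mpr (Complex.hasSum_taylorSeries_neg_log hu)
  have h2 := h1.neg
  refine hasSum_of_eq h2 (fun k => ?_) (by simp)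
  rw [modeTerm_eq hx _ _ _ (Nat.zero_le _)]
  simp
  ring

lemma modeTerm_eq_zero (x y : ℂ) (p q k : ℕ) (hq : k + 1 < q) : modeTerm x y p q k = 0 := by
  rw [modeTerm, choose_cast_succ, Nat.choose_eq_zero_of_lt hq]
  simp

/-- A negative binomial series in `y / x` without its constant term. The missing term `propValue 0 x
(p + 1) 0` is what the zero mode contributes. -/
lemma hasSum_modeTerm_succ_zero {x y : ℂ} (hx : x ≠ 0) (hxy : ‖y‖ < ‖x‖) (p : ℕ) :
    HasSum (modeTerm x y (p + 1) 0) (propValue 0 (x - y) (p + 1) 0 - propValue 0 x (p + 1) 0) := by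
  have hu : ‖y / x‖ < 1 := by
    rw [norm_div]
    exact (div_lt_one (norm_pos_iff.mpr hx)).mpr hxy
  have h0 : HasSum (fun k : ℕ => ((k + p).choose p : ℂ) * (y / x) ^ k)
      (1 / (1 - y / x) ^ (p + 1)) := hasSum_choose_mul_geometric_of_norm_lt_one p hu
  have h1 := (hasSum_nat_add_iff' 1).mpr h0
  have h2 := h1.mul_left ((-1) ^ (p + 2) / ((p : ℂ) + 1) / x ^ (p + 1))
  have hp : (p : ℂ) + 1 ≠ 0 := by exact_mod_cast Nat.succ_ne_zero p
  have hxy' : x - y ≠ 0 := by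
    rw [sub_ne_zero]
    rintro rfl
    exact lt_irrefl _ hxy
  have hux : 1 - y / x = (x - y) / x := by field_simp
  refine hasSum_of_eq h2 (fun k => ?_) ?_
  · rw [modeTerm_eq hx _ _ _ (Nat.zero_le _)]
    have hk : (k : ℂ) + 1 ≠ 0 := by exact_mod_cast Nat.succ_ne_zero k
    have h3 : ((k + (p + 1)).choose (p + 1) : ℂ) * (p + 1) = ((k + 1 + p).choose p : ℂ) * (k + 1) := by
      have := Nat.choose_succ_right_eq (k + (p + 1)) p
      rw [show k + (p + 1) - p = k + 1 by omega] at this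
      rw [show k + 1 + p = k + (p + 1) by ring]
      exact_mod_cast this
    have h4 : ((k + (p + 1)).choose (p + 1) : ℂ) / (k + 1) = ((k + 1 + p).choose p : ℂ) / (p + 1) := by
      rw [div_eq_div_iff hk hp, h3]
    rw [Nat.choose_zero_right, Nat.cast_one, mul_one, h4, Nat.sub_zero, add_zero]
    ring
  · rw [propValue, propValue, if_neg (by omega), if_neg (by omega), hux]
    simp only [Finset.sum_range_one, zero_add, Nat.choose_self, pow_zero, add_zero]
    push_cast
    rw [div_pow]
    field_simp

/-- The derivatives in `y` kill the modes with `k < q`. The remaining ones form a complete negative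
binomial series after the shift of the index by `q`, so no correction from the zero mode is needed.
-/
lemma hasSum_modeTerm_succ {x y : ℂ} (hx : x ≠ 0) (hxy : ‖y‖ < ‖x‖) (p q : ℕ) :
    HasSum (modeTerm x y p (q + 1)) (propValue 0 (x - y) p (q + 1)) := by
  have hu : ‖y / x‖ < 1 := by
    rw [norm_div]
    exact (div_lt_one (norm_pos_iff.mpr hx)).mpr hxy
  have hxy' : x - y ≠ 0 := by
    rw [sub_ne_zero]
    rintro rfl
    exact lt_irrefl _ hxy
  have hux : 1 - y / x = (x - y) / x := by field_simp
  have h2 := (hasSum_choose_mul_geometric_of_norm_lt_one (p + q) hu).mul_left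
    ((-1) ^ (p + 1) * (((p.factorial : ℂ) * (q + 1).factorial)⁻¹ * ((p + q).factorial : ℂ)) /
      x ^ (p + (q + 1)))
  rw [← (add_left_injective q).hasSum_iff]
  · refine hasSum_of_eq h2 (fun s => ?_) ?_
    · change modeTerm x y p (q + 1) (s + q) = _
      rw [modeTerm_eq hx _ _ _ (by omega), show s + q + 1 - (q + 1) = s by omega]
      have h3 : ((s + q + p).choose p : ℂ) = (s + q + p).factorial / ((s + q).factorial * p.factorial) :=
        cast_choose_right _ _
      have h4 : ((s + q + 1).choose (q + 1) : ℂ) =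
          (s + (q + 1)).factorial / (s.factorial * (q + 1).factorial) :=
        cast_choose_right s (q + 1)
      have h5 : ((s + (p + q)).choose (p + q) : ℂ) =
          (s + (p + q)).factorial / (s.factorial * (p + q).factorial) :=
        cast_choose_right _ _
      rw [h3, h4, h5, show s + q + p = s + (p + q) by ring, show s + (q + 1) = (s + q) + 1 by ring,
        Nat.factorial_succ (s + q)]
      have e1 : ((s + q).factorial : ℂ) ≠ 0 := Nat.cast_ne_zero.mpr (Nat.factorial_ne_zero _)
      have e2 : ((p + q).factorial : ℂ) ≠ 0 := Nat.cast_ne_zero.mpr (Nat.factorial_ne_zero _)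
      have e3 : (s : ℂ) + q + 1 ≠ 0 := by exact_mod_cast Nat.succ_ne_zero (s + q)
      push_cast
      field_simp
    · rw [propValue, if_neg (by omega), mul_div_assoc, choose_div_add _ _ (by omega), hux,
        show p + (q + 1) - 1 = p + q by omega, show p + q + 1 = p + (q + 1) by ring, div_pow]
      field_simp
  · intro k hk
    refine modeTerm_eq_zero x y p (q + 1) k ?_
    by_contra h3
    exact hk ⟨k - q, by dsimp only; omega⟩

/-- The contribution of the nonzero modes to the propagator. -/
def modeSum (x y : ℂ) (p q : ℕ) : ℂ :=
  if q = 0 then if p = 0 then Complex.log (1 - y / x) else propValue 0 (x - y) p 0 - propValue 0 x p 0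
  else propValue 0 (x - y) p q

lemma hasSum_modeTerm {x y : ℂ} (hx : x ≠ 0) (hxy : ‖y‖ < ‖x‖) (p q : ℕ) :
    HasSum (modeTerm x y p q) (modeSum x y p q) := by
  rcases q with _ | q
  · rcases p with _ | p
    · exact hasSum_modeTerm_zero_zero hx hxy
    · exact hasSum_modeTerm_succ_zero hx hxy p
  · exact hasSum_modeTerm_succ hx hxy p q

/-- The creation part of a vertex operator. -/
def creationCoeff (c : ℕ → ℂ) (R : ℕ) (w : ℂ) (k : ℕ) : ℂ :=
  ∑ p ∈ Finset.range (R + 1), c p * (Ring.choose ((k : ℤ) + 1) p : ℤ) * w ^ ((k : ℤ) + 1 - p)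

/-- The annihilation part of a vertex operator. -/
def annihilationCoeff (c : ℕ → ℂ) (R : ℕ) (w : ℂ) (k : ℕ) : ℂ :=
  ∑ p ∈ Finset.range (R + 1), c p * (Ring.choose (-((k : ℤ) + 1)) p : ℤ) *
    w ^ (-((k : ℤ) + 1) - p)

lemma hasSum_annihilation_creation (κ : ℂ) (c d : ℕ → ℂ) (R S : ℕ) {x y : ℂ} (hx : x ≠ 0)
    (hxy : ‖y‖ < ‖x‖) :
    HasSum (fun k : ℕ => (-(2 / κ * annihilationCoeff c R x k)) / (k + 1) * creationCoeff d S y k)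
      (∑ p ∈ Finset.range (R + 1), ∑ q ∈ Finset.range (S + 1),
        form (c p) (d q) / κ * modeSum x y p q) := by
  have h1 := hasSum_sum (s := Finset.range (R + 1)) fun p _ =>
    hasSum_sum (s := Finset.range (S + 1)) fun q _ =>
      (hasSum_modeTerm hx hxy p q).mul_left (form (c p) (d q) / κ)
  refine hasSum_of_eq h1 (fun k => ?_) rfl
  have h2 : -(2 / κ * annihilationCoeff c R x k) / (k + 1) =
      ∑ p ∈ Finset.range (R + 1), -(2 / κ / (k + 1) *
        (c p * (Ring.choose (-((k : ℤ) + 1)) p : ℤ) * x ^ (-((k : ℤ) + 1) - p))) := by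
    rw [annihilationCoeff, Finset.sum_neg_distrib, ← Finset.mul_sum]
    ring
  rw [h2, creationCoeff, Finset.sum_mul_sum]
  refine Finset.sum_congr rfl fun p _ => Finset.sum_congr rfl fun q _ => ?_
  rw [modeTerm, form]
  ring

/-- The contribution of a pair of vertex operators to the vacuum expectation value. -/
def pairTerm (κ : ℂ) (c d : ℕ → ℂ) (R S : ℕ) (x y l : ℂ) : ℂ :=
  2 * d 0 / κ * (c 0 * l + ∑ p ∈ Finset.Icc 1 R, c p * ((-1) ^ (p - 1) / (p * x ^ p))) +
    ∑ p ∈ Finset.range (R + 1), ∑ q ∈ Finset.range (S + 1),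
      form (c p) (d q) / κ * modeSum x y p q

/-- The zero mode supplies `log x` and its derivatives, which are independent of `y` and therefore
enter for `q = 0` only; there they complete the contribution of the nonzero modes. -/
lemma pairTerm_eq (κ : ℂ) (c d : ℕ → ℂ) (R S : ℕ) (x y l : ℂ) :
    pairTerm κ c d R S x y l = ∑ p ∈ Finset.range (R + 1), ∑ q ∈ Finset.range (S + 1),
      form (c p) (d q) / κ * propValue (l + Complex.log (1 - y / x)) (x - y) p q := by
  have h1 : 2 * d 0 / κ * (c 0 * l + ∑ p ∈ Finset.Icc 1 R, c p * ((-1) ^ (p - 1) / (p * x ^ p))) =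
      ∑ p ∈ Finset.range (R + 1), form (c p) (d 0) / κ *
        (if p = 0 then l else propValue 0 x p 0) := by
    have h2 : Finset.Icc 1 R = Finset.Ico 1 (R + 1) := by
      ext p; simp
    rw [Finset.sum_range_succ', h2, Finset.sum_Ico_eq_sum_range, mul_add, Finset.mul_sum, add_comm]
    congr 1
    · refine Finset.sum_congr rfl fun p _ => ?_
      rw [form, if_neg (Nat.succ_ne_zero p), propValue, if_neg (by omega), add_comm 1 p]
      simp only [Nat.add_sub_cancel, add_zero, Nat.choose_self]
      rw [pow_succ (-1 : ℂ), pow_succ (-1 : ℂ), Nat.cast_one, mul_one, div_div]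
      ring
    · simp [form]
      ring
  rw [pairTerm, h1, ← Finset.sum_add_distrib]
  refine Finset.sum_congr rfl fun p _ => ?_
  rw [Finset.sum_range_succ' _ S, Finset.sum_range_succ' _ S, add_left_comm]
  refine congrArg₂ (· + ·) ?_ ?_
  · refine Finset.sum_congr rfl fun q _ => ?_
    simp [modeSum, propValue]
  · rw [← mul_add]
    congr 1
    by_cases hp : p = 0
    · simp [modeSum, propValue, hp]
    · simp [modeSum, propValue, hp]

/-! ### Products of vertex operators -/

section VertexProduct

variable {ι : Type*}

/-- The sum of `P j k` over the pairs `j`, `k` of entries with `j` before `k`. -/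
def pairSum (P : ι → ι → ℂ) : List ι → ℂ
  | [] => 0
  | j :: js => (js.map (P j)).sum + pairSum P js

lemma pairSum_eq {lt : ι → ι → Prop} [DecidableRel lt] (hirr : ∀ j, ¬ lt j j)
    (hasymm : ∀ j k, lt j k → ¬ lt k j) (P : ι → ι → ℂ) (js : List ι) (hjs : js.Pairwise lt) :
    pairSum P js = (js.map fun j => (js.map fun k => if lt j k then P j k else 0).sum).sum := by
  induction js with
  | nil => rfl
  | cons j js ih =>
    rw [List.pairwise_cons] at hjs
    rw [pairSum, ih hjs.2, List.map_cons, List.sum_cons, List.map_cons, List.sum_cons,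
      if_neg (hirr j), zero_add]
    congr 1
    · refine congrArg List.sum (List.map_congr_left fun k hk => ?_)
      rw [if_pos (hjs.1 k hk)]
    · refine congrArg List.sum (List.map_congr_left fun k hk => ?_)
      rw [List.map_cons, List.sum_cons, if_neg (hasymm j k (hjs.1 k hk)), zero_add]

lemma list_sum_map_add (f g : ι → ℂ) (js : List ι) :
    (js.map fun j => f j + g j).sum = (js.map f).sum + (js.map g).sum := by
  induction js with
  | nil => simp
  | cons j js ih => simp only [List.map_cons, List.sum_cons, ih]; ring

lemma list_sum_map_mul (f : ι → ℂ) (c : ℂ) (js : List ι) :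
    (js.map fun j => f j * c).sum = (js.map f).sum * c := by
  induction js with
  | nil => simp
  | cons j js ih => simp only [List.map_cons, List.sum_cons, ih]; ring

/-- By induction from the right. The leftmost operator meets the state of the others: its zero mode
reads off their total momentum, and its annihilation part translates the variables `y` in their
creation exponentials. Both effects are sums over the operators to the right, hence the pair terms.
Summability is required so that a translated series splits into two. -/
lemma foldr_vertexOp (κ : ℂ) (c : ι → ℕ → ℂ) (R : ι → ℕ) (x l : ι → ℂ) (hx : ∀ j, x j ≠ 0)
    (js : List ι) (hjs : js.Pairwise fun j k => ‖x k‖ < ‖x j‖) :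
    (js.foldr (fun j s => vertexOp κ (c j) (R j) (x j) (l j) s)
      ((0 : ℂ), fun _ : ℕ → ℂ => (1 : ℂ))).1 = (js.map fun j => c j 0).sum ∧
    ∀ y : ℕ → ℂ, (∀ j ∈ js, Summable fun k : ℕ =>
        y k / (k + 1) * creationCoeff (c j) (R j) (x j) k) →
      (js.foldr (fun j s => vertexOp κ (c j) (R j) (x j) (l j) s)
        ((0 : ℂ), fun _ : ℕ → ℂ => (1 : ℂ))).2 y =
      Complex.exp ((js.map fun j => ∑' k : ℕ,
          y k / (k + 1) * creationCoeff (c j) (R j) (x j) k).sum +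
        pairSum (fun j k => pairTerm κ (c j) (c k) (R j) (R k) (x j) (x k) (l j)) js) := by
  induction js with
  | nil => simp [pairSum]
  | cons j js ih =>
    rw [List.pairwise_cons] at hjs
    obtain ⟨ih1, ih2⟩ := ih hjs.2
    rw [List.foldr_cons]
    set s := js.foldr (fun j s => vertexOp κ (c j) (R j) (x j) (l j) s)
      ((0 : ℂ), fun _ : ℕ → ℂ => (1 : ℂ)) with hs
    refine ⟨?_, fun y hy => ?_⟩
    · change s.1 + c j 0 = _
      rw [ih1, List.map_cons, List.sum_cons, add_comm]
    · have hA := fun k hk => hasSum_annihilation_creation κ (c j) (c k) (R j) (R k) (hx j)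
        (hjs.1 k hk)
      have hsplit : ∀ k (i : ℕ), (y i - 2 / κ * annihilationCoeff (c j) (R j) (x j) i) / (i + 1) *
          creationCoeff (c k) (R k) (x k) i =
          y i / (i + 1) * creationCoeff (c k) (R k) (x k) i +
            (-(2 / κ * annihilationCoeff (c j) (R j) (x j) i)) / (i + 1) *
              creationCoeff (c k) (R k) (x k) i := fun k i => by ring
      have hy' : ∀ k ∈ js, HasSum (fun i : ℕ =>
          (y i - 2 / κ * annihilationCoeff (c j) (R j) (x j) i) / (i + 1) *
            creationCoeff (c k) (R k) (x k) i)
          ((∑' i : ℕ, y i / (i + 1) * creationCoeff (c k) (R k) (x k) i) +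
            ∑ p ∈ Finset.range (R j + 1), ∑ q ∈ Finset.range (R k + 1),
              form (c j p) (c k q) / κ * modeSum (x j) (x k) p q) := fun k hk =>
        hasSum_of_eq ((hy k (List.mem_cons_of_mem _ hk)).hasSum.add (hA k hk)) (hsplit k) rfl
      have h1 := ih2 (fun i => y i - 2 / κ * annihilationCoeff (c j) (R j) (x j) i)
        fun k hk => (hy' k hk).summable
      have h2 : (vertexOp κ (c j) (R j) (x j) (l j) s).2 y =
          Complex.exp (∑' k : ℕ, y k / (k + 1) * creationCoeff (c j) (R j) (x j) k) *
          Complex.exp (2 * s.1 / κ * (c j 0 * l j +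
            ∑ p ∈ Finset.Icc 1 (R j), c j p * ((-1) ^ (p - 1) / (p * x j ^ p)))) *
          s.2 (fun i => y i - 2 / κ * annihilationCoeff (c j) (R j) (x j) i) := rfl
      rw [h2, h1, ← Complex.exp_add, ← Complex.exp_add, List.map_cons, List.sum_cons, pairSum, ih1]
      congr 1
      have h3 : (js.map fun k => ∑' i : ℕ,
          (y i - 2 / κ * annihilationCoeff (c j) (R j) (x j) i) / (i + 1) *
            creationCoeff (c k) (R k) (x k) i) =
          js.map fun k => (∑' i : ℕ, y i / (i + 1) * creationCoeff (c k) (R k) (x k) i) +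
            ∑ p ∈ Finset.range (R j + 1), ∑ q ∈ Finset.range (R k + 1),
              form (c j p) (c k q) / κ * modeSum (x j) (x k) p q :=
        List.map_congr_left fun k hk => (hy' k hk).tsum_eq
      have h4 : 2 * (js.map fun k => c k 0).sum / κ * (c j 0 * l j +
            ∑ p ∈ Finset.Icc 1 (R j), c j p * ((-1) ^ (p - 1) / (p * x j ^ p))) =
          (js.map fun k => 2 * c k 0 / κ * (c j 0 * l j +
            ∑ p ∈ Finset.Icc 1 (R j), c j p * ((-1) ^ (p - 1) / (p * x j ^ p)))).sum := by
        rw [mul_comm (2 : ℂ), mul_div_assoc, mul_assoc, ← list_sum_map_mul]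
        refine congrArg List.sum (List.map_congr_left fun k _ => ?_)
        ring
      rw [h3, h4, list_sum_map_add]
      simp only [pairTerm]
      rw [list_sum_map_add]
      ring

end VertexProduct

variable {m n : ℕ} {r : Fin n → ℕ}

/-- At `y = 0` the creation parts disappear and the pair terms remain. The logarithm of `w j - w k`
is the branch `l j + log (1 - w k / w j)`, which converges for radially ordered points. -/
theorem bosonVev_eq_psi (κ : ℂ) (lam : Weights r) (w : Pts m n) (l : Fin m ⊕ Fin n → ℂ)
    (hl : ∀ j, Complex.exp (l j) = w j) (hw : ∀ j k, toLex j < toLex k → ‖w k‖ < ‖w j‖) :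
    bosonVev κ lam w l = psi κ lam w (fun j k => l j + Complex.log (1 - w k / w j)) := by
  classical
  have hx : ∀ j, w j ≠ 0 := fun j => hl j ▸ Complex.exp_ne_zero _
  have hinj : Function.Injective w := by
    intro j k hjk
    rcases lt_trichotomy (toLex j) (toLex k) with h | h | h
    · exact absurd (hw j k h) (by rw [hjk]; exact lt_irrefl _)
    · exact toLex.injective h
    · exact absurd (hw k j h) (by rw [hjk]; exact lt_irrefl _)
  have hsorted : ((List.ofFn (Sum.inl : Fin m → Fin m ⊕ Fin n)) ++
      (List.ofFn (Sum.inr : Fin n → Fin m ⊕ Fin n))).Pairwise fun j k => toLex j < toLex k := by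
    rw [List.pairwise_append, List.pairwise_ofFn, List.pairwise_ofFn]
    refine ⟨fun i j hij => Sum.Lex.inl_lt_inl_iff.mpr hij,
      fun i j hij => Sum.Lex.inr_lt_inr_iff.mpr hij, fun j hj k hk => ?_⟩
    obtain ⟨i, rfl⟩ := (List.mem_ofFn' _ _).mp hj
    obtain ⟨a, rfl⟩ := (List.mem_ofFn' _ _).mp hk
    exact Sum.Lex.inl_lt_inr _ _
  have h1 := (foldr_vertexOp κ (charge lam) (order r) w l hx _
    (hsorted.imp fun {j k} h => hw j k h)).2 0 (fun j _ => by simp [summable_zero])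
  rw [bosonVev, h1, psi_eq_exp κ lam hinj, pairSum_eq (lt := fun j k => toLex j < toLex k)
    (fun j => lt_irrefl _) (fun j k h => h.asymm) _ _ hsorted]
  congr 1
  simp only [Pi.zero_apply, zero_div, zero_mul, tsum_zero, List.map_append, List.sum_append,
    List.map_ofFn, List.sum_ofFn, Function.comp_apply, Finset.sum_const_zero, add_zero, zero_add]
  rw [psiExponent]
  simp only [Fintype.sum_sum_type, pairTerm_eq]

end Boson

/-! ### Rational functions regular at pairwise distinct points -/

section Regular

variable {m n : ℕ}

lemma IsRegular.const (c : ℂ) : IsRegular (fun _ : Pts m n => c) :=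
  ⟨MvPolynomial.C c, 1, fun w _ => by simp⟩

lemma IsRegular.add {η θ : Pts m n → ℂ} (hη : IsRegular η) (hθ : IsRegular θ) :
    IsRegular fun w => η w + θ w := by
  obtain ⟨p, q, h⟩ := hη
  obtain ⟨p', q', h'⟩ := hθ
  refine ⟨p * q' + p' * q, q * q', fun w hw => ⟨?_, ?_⟩⟩
  · rw [map_mul]
    exact mul_ne_zero (h w hw).1 (h' w hw).1
  · have h1 := (h w hw).1
    have h2 := (h' w hw).1
    dsimp only
    rw [(h w hw).2, (h' w hw).2, map_add, map_mul, map_mul, map_mul]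
    field_simp

lemma IsRegular.mul {η θ : Pts m n → ℂ} (hη : IsRegular η) (hθ : IsRegular θ) :
    IsRegular fun w => η w * θ w := by
  obtain ⟨p, q, h⟩ := hη
  obtain ⟨p', q', h'⟩ := hθ
  refine ⟨p * p', q * q', fun w hw => ⟨?_, ?_⟩⟩
  · rw [map_mul]
    exact mul_ne_zero (h w hw).1 (h' w hw).1
  · dsimp only
    rw [(h w hw).2, (h' w hw).2, map_mul, map_mul, div_mul_div_comm]

lemma IsRegular.const_mul {η : Pts m n → ℂ} (hη : IsRegular η) (c : ℂ) :
    IsRegular fun w => c * η w := (IsRegular.const c).mul hη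

lemma IsRegular.sum {ι : Type*} (s : Finset ι) {η : ι → Pts m n → ℂ}
    (hη : ∀ i ∈ s, IsRegular (η i)) : IsRegular fun w => ∑ i ∈ s, η i w := by
  classical
  induction s using Finset.induction_on with
  | empty => simpa using IsRegular.const 0
  | insert i s hi ih =>
    simp only [Finset.sum_insert hi]
    exact (hη i (Finset.mem_insert_self _ _)).add
      (ih fun j hj => hη j (Finset.mem_insert_of_mem hj))

lemma IsRegular.prod {ι : Type*} (s : Finset ι) {η : ι → Pts m n → ℂ}
    (hη : ∀ i ∈ s, IsRegular (η i)) : IsRegular fun w => ∏ i ∈ s, η i w := by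
  classical
  induction s using Finset.induction_on with
  | empty => simpa using IsRegular.const 1
  | insert i s hi ih =>
    simp only [Finset.prod_insert hi]
    exact (hη i (Finset.mem_insert_self _ _)).mul
      (ih fun j hj => hη j (Finset.mem_insert_of_mem hj))

lemma IsRegular.pow {η : Pts m n → ℂ} (hη : IsRegular η) (k : ℕ) :
    IsRegular fun w => η w ^ k := by
  have := IsRegular.prod (Finset.range k) (η := fun _ => η) fun _ _ => hη
  simpa using this

lemma IsRegular.inv_sub {j k : Fin m ⊕ Fin n} (hjk : j ≠ k) :
    IsRegular fun w : Pts m n => (w j - w k)⁻¹ :=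
  ⟨1, MvPolynomial.X j - MvPolynomial.X k, fun w hw => by
    rw [map_sub, MvPolynomial.eval_X, MvPolynomial.eval_X, map_one, one_div]
    exact ⟨sub_ne_zero.mpr (hw.ne hjk), rfl⟩⟩

lemma IsRegular.congr {η θ : Pts m n → ℂ} (hη : IsRegular η)
    (h : ∀ w, Function.Injective w → θ w = η w) : IsRegular θ := by
  obtain ⟨p, q, hpq⟩ := hη
  exact ⟨p, q, fun w hw => ⟨(hpq w hw).1, by rw [h w hw, (hpq w hw).2]⟩⟩

/-- The real intervals in which the points are radially ordered. -/
def radialInterval (m n : ℕ) : Fin m ⊕ Fin n → Set ℂ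
  | Sum.inl i => Complex.ofReal '' Set.Ioo (2 * ((n : ℝ) + i)) (2 * ((n : ℝ) + i) + 1)
  | Sum.inr a => Complex.ofReal '' Set.Ioo (2 * (a : ℝ)) (2 * (a : ℝ) + 1)

lemma radialInterval_infinite (j : Fin m ⊕ Fin n) : (radialInterval m n j).Infinite := by
  rcases j with i | a
  · exact (Set.Ioo_infinite (by linarith)).image Complex.ofReal_injective.injOn
  · exact (Set.Ioo_infinite (by linarith)).image Complex.ofReal_injective.injOn

lemma exists_of_mem_radialInterval {j : Fin m ⊕ Fin n} {x : ℂ} (hx : x ∈ radialInterval m n j) :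
    ∃ y : ℝ, x = y ∧ 2 * (((Sum.elim (fun i : Fin m => n + (i : ℕ)) (fun a : Fin n => (a : ℕ)) j : ℕ)) : ℝ) < y ∧
      y < 2 * (((Sum.elim (fun i : Fin m => n + (i : ℕ)) (fun a : Fin n => (a : ℕ)) j : ℕ)) : ℝ) + 1 := by
  rcases j with i | a
  · obtain ⟨y, hy, rfl⟩ := hx
    exact ⟨y, rfl, by simpa using hy.1, by simpa using hy.2⟩
  · obtain ⟨y, hy, rfl⟩ := hx
    exact ⟨y, rfl, by simpa using hy.1, by simpa using hy.2⟩

lemma injective_of_mem_radialInterval {w : Pts m n} (hw : ∀ j, w j ∈ radialInterval m n j) :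
    Function.Injective w := by
  intro j k hjk
  obtain ⟨x, hx, hx1, hx2⟩ := exists_of_mem_radialInterval (hw j)
  obtain ⟨y, hy, hy1, hy2⟩ := exists_of_mem_radialInterval (hw k)
  have hxy : x = y := Complex.ofReal_injective (by rw [← hx, ← hy, hjk])
  subst hxy
  set N : Fin m ⊕ Fin n → ℕ := Sum.elim (fun i : Fin m => n + (i : ℕ)) (fun a : Fin n => (a : ℕ))
    with hN
  have h1 : N j < N k + 1 := by
    have : (N j : ℝ) < N k + 1 := by linarith
    exact_mod_cast this
  have h2 : N k < N j + 1 := by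
    have : (N k : ℝ) < N j + 1 := by linarith
    exact_mod_cast this
  have h3 : N j = N k := by omega
  rcases j with i | a <;> rcases k with i' | a' <;> simp only [hN, Sum.elim_inl, Sum.elim_inr] at h3
  · rw [Fin.ext (Nat.add_left_cancel h3)]
  · omega
  · omega
  · rw [Fin.ext h3]

lemma norm_lt_of_mem_radialInterval {w : Pts m n} (hw : ∀ j, w j ∈ radialInterval m n j)
    (i : Fin m) (a : Fin n) : ‖w (Sum.inr a)‖ < ‖w (Sum.inl i)‖ := by
  obtain ⟨x, hx, hx1, hx2⟩ := exists_of_mem_radialInterval (hw (Sum.inl i))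
  obtain ⟨y, hy, hy1, hy2⟩ := exists_of_mem_radialInterval (hw (Sum.inr a))
  simp only [Sum.elim_inl, Sum.elim_inr] at hx1 hx2 hy1 hy2
  push_cast at hx1
  have h1 : (a : ℝ) + 1 ≤ n := by exact_mod_cast a.2
  have h2 : (0 : ℝ) ≤ (a : ℕ) := Nat.cast_nonneg _
  have h3 : (0 : ℝ) ≤ (i : ℕ) := Nat.cast_nonneg _
  rw [hx, hy, Complex.norm_real, Complex.norm_real, Real.norm_of_nonneg (by linarith),
    Real.norm_of_nonneg (by linarith)]
  linarith

/-- Regular functions which agree at radially ordered points agree. -/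
lemma IsRegular.eq_of_radial {η θ : Pts m n → ℂ} (hη : IsRegular η) (hθ : IsRegular θ)
    (h : ∀ w : Pts m n, Function.Injective w → (∀ i a, ‖w (Sum.inr a)‖ < ‖w (Sum.inl i)‖) →
      η w = θ w) (w : Pts m n) (hw : Function.Injective w) : η w = θ w := by
  obtain ⟨p, q, hpq⟩ := hη
  obtain ⟨p', q', hpq'⟩ := hθ
  -- The identity with denominators cleared holds on a product of infinite sets, hence as an
  -- identity of polynomials.
  have key : p * q' = p' * q := by
    refine MvPolynomial.funext_set (radialInterval m n) radialInterval_infinite fun x hx => ?_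
    have hx' : ∀ j, x j ∈ radialInterval m n j := fun j => hx j (Set.mem_univ _)
    have hxi := injective_of_mem_radialInterval hx'
    have h1 := h x hxi (norm_lt_of_mem_radialInterval hx')
    rw [(hpq x hxi).2, (hpq' x hxi).2, div_eq_div_iff (hpq x hxi).1 (hpq' x hxi).1] at h1
    rw [map_mul, map_mul, h1]
  rw [(hpq w hw).2, (hpq' w hw).2, div_eq_div_iff (hpq w hw).1 (hpq' w hw).1, ← map_mul, ← map_mul,
    key]

end Regular

/-! ### Products of derivations -/

section Derivations

variable {A : Type*} [CommRing A] [Algebra ℂ A]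

/-- The indices sent to `a`, in increasing order. -/
def fiberList {m n : ℕ} (α : Fin m → Fin n) (a : Fin n) : List (Fin m) :=
  (List.finRange m).filter fun i => α i = a

lemma fiberList_cons {m n : ℕ} (b : Fin n) (α : Fin m → Fin n) (a : Fin n) :
    fiberList (Fin.cons b α : Fin (m + 1) → Fin n) a =
      if b = a then 0 :: (fiberList α a).map Fin.succ else (fiberList α a).map Fin.succ := by
  rw [fiberList, List.finRange_succ, List.filter_cons, List.filter_map]
  simp only [Fin.cons_zero, decide_eq_true_eq]
  rfl

lemma derivation_apply_prod {ι : Type*} [DecidableEq ι] (δ : Derivation ℂ A A) (R : ι → A)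
    (S : Finset ι) : δ (∏ a ∈ S, R a) = ∑ b ∈ S, ∏ a ∈ S, if b = a then δ (R a) else R a := by
  induction S using Finset.induction_on with
  | empty => simp
  | insert c S hc ih =>
    rw [Finset.prod_insert hc, Derivation.leibniz, ih, Finset.sum_insert hc, Finset.prod_insert hc,
      if_pos rfl, smul_eq_mul, smul_eq_mul, Finset.mul_sum, add_comm]
    congr 1
    · rw [mul_comm]
      congr 1
      refine Finset.prod_congr rfl fun a ha => ?_
      rw [if_neg (fun h : c = a => hc (h ▸ ha))]
    · refine Finset.sum_congr rfl fun b hb => ?_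
      rw [Finset.prod_insert hc, if_neg (fun h : b = c => hc (h ▸ hb))]

/-- The Leibniz formula for a product of derivations applied to a product. -/
lemma prod_derivation_apply_prod {m n : ℕ} (D : Fin m → Derivation ℂ A A) (Q : Fin n → A) :
    ((List.finRange m).map fun i => (D i : A →ₗ[ℂ] A)).prod (∏ a, Q a) =
      ∑ α : Fin m → Fin n, ∏ a, ((fiberList α a).map fun i => (D i : A →ₗ[ℂ] A)).prod (Q a) := by
  induction m with
  | zero => simp [fiberList]
  | succ m ih =>
    rw [List.finRange_succ, List.map_cons, List.prod_cons, List.map_map, Module.End.mul_apply]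
    have h1 := ih fun i => D i.succ
    rw [show ((fun i => (D i : A →ₗ[ℂ] A)) ∘ Fin.succ) = fun i : Fin m => (D i.succ : A →ₗ[ℂ] A)
      from rfl, h1, map_sum, ← (Fin.consEquiv fun _ => Fin n).sum_comp, Fintype.sum_prod_type,
      Finset.sum_comm]
    refine Finset.sum_congr rfl fun α _ => ?_
    rw [Derivation.coeFn_coe, derivation_apply_prod]
    refine Finset.sum_congr rfl fun b _ => Finset.prod_congr rfl fun a _ => ?_
    change _ = ((fiberList (Fin.cons b α : Fin (m + 1) → Fin n) a).map
      fun i => (D i : A →ₗ[ℂ] A)).prod (Q a)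
    rw [fiberList_cons]
    split_ifs
    · rw [List.map_cons, List.prod_cons, List.map_map]
      rfl
    · rw [List.map_map]
      rfl

end Derivations

/-! ### Wick's formula -/

section Wick

variable {S : Type*} {m N : ℕ} (D : Fin m → Derivation ℂ (MvPolynomial S ℂ) (MvPolynomial S ℂ))
  (g : Fin m → S → ℂ)

lemma mem_fiberList {α : Fin m → Fin N} {j : Fin N} {i : Fin m} :
    i ∈ fiberList α j ↔ α i = j := by
  simp [fiberList]

lemma fiberList_nodup (α : Fin m → Fin N) (j : Fin N) : (fiberList α j).Nodup :=
  (List.nodup_finRange m).filter _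

lemma prod_derivation_X_eq_C (hD : ∀ i s, D i (MvPolynomial.X s) = MvPolynomial.C (g i s)) (s : S)
    (i : Fin m) (l : List (Fin m)) : ∃ c, ((i :: l).map fun i =>
      (D i : MvPolynomial S ℂ →ₗ[ℂ] MvPolynomial S ℂ)).prod (MvPolynomial.X s) =
        MvPolynomial.C c := by
  induction l generalizing i with
  | nil => exact ⟨g i s, by simp [hD]⟩
  | cons k l ih =>
    obtain ⟨c, hc⟩ := ih k
    refine ⟨0, ?_⟩
    rw [List.map_cons, List.prod_cons, Module.End.mul_apply, hc, Derivation.coeFn_coe,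
      MvPolynomial.derivation_C, map_zero]

lemma prod_derivation_X_eq_zero (hD : ∀ i s, D i (MvPolynomial.X s) = MvPolynomial.C (g i s))
    (s : S) (l : List (Fin m)) (hl : 2 ≤ l.length) : (l.map fun i =>
      (D i : MvPolynomial S ℂ →ₗ[ℂ] MvPolynomial S ℂ)).prod (MvPolynomial.X s) = 0 := by
  match l, hl with
  | i :: k :: l, _ =>
    obtain ⟨c, hc⟩ := prod_derivation_X_eq_C D g hD s k l
    rw [List.map_cons, List.prod_cons, Module.End.mul_apply, hc, Derivation.coeFn_coe,
      MvPolynomial.derivation_C]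

open Classical in
-- By the Leibniz rule each derivation is assigned to a variable. A variable that is hit by none has
-- no constant term, and one hit twice is differentiated to zero, so only bijective assignments
-- survive.
lemma wick (hD : ∀ i s, D i (MvPolynomial.X s) = MvPolynomial.C (g i s)) (s : Fin N → S) :
    MvPolynomial.constantCoeff (((List.finRange m).map fun i =>
      (D i : MvPolynomial S ℂ →ₗ[ℂ] MvPolynomial S ℂ)).prod (∏ j, MvPolynomial.X (s j))) =
      ∑ α : Fin m → Fin N, if Function.Bijective α then ∏ i, g i (s (α i)) else 0 := by
  rw [prod_derivation_apply_prod, map_sum]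
  refine Finset.sum_congr rfl fun α _ => ?_
  rw [map_prod]
  split_ifs with hα
  · have h1 : ∀ i, fiberList α (α i) = [i] := fun i =>
      List.perm_singleton.mp ((List.perm_ext_iff_of_nodup (fiberList_nodup _ _)
        (List.nodup_singleton i)).mpr fun k => by
          rw [mem_fiberList, List.mem_singleton, hα.1.eq_iff])
    rw [← (Equiv.ofBijective α hα).prod_comp]
    refine Finset.prod_congr rfl fun i _ => ?_
    rw [Equiv.ofBijective_apply, h1]
    simp [hD]
  · by_cases hsurj : Function.Surjective α
    · have hinj : ¬ Function.Injective α := fun h => hα ⟨h, hsurj⟩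
      rw [Function.Injective] at hinj
      push Not at hinj
      obtain ⟨i, k, hik, hne⟩ := hinj
      refine Finset.prod_eq_zero (Finset.mem_univ (α i)) ?_
      rw [prod_derivation_X_eq_zero D g hD, map_zero]
      have h2 : [i, k].Subperm (fiberList α (α i)) :=
        List.subperm_of_subset (by simp [hne]) (by
          intro x hx
          rw [mem_fiberList]
          simp only [List.mem_cons, List.not_mem_nil, or_false] at hx
          rcases hx with rfl | rfl
          · rfl
          · exact hik.symm)
      exact h2.length_le
    · rw [Function.Surjective] at hsurj
      push Not at hsurj
      obtain ⟨j, hj⟩ := hsurj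
      refine Finset.prod_eq_zero (Finset.mem_univ j) ?_
      have : fiberList α j = [] := by
        rw [List.eq_nil_iff_forall_not_mem]
        intro i hi
        exact hj i (mem_fiberList.mp hi)
      rw [this]
      simp

end Wick

/-! ### Vacuum expectation values of the `βγ` system -/

section BetaGamma

lemma pderiv_inl_prod_inr {N : ℕ} (k : ℕ) (s : Fin N → ℕ) :
    MvPolynomial.pderiv (Sum.inl k : ℕ ⊕ ℕ) (∏ j, MvPolynomial.X (Sum.inr (s j)) : Fock) = 0 := by
  rw [derivation_apply_prod]
  refine Finset.sum_eq_zero fun b _ => Finset.prod_eq_zero (Finset.mem_univ b) ?_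
  rw [if_pos rfl, MvPolynomial.pderiv_X_of_ne (by simp)]

/-- A mode with `k > 0` differentiates in a `β` variable, and the other `γ` modes never create one.
-/
lemma gammaModes_apply_one {N : ℕ} (k : Fin N → ℤ) :
    ((List.ofFn fun j => gammaMode (k j)).prod (1 : Fock)) =
      if ∀ j, k j ≤ 0 then ∏ j, MvPolynomial.X (Sum.inr (-k j).toNat) else 0 := by
  induction N with
  | zero => simp
  | succ N ih =>
    rw [List.ofFn_succ, List.prod_cons, Module.End.mul_apply, ih fun j => k j.succ]
    by_cases h0 : k 0 ≤ 0
    · by_cases h1 : ∀ j : Fin N, k j.succ ≤ 0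
      · have h2 : ∀ j, k j ≤ 0 := Fin.forall_fin_succ.mpr ⟨h0, h1⟩
        rw [if_pos h1, if_pos h2, gammaMode, if_neg (by omega), LinearMap.mulLeft_apply,
          Fin.prod_univ_succ]
      · rw [if_neg h1, if_neg fun h => h1 fun j => h j.succ, map_zero]
    · rw [if_neg (c := ∀ j, k j ≤ 0) fun h => h0 (h 0), gammaMode, if_pos (by omega)]
      split_ifs
      · rw [LinearMap.neg_apply]
        refine neg_eq_zero.mpr ?_
        exact pderiv_inl_prod_inr _ fun j => (-k j.succ).toNat
      · rw [map_zero]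

/-- A creation mode of `β` leaves its variable as a factor, and the `β` modes to its left cannot
remove it, because they differentiate in `γ` variables only. So the constant term vanishes. -/
lemma betaModes_apply_of_neg (ks : List ℤ) (hks : ∃ k ∈ ks, k < 0) (Y : Fock) :
    ∃ (j : ℕ) (Z : Fock), (ks.map betaMode).prod Y = MvPolynomial.X (Sum.inl j) * Z := by
  induction ks with
  | nil => simp at hks
  | cons k ks ih =>
    rw [List.map_cons, List.prod_cons, Module.End.mul_apply]
    by_cases hk : k < 0
    · exact ⟨(-1 - k).toNat, _, by rw [betaMode, if_neg (by omega), LinearMap.mulLeft_apply]⟩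
    · obtain ⟨j, Z, hZ⟩ := ih (by
        obtain ⟨k', hk', h'⟩ := hks
        rcases List.mem_cons.mp hk' with rfl | h2
        · exact absurd h' hk
        · exact ⟨k', h2, h'⟩)
      rw [hZ, betaMode, if_pos (by omega)]
      refine ⟨j, MvPolynomial.pderiv (Sum.inr k.toNat) Z, ?_⟩
      rw [Derivation.coeFn_coe, Derivation.leibniz, MvPolynomial.pderiv_X_of_ne (by simp),
        smul_zero, add_zero, smul_eq_mul]

lemma list_prod_smul {ι M : Type*} [AddCommGroup M] [Module ℂ M] (l : List ι) (c : ι → ℂ)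
    (T : ι → Module.End ℂ M) :
    (l.map fun i => c i • T i).prod = (l.map c).prod • (l.map T).prod := by
  induction l with
  | nil => simp
  | cons i l ih =>
    simp only [List.map_cons, List.prod_cons]
    rw [ih, smul_mul_smul_comm]

/-- The contribution of the contraction of `β_k` and `γ_{k'}` to `⟨β(t) ∂ ^ p γ(z) / p!⟩`. -/
def contraction (t z : ℂ) (p : ℕ) (k : ℤ × ℤ) : ℂ :=
  if 0 ≤ k.1 ∧ k.2 = -k.1 then t ^ (-k.1 - 1) * ((Ring.choose (-k.2) p : ℤ) * z ^ (-k.2 - p)) else 0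

open Classical in
-- Only annihilation modes of `β` and creation modes of `γ` contribute. The former are then
-- derivations with constant values on the variables, and `wick` applies.
lemma vev_modes {m N : ℕ} (t : Fin m → ℂ) (p : Fin N → ℕ) (z : Fin N → ℂ) (k : Fin m → ℤ)
    (k' : Fin N → ℤ) :
    MvPolynomial.constantCoeff (((List.ofFn fun i => betaField (t i) (k i)) ++
      (List.ofFn fun j => gammaField (p j) (z j) (k' j))).prod (1 : Fock)) =
    ∑ α : Fin m → Fin N, if Function.Bijective α then
      ∏ i, contraction (t i) (z (α i)) (p (α i)) (k i, k' (α i)) else 0 := by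
  have hβ : (List.ofFn fun i => betaField (t i) (k i)).prod =
      (∏ i, t i ^ (-k i - 1)) • ((List.finRange m).map fun i => betaMode (k i)).prod := by
    rw [List.ofFn_eq_map, ← List.prod_ofFn, List.ofFn_eq_map, ← list_prod_smul]
    rfl
  have hγ : (List.ofFn fun j => gammaField (p j) (z j) (k' j)).prod =
      (∏ j, (Ring.choose (-k' j) (p j) : ℤ) * z j ^ (-k' j - p j) : ℂ) •
        (List.ofFn fun j => gammaMode (k' j)).prod := by
    rw [List.ofFn_eq_map, ← List.prod_ofFn, List.ofFn_eq_map, List.ofFn_eq_map, ← list_prod_smul]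
    rfl
  rw [List.prod_append, hβ, hγ, Module.End.mul_apply, LinearMap.smul_apply, LinearMap.smul_apply,
    LinearMap.map_smul, gammaModes_apply_one]
  by_cases hk' : ∀ j, k' j ≤ 0
  · rw [if_pos hk']
    by_cases hk : ∀ i, 0 ≤ k i
    · have h1 : (List.finRange m).map (fun i => betaMode (k i)) = (List.finRange m).map fun i =>
          ((MvPolynomial.pderiv (Sum.inr (k i).toNat) :
            Derivation ℂ Fock Fock) : Fock →ₗ[ℂ] Fock) := by
        refine List.map_congr_left fun i _ => ?_
        rw [betaMode, if_pos (hk i)]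
      rw [h1, MvPolynomial.constantCoeff_smul, MvPolynomial.constantCoeff_smul, wick
        (D := fun i => MvPolynomial.pderiv (Sum.inr (k i).toNat))
        (g := fun i s => if s = Sum.inr (k i).toNat then 1 else 0)
        (fun i s => by
          rw [MvPolynomial.pderiv_X, Pi.single_apply, apply_ite MvPolynomial.C, map_one, map_zero]) (fun j => Sum.inr (-k' j).toNat), smul_eq_mul, smul_eq_mul,
        Finset.mul_sum, Finset.mul_sum]
      refine Finset.sum_congr rfl fun α _ => ?_
      split_ifs with hα
      · rw [← (Equiv.ofBijective α hα).prod_comp]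
        simp only [Equiv.ofBijective_apply]
        rw [← Finset.prod_mul_distrib, ← Finset.prod_mul_distrib]
        refine Finset.prod_congr rfl fun i _ => ?_
        rw [contraction]
        have h2 : (0 ≤ k i ∧ k' (α i) = -k i) ↔
            (Sum.inr (-k' (α i)).toNat : ℕ ⊕ ℕ) = Sum.inr (k i).toNat := by
          rw [Sum.inr.injEq]
          have := hk i
          have := hk' (α i)
          omega
        simp only [h2]
        split_ifs <;> ring
      · ring
    · push Not at hk
      obtain ⟨i, hi⟩ := hk
      obtain ⟨j, Z, hZ⟩ := betaModes_apply_of_neg ((List.finRange m).map k)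
        ⟨k i, List.mem_map.mpr ⟨i, List.mem_finRange i, rfl⟩, hi⟩
        (∏ j, MvPolynomial.X (Sum.inr (-k' j).toNat))
      rw [List.map_map] at hZ
      rw [show (fun i => betaMode (k i)) = betaMode ∘ k from rfl, hZ]
      rw [MvPolynomial.constantCoeff_smul, MvPolynomial.constantCoeff_smul, map_mul,
        MvPolynomial.constantCoeff_X, zero_mul, smul_zero, smul_zero]
      refine (Finset.sum_eq_zero fun α _ => ?_).symm
      split_ifs with hα
      · refine Finset.prod_eq_zero (Finset.mem_univ i) ?_
        rw [contraction, if_neg]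
        dsimp only
        omega
      · rfl
  · rw [if_neg hk', map_zero, smul_zero, smul_zero, map_zero]
    push Not at hk'
    obtain ⟨j, hj⟩ := hk'
    refine (Finset.sum_eq_zero fun α _ => ?_).symm
    split_ifs with hα
    · obtain ⟨i, rfl⟩ := hα.2 j
      refine Finset.prod_eq_zero (Finset.mem_univ i) ?_
      rw [contraction, if_neg]
      dsimp only
      omega
    · rfl

/-- The surviving pairs of modes are `(k, -k)`, and the `p` derivatives kill those with `k < p`. The
rest is a negative binomial series in `z / t`. -/
lemma hasSum_contraction {t z : ℂ} (htz : ‖z‖ < ‖t‖) (p : ℕ) :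
    HasSum (contraction t z p) (1 / (t - z) ^ (p + 1)) := by
  have ht : t ≠ 0 := norm_pos_iff.mp ((norm_nonneg z).trans_lt htz)
  have hu : ‖z / t‖ < 1 := by
    rw [norm_div]
    exact (div_lt_one (norm_pos_iff.mpr ht)).mpr htz
  have htz' : t - z ≠ 0 := by
    rw [sub_ne_zero]
    rintro rfl
    exact lt_irrefl _ htz
  have h0 : HasSum (fun k : ℕ => ((k + p).choose p : ℂ) * (z / t) ^ k)
      (1 / (1 - z / t) ^ (p + 1)) := hasSum_choose_mul_geometric_of_norm_lt_one p hu
  have hinj : Function.Injective fun s : ℕ => (((s + p : ℕ) : ℤ), -((s + p : ℕ) : ℤ)) := by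
    intro s s' h
    have := (Prod.mk.inj h).1
    omega
  rw [← hinj.hasSum_iff]
  · refine hasSum_of_eq (h0.mul_left (1 / t ^ (p + 1))) (fun s => ?_) ?_
    · rw [Function.comp_apply, contraction, if_pos ⟨by positivity, rfl⟩]
      have h1 : (Ring.choose (- -((s + p : ℕ) : ℤ)) p : ℤ) = ((s + p).choose p : ℤ) := by
        rw [neg_neg, Ring.choose_natCast]
      have h2 : z ^ (- -((s + p : ℕ) : ℤ) - p) = z ^ s := by
        rw [← zpow_natCast]; congr 1; push_cast; ring
      have h3 : t ^ (-((s + p : ℕ) : ℤ) - 1) = (t ^ (s + (p + 1)))⁻¹ := by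
        rw [← zpow_natCast, ← zpow_neg]; congr 1; push_cast; ring
      dsimp only
      rw [h1, h2, h3, pow_add, div_pow]
      push_cast
      field_simp
    · rw [show 1 - z / t = (t - z) / t by field_simp, div_pow]
      field_simp
  · rintro ⟨k, k'⟩ hk
    rw [contraction]
    split_ifs with h1
    · obtain ⟨h1, h2⟩ := h1
      dsimp only at h1 h2 ⊢
      subst h2
      lift k to ℕ using h1
      have h3 : k < p := by
        by_contra h3
        exact hk ⟨k - p, by dsimp only; rw [Nat.sub_add_cancel (by omega)]⟩
      rw [neg_neg, Ring.choose_natCast, Nat.choose_eq_zero_of_lt h3]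
      simp
    · rfl

lemma hasSum_prod_fin {X : Type*} {m : ℕ} (G : Fin m → X → ℂ) (a : Fin m → ℂ)
    (hG : ∀ i, HasSum (G i) (a i)) :
    HasSum (fun k : Fin m → X => ∏ i, G i (k i)) (∏ i, a i) := by
  induction m with
  | zero =>
    have := hasSum_unique (fun k : Fin 0 → X => ∏ i, G i (k i))
    simpa using this
  | succ m ih =>
    have h1 := ih (fun i => G i.succ) (fun i => a i.succ) fun i => hG i.succ
    have hs0 : Summable fun x => ‖G 0 x‖ := (hG 0).summable.norm
    have hs1 : Summable fun k : Fin m → X => ‖∏ i, G i.succ (k i)‖ := h1.summable.norm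
    have h3 : Summable fun x : X × (Fin m → X) => G 0 x.1 * ∏ i, G i.succ (x.2 i) :=
      by apply summable_mul_of_summable_norm hs0 hs1
    have h2 : HasSum (fun x : X × (Fin m → X) => G 0 x.1 * ∏ i, G i.succ (x.2 i))
      (a 0 * ∏ i : Fin m, a i.succ) := by
      apply HasSum.mul (hG 0) h1 h3
    rw [← (Fin.consEquiv fun _ => X).hasSum_iff]
    refine hasSum_of_eq h2 (fun k => ?_) (by rw [Fin.prod_univ_succ])
    rw [Function.comp_apply, Fin.prod_univ_succ]
    rfl

lemma hasVev_ofFn {M : ℕ} (F : Fin M → ℤ → Module.End ℂ Fock) (c : ℂ) :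
    HasVev (List.ofFn F) c ↔ HasSum (fun k : Fin M → ℤ =>
      MvPolynomial.constantCoeff ((List.ofFn fun i => F i (k i)).prod (1 : Fock))) c := by
  rw [HasVev, ← ((finCongr (List.length_ofFn (f := F)).symm).arrowCongr (Equiv.refl ℤ)).hasSum_iff]
  have : ((fun k : Fin (List.ofFn F).length → ℤ => MvPolynomial.constantCoeff
      ((List.ofFn fun i => (List.ofFn F).get i (k i)).prod (1 : Fock))) ∘
        ((finCongr (List.length_ofFn (f := F)).symm).arrowCongr (Equiv.refl ℤ))) =
      fun k : Fin M → ℤ =>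
        MvPolynomial.constantCoeff ((List.ofFn fun i => F i (k i)).prod (1 : Fock)) := by
    funext k
    rw [Function.comp_apply]
    congr 3
    refine List.ext_get (by simp) fun i h1 h2 => ?_
    simp
  rw [this]

open Classical in
/-- The vacuum expectation value of a product of fields `β(t)` and `∂ ^ p γ(z) / p!`. -/
lemma hasVev_beta_gamma {m N : ℕ} (t : Fin m → ℂ) (p : Fin N → ℕ) (z : Fin N → ℂ)
    (htz : ∀ i j, ‖z j‖ < ‖t i‖) :
    HasVev ((List.ofFn fun i => betaField (t i)) ++ List.ofFn fun j => gammaField (p j) (z j))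
      (∑ α : Fin m → Fin N, if Function.Bijective α then
        ∏ i, 1 / (t i - z (α i)) ^ (p (α i) + 1) else 0) := by
  rw [← List.ofFn_fin_append, hasVev_ofFn, ← (Fin.appendEquiv m N).hasSum_iff]
  have h1 : HasSum (fun k : (Fin m → ℤ) × (Fin N → ℤ) => ∑ α : Fin m → Fin N,
      if Function.Bijective α then
        ∏ i, contraction (t i) (z (α i)) (p (α i)) (k.1 i, k.2 (α i)) else 0)
      (∑ α : Fin m → Fin N, if Function.Bijective α then
        ∏ i, 1 / (t i - z (α i)) ^ (p (α i) + 1) else 0) := by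
    refine hasSum_sum fun α _ => ?_
    split_ifs with hα
    · have h2 := hasSum_prod_fin _ _ fun i => hasSum_contraction (htz i (α i)) (p (α i))
      -- For a fixed bijection the modes are regrouped into contracted pairs, over which the
      -- multiple series is a product of single ones.
      let E : (Fin m → ℤ × ℤ) ≃ (Fin m → ℤ) × (Fin N → ℤ) :=
        (Equiv.arrowProdEquivProdArrow (Fin m) (fun _ => ℤ) (fun _ => ℤ)).trans
          (Equiv.prodCongr (Equiv.refl _) ((Equiv.ofBijective α hα).arrowCongr (Equiv.refl ℤ)))
      rw [← E.hasSum_iff]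
      refine hasSum_of_eq h2 (fun k => ?_) rfl
      rw [Function.comp_apply]
      refine Finset.prod_congr rfl fun i _ => ?_
      congr 1
      have : (E k).2 (α i) = (k i).2 := by
        change (k ((Equiv.ofBijective α hα).symm (α i))).2 = _
        rw [Equiv.ofBijective_symm_apply_apply]
      rw [this]
      rfl
    · exact hasSum_zero
  refine hasSum_of_eq h1 (fun k => ?_) rfl
  rw [← vev_modes, Function.comp_apply, ← List.ofFn_fin_append]
  congr 4
  funext i
  refine Fin.addCases (fun i => ?_) (fun j => ?_) i
  · simp [Fin.appendEquiv]
  · simp [Fin.appendEquiv]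

end BetaGamma

/-! ### The correlation function of the `βγ` system as a sum over partitions -/

section Correlation

variable {m n : ℕ} {r : Fin n → ℕ}

/-- The contraction of `β(t_i)` and `∂ ^ p γ(z_a) / p!`. -/
def kernel (t : Fin m → ℂ) (z : Fin n → ℂ) (i : Fin m) (s : Σ a : Fin n, Fin (r a + 1)) : ℂ :=
  1 / (t i - z s.1) ^ ((s.2 : ℕ) + 1)

/-- The derivation which replaces one of the fields `γ` with its contraction with `β(t_i)`. -/
def betaDer (r : Fin n → ℕ) (t : Fin m → ℂ) (z : Fin n → ℂ) (i : Fin m) :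
    Derivation ℂ (FPoly r) (FPoly r) :=
  MvPolynomial.mkDerivation ℂ fun s => MvPolynomial.C (kernel t z i s)

lemma betaDer_X (t : Fin m → ℂ) (z : Fin n → ℂ) (i : Fin m) (s : Σ a : Fin n, Fin (r a + 1)) :
    betaDer r t z i (MvPolynomial.X s) = MvPolynomial.C (kernel t z i s) :=
  MvPolynomial.mkDerivation_X _ _ _

lemma betaDer_commute (t : Fin m → ℂ) (z : Fin n → ℂ) (i j : Fin m) :
    Commute (betaDer r t z i : FPoly r →ₗ[ℂ] FPoly r) (betaDer r t z j) := by
  have h1 : ⁅betaDer r t z i, betaDer r t z j⁆ = 0 := by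
    refine MvPolynomial.derivation_ext fun s => ?_
    rw [Derivation.commutator_apply, betaDer_X, betaDer_X, MvPolynomial.derivation_C,
      MvPolynomial.derivation_C, sub_zero]
    rfl
  refine LinearMap.ext fun P => ?_
  have h2 := congrArg (fun δ : Derivation ℂ (FPoly r) (FPoly r) => δ P) h1
  simp only [Derivation.commutator_apply] at h2
  exact sub_eq_zero.mp h2

/-- The functions `ω` in terms of derivations. -/
def bgCorrelation (P : ∀ a, MvPolynomial (Fin (r a + 1)) ℂ) (t : Fin m → ℂ) (z : Fin n → ℂ) : ℂ :=
  MvPolynomial.constantCoeff (((List.finRange m).map fun i =>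
    (betaDer r t z i : FPoly r →ₗ[ℂ] FPoly r)).prod (∏ a, MvPolynomial.rename (Sigma.mk a) (P a)))

/-- The derivations attached to the points `t_i` commute, so their order is irrelevant. -/
lemma bgCorrelation_perm (P : ∀ a, MvPolynomial (Fin (r a + 1)) ℂ) (t : Fin m → ℂ) (z : Fin n → ℂ)
    (σ : Equiv.Perm (Fin m)) : bgCorrelation P (t ∘ σ) z = bgCorrelation P t z := by
  have h1 : (List.finRange m).map (fun i => (betaDer r (t ∘ σ) z i : FPoly r →ₗ[ℂ] FPoly r)) =
      ((List.finRange m).map σ).map fun i => (betaDer r t z i : FPoly r →ₗ[ℂ] FPoly r) := by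
    rw [List.map_map]
    rfl
  rw [bgCorrelation, bgCorrelation, h1]
  refine congrArg (fun T : Module.End ℂ (FPoly r) => MvPolynomial.constantCoeff
    (T (∏ a, MvPolynomial.rename (Sigma.mk a) (P a)))) ?_
  refine List.Perm.prod_eq' (List.Perm.map _ ?_) ?_
  · refine (List.perm_ext_iff_of_nodup ((List.nodup_finRange m).map σ.injective)
      (List.nodup_finRange m)).mpr fun i => ?_
    simp only [List.mem_finRange, iff_true, List.mem_map, true_and]
    exact ⟨σ.symm i, σ.apply_symm_apply i⟩
  · rw [List.pairwise_map]
    exact List.pairwise_of_forall fun i j => betaDer_commute t z i j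

/-! #### The expansion over partitions -/

/-- On the variables of a single site the derivation is the combination of the operators `S[p]`
whose coefficients are the contractions. -/
lemma betaDer_rename (t : Fin m → ℂ) (z : Fin n → ℂ) (i : Fin m) (a : Fin n)
    (Q : MvPolynomial (Fin (r a + 1)) ℂ) :
    betaDer r t z i (MvPolynomial.rename (Sigma.mk a) Q) = MvPolynomial.rename (Sigma.mk a)
      ((∑ p : Fin (r a + 1), kernel (r := r) t z i ⟨a, p⟩ • screen p) Q) := by
  have hT : ∀ Q : MvPolynomial (Fin (r a + 1)) ℂ,
      (∑ p : Fin (r a + 1), kernel (r := r) t z i ⟨a, p⟩ • screen p) Q =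
        ∑ p : Fin (r a + 1), kernel (r := r) t z i ⟨a, p⟩ • MvPolynomial.pderiv p Q := by
    intro Q
    rw [LinearMap.sum_apply]
    rfl
  rw [hT]
  induction Q using MvPolynomial.induction_on with
  | C c =>
    rw [MvPolynomial.rename_C, MvPolynomial.derivation_C, Finset.sum_eq_zero, map_zero]
    intro p _
    rw [MvPolynomial.derivation_C, smul_zero]
  | add P Q hP hQ =>
    rw [map_add, map_add, hP, hQ, ← map_add, ← Finset.sum_add_distrib]
    simp only [map_add, smul_add]
  | mul_X Q p hQ =>
    rw [map_mul, Derivation.leibniz, hQ, MvPolynomial.rename_X, betaDer_X, smul_eq_mul, smul_eq_mul]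
    have h1 : ∑ q : Fin (r a + 1), kernel (r := r) t z i ⟨a, q⟩ •
        MvPolynomial.pderiv q (Q * MvPolynomial.X p) =
        Q * MvPolynomial.C (kernel (r := r) t z i ⟨a, p⟩) + MvPolynomial.X p *
          ∑ q : Fin (r a + 1), kernel (r := r) t z i ⟨a, q⟩ • MvPolynomial.pderiv q Q := by
      simp only [Derivation.leibniz, smul_add, Finset.sum_add_distrib, smul_eq_mul]
      congr 1
      · rw [Finset.sum_eq_single p]
        · rw [MvPolynomial.pderiv_X_self, mul_one, MvPolynomial.smul_eq_C_mul, mul_comm]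
        · intro q _ hq
          rw [MvPolynomial.pderiv_X_of_ne hq.symm, mul_zero, smul_zero]
        · simp
      · rw [Finset.mul_sum]
        exact Finset.sum_congr rfl fun q _ => (mul_smul_comm _ _ _).symm
    rw [h1, map_add, map_mul, map_mul, MvPolynomial.rename_C, MvPolynomial.rename_X]

lemma prod_betaDer_rename (t : Fin m → ℂ) (z : Fin n → ℂ) (l : List (Fin m)) (a : Fin n)
    (Q : MvPolynomial (Fin (r a + 1)) ℂ) :
    (l.map fun i => (betaDer r t z i : FPoly r →ₗ[ℂ] FPoly r)).prod
        (MvPolynomial.rename (Sigma.mk a) Q) = MvPolynomial.rename (Sigma.mk a)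
      ((l.map fun i => ∑ p : Fin (r a + 1), kernel (r := r) t z i ⟨a, p⟩ • screen p).prod Q) := by
  induction l with
  | nil => simp
  | cons i l ih =>
    rw [List.map_cons, List.prod_cons, Module.End.mul_apply, ih, Derivation.coeFn_coe,
      betaDer_rename, List.map_cons, List.prod_cons, Module.End.mul_apply]

lemma prod_ofFn_sum_smul {ι M : Type*} [Fintype ι] [AddCommGroup M] [Module ℂ M] {k : ℕ}
    (g : Fin k → ι → ℂ) (T : ι → Module.End ℂ M) :
    (List.ofFn fun j => ∑ p, g j p • T p).prod =
      ∑ p : Fin k → ι, (∏ j, g j (p j)) • ((List.ofFn p).map T).prod := by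
  induction k with
  | zero => simp
  | succ k ih =>
    rw [List.ofFn_succ, List.prod_cons, ih fun j => g j.succ,
      ← (Fin.consEquiv fun _ => ι).sum_comp, Fintype.sum_prod_type, Finset.sum_mul_sum]
    refine Finset.sum_congr rfl fun q _ => Finset.sum_congr rfl fun p _ => ?_
    rw [smul_mul_smul_comm, Fin.prod_univ_succ, List.ofFn_succ, List.map_cons, List.prod_cons]
    rfl

lemma ofFn_orderEmbOfFin (I : Finset (Fin m)) : List.ofFn (I.orderEmbOfFin rfl) = I.sort := by
  refine List.ext_getElem (by simp) fun i h1 h2 => ?_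
  rw [List.getElem_ofFn, Finset.orderEmbOfFin_apply]
  rfl

lemma sort_fiber (α : Fin m → Fin n) (a : Fin n) :
    (Finset.univ.filter fun i => α i = a).sort = fiberList α a := by
  refine List.Perm.eq_of_pairwise' (r := (· ≤ ·)) (Finset.pairwise_sort _ _)
    ((List.pairwise_le_finRange m).filter _) ?_
  refine (List.perm_ext_iff_of_nodup (Finset.sort_nodup _ _) (fiberList_nodup α a)).mpr fun i => ?_
  rw [Finset.mem_sort, mem_fiberList]
  simp

lemma constantCoeff_prod_betaDer (t : Fin m → ℂ) (z : Fin n → ℂ) (α : Fin m → Fin n) (a : Fin n)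
    (Q : MvPolynomial (Fin (r a + 1)) ℂ) :
    MvPolynomial.constantCoeff (((fiberList α a).map fun i =>
      (betaDer r t z i : FPoly r →ₗ[ℂ] FPoly r)).prod (MvPolynomial.rename (Sigma.mk a) Q)) =
      partTerm Q t (z a) (Finset.univ.filter fun i => α i = a) := by
  rw [prod_betaDer_rename, MvPolynomial.constantCoeff_rename, ← sort_fiber, ← ofFn_orderEmbOfFin,
    List.map_ofFn, partTerm]
  have := prod_ofFn_sum_smul (fun (j : Fin (Finset.univ.filter fun i => α i = a).card) p =>
    kernel (r := r) t z ((Finset.univ.filter fun i => α i = a).orderEmbOfFin rfl j) ⟨a, p⟩)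
    (screen (r := r a))
  rw [show ((fun i => ∑ p : Fin (r a + 1), kernel (r := r) t z i ⟨a, p⟩ • screen p) ∘
    (Finset.univ.filter fun i => α i = a).orderEmbOfFin rfl) = fun j => ∑ p : Fin (r a + 1),
    kernel (r := r) t z ((Finset.univ.filter fun i => α i = a).orderEmbOfFin rfl j) ⟨a, p⟩ •
      screen p from rfl, this, LinearMap.sum_apply, map_sum]
  refine Finset.sum_congr rfl fun p _ => ?_
  rw [LinearMap.smul_apply, MvPolynomial.constantCoeff_smul, screenWord, smul_eq_mul, mul_comm,
    div_eq_mul_inv, ← Finset.prod_inv_distrib]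
  simp only [kernel, one_div]

/-- The Leibniz rule yields a sum over maps from the indices `i` to the sites `a`; the fibres of
such a map are the sets `I_a`, and every admissible sequence of sets arises from exactly one map. -/
theorem bgCorrelation_eq_partitionSum (P : ∀ a, MvPolynomial (Fin (r a + 1)) ℂ) (t : Fin m → ℂ)
    (z : Fin n → ℂ) : bgCorrelation P t z = partitionSum P t z := by
  rw [bgCorrelation, prod_derivation_apply_prod, map_sum, partitionSum]
  simp only [map_prod, constantCoeff_prod_betaDer]
  refine Finset.sum_nbij (fun α a => Finset.univ.filter fun i => α i = a) (fun α _ => ?_)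
    (fun α _ β _ h => ?_) (fun I hI => ?_) (fun α _ => rfl)
  · simp only [partitions, Finset.mem_filter, Finset.mem_univ, true_and]
    refine ⟨fun a b hab => ?_, ?_⟩
    · rw [Finset.disjoint_left]
      intro i hi hi'
      simp only [Finset.mem_filter, Finset.mem_univ, true_and] at hi hi'
      exact hab (hi.symm.trans hi')
    · ext i
      simp
  · funext i
    have := congrFun h (β i)
    have h2 : i ∈ Finset.univ.filter fun k => β k = β i := by simp
    dsimp only at this
    rw [← this] at h2
    simpa using h2
  · simp only [partitions, Finset.coe_filter, Finset.mem_univ, true_and, Set.mem_ofPred_eq] at hI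
    have h1 : ∀ i, ∃ a, i ∈ I a := by
      intro i
      have : i ∈ Finset.univ.biUnion I := by rw [hI.2]; exact Finset.mem_univ i
      simpa using this
    choose α hα using h1
    refine ⟨α, by simp, ?_⟩
    funext a
    ext i
    simp only [Finset.mem_filter, Finset.mem_univ, true_and]
    constructor
    · rintro rfl
      exact hα i
    · intro hi
      by_contra hne
      exact Finset.disjoint_left.mp (hI.1 _ _ hne) (hα i) hi

/-! #### The vacuum expectation values -/

/-- The factors of `∏ a, ∏ p, (∂ ^ p γ(z_a) / p!) ^ (d a p)`. -/
def gammaFactors (d : ∀ a, Fin (r a + 1) →₀ ℕ) : List (Σ a : Fin n, Fin (r a + 1)) :=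
  (List.ofFn fun a : Fin n => (List.ofFn fun p : Fin (r a + 1) =>
    List.replicate (d a p) (⟨a, p⟩ : Σ a : Fin n, Fin (r a + 1))).flatten).flatten

lemma bgFields_eq (w : Pts m n) (d : ∀ a, Fin (r a + 1) →₀ ℕ) :
    bgFields w d = (List.ofFn fun i : Fin m => betaField (w (Sum.inl i))) ++
      List.ofFn fun j : Fin (gammaFactors d).length =>
        gammaField ((gammaFactors d).get j).2 (w (Sum.inr ((gammaFactors d).get j).1)) := by
  have h1 : (List.ofFn fun j : Fin (gammaFactors d).length =>
        gammaField ((gammaFactors d).get j).2 (w (Sum.inr ((gammaFactors d).get j).1))) =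
      (gammaFactors d).map fun s => gammaField s.2 (w (Sum.inr s.1)) := by
    conv_rhs => rw [← List.ofFn_get (gammaFactors d), List.map_ofFn]
    rfl
  rw [h1, bgFields, gammaFactors]
  simp only [List.map_flatten, List.map_ofFn, Function.comp_def, List.map_replicate]

lemma prod_gammaFactors_X (d : ∀ a, Fin (r a + 1) →₀ ℕ) :
    ∏ j, (MvPolynomial.X ((gammaFactors d).get j) : FPoly r) =
      ∏ a, MvPolynomial.rename (Sigma.mk a) (MvPolynomial.monomial (d a) (1 : ℂ)) := by
  have h1 : ∏ j, (MvPolynomial.X ((gammaFactors d).get j) : FPoly r) =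
      ((gammaFactors d).map fun s => (MvPolynomial.X s : FPoly r)).prod := by
    conv_rhs => rw [← List.ofFn_get (gammaFactors d), List.map_ofFn, List.prod_ofFn]
    rfl
  rw [h1, gammaFactors]
  simp only [List.map_flatten, List.map_ofFn, Function.comp_def, List.map_replicate,
    List.prod_flatten, List.prod_ofFn, List.prod_replicate]
  refine Finset.prod_congr rfl fun a _ => ?_
  rw [MvPolynomial.monomial_eq, map_mul, MvPolynomial.rename_C, map_one, one_mul,
    Finsupp.prod_fintype _ _ (fun p => pow_zero _), map_prod]
  refine Finset.prod_congr rfl fun p _ => ?_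
  rw [map_pow, MvPolynomial.rename_X]

/-- Both sides are the same sum over bijections between the fields `β` and the fields `γ`: one by
the summation over modes, the other by `wick`. -/
lemma hasVev_bgFields (w : Pts m n) (hw : ∀ i a, ‖w (Sum.inr a)‖ < ‖w (Sum.inl i)‖)
    (d : ∀ a, Fin (r a + 1) →₀ ℕ) :
    HasVev (bgFields w d) (bgCorrelation (fun a => MvPolynomial.monomial (d a) 1)
      (fun i => w (Sum.inl i)) fun a => w (Sum.inr a)) := by
  rw [bgFields_eq, bgCorrelation, ← prod_gammaFactors_X,
    wick _ _ (betaDer_X (fun i => w (Sum.inl i)) fun a => w (Sum.inr a))]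
  exact hasVev_beta_gamma _ _ _ fun i j => hw i _

lemma bgCorrelation_eq_sum (P : ∀ a, MvPolynomial (Fin (r a + 1)) ℂ) (t : Fin m → ℂ)
    (z : Fin n → ℂ) : bgCorrelation P t z =
      ∑ d ∈ Fintype.piFinset (fun a => (P a).support), (∏ a, MvPolynomial.coeff (d a) (P a)) *
        bgCorrelation (fun a => MvPolynomial.monomial (d a) 1) t z := by
  have h1 : ∏ a, MvPolynomial.rename (Sigma.mk a) (P a) =
      ∑ d ∈ Fintype.piFinset (fun a => (P a).support), (∏ a, MvPolynomial.coeff (d a) (P a)) •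
        ∏ a, (MvPolynomial.rename (Sigma.mk a) (MvPolynomial.monomial (d a) 1) : FPoly r) := by
    have h2 : ∀ a, (MvPolynomial.rename (Sigma.mk a) (P a) : FPoly r) =
        ∑ d ∈ (P a).support, MvPolynomial.coeff d (P a) •
          MvPolynomial.rename (Sigma.mk a) (MvPolynomial.monomial d 1) := by
      intro a
      conv_lhs => rw [(P a).as_sum, map_sum]
      refine Finset.sum_congr rfl fun d _ => ?_
      rw [← map_smul, MvPolynomial.smul_monomial, smul_eq_mul, mul_one]
    rw [Finset.prod_congr rfl fun a _ => h2 a, Finset.prod_univ_sum]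
    refine Finset.sum_congr rfl fun d _ => ?_
    simp only [MvPolynomial.smul_eq_C_mul, Finset.prod_mul_distrib, map_prod]
  rw [bgCorrelation, h1, map_sum, map_sum]
  refine Finset.sum_congr rfl fun d _ => ?_
  rw [LinearMap.map_smul, MvPolynomial.constantCoeff_smul, smul_eq_mul, bgCorrelation]

lemma isRegular_partitionSum (P : ∀ a, MvPolynomial (Fin (r a + 1)) ℂ) :
    IsRegular fun w : Pts m n =>
      partitionSum P (fun i => w (Sum.inl i)) fun a => w (Sum.inr a) := by
  refine IsRegular.sum _ fun I _ => IsRegular.prod _ fun a _ => IsRegular.sum _ fun p _ => ?_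
  have h1 := (IsRegular.prod Finset.univ fun (j : Fin (I a).card) _ =>
    (IsRegular.inv_sub (m := m) (n := n) (j := Sum.inl ((I a).orderEmbOfFin rfl j))
      (k := Sum.inr a) Sum.inl_ne_inr).pow ((p j : ℕ) + 1)).const_mul
    (MvPolynomial.constantCoeff (screenWord (List.ofFn p) (P a)))
  simpa only [div_eq_mul_inv, ← Finset.prod_inv_distrib, inv_pow] using h1

/-- In the radial domain the sums of the mode expansions are unique and equal to the partition sum.
Both functions are regular, so agreement there extends to all pairwise distinct points. -/
theorem isBGCorrelation_iff (P : ∀ a, MvPolynomial (Fin (r a + 1)) ℂ) (ω : Pts m n → ℂ) :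
    IsBGCorrelation P ω ↔ ∀ (t : Fin m → ℂ) (z : Fin n → ℂ), Function.Injective (Sum.elim t z) →
      ω (Sum.elim t z) = partitionSum P t z := by
  have hvev : ∀ w : Pts m n, (∀ i a, ‖w (Sum.inr a)‖ < ‖w (Sum.inl i)‖) →
      ∀ c : (∀ a, Fin (r a + 1) →₀ ℕ) → ℂ, (∀ d, HasVev (bgFields w d) (c d)) →
      ∑ d ∈ Fintype.piFinset (fun a => (P a).support),
        (∏ a, MvPolynomial.coeff (d a) (P a)) * c d =
      partitionSum P (fun i => w (Sum.inl i)) fun a => w (Sum.inr a) := by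
    intro w hw c hc
    rw [← bgCorrelation_eq_partitionSum, bgCorrelation_eq_sum]
    refine Finset.sum_congr rfl fun d _ => ?_
    rw [(hc d).unique (hasVev_bgFields w hw d)]
  have helim : ∀ w : Pts m n, Sum.elim (fun i => w (Sum.inl i)) (fun a => w (Sum.inr a)) = w :=
    fun w => Sum.elim_comp_inl_inr w
  constructor
  · rintro ⟨hreg, h⟩ t z hinj
    exact hreg.eq_of_radial (isRegular_partitionSum P) (fun w hw hr => by
      obtain ⟨c, hc, hω⟩ := h w hw hr
      rw [hω, hvev w hr c hc]) (Sum.elim t z) hinj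
  · intro h
    have h1 : ∀ w : Pts m n, Function.Injective w →
        ω w = partitionSum P (fun i => w (Sum.inl i)) fun a => w (Sum.inr a) := by
      intro w hw
      rw [← h _ _ (by rwa [helim]), helim]
    refine ⟨(isRegular_partitionSum P).congr h1, fun w hw hr => ⟨_, hasVev_bgFields w hr, ?_⟩⟩
    rw [h1 w hw, hvev w hr _ (hasVev_bgFields w hr)]

/-- Each term of the average equals the partition sum itself, because the latter is a constant term
of a product of commuting derivations. -/
lemma partitionSum_symm (P : ∀ a, MvPolynomial (Fin (r a + 1)) ℂ) (t : Fin m → ℂ) (z : Fin n → ℂ) :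
    ((m.factorial : ℂ)⁻¹) * ∑ σ : Equiv.Perm (Fin m), partitionSum P (t ∘ σ) z =
      partitionSum P t z := by
  simp only [← bgCorrelation_eq_partitionSum, bgCorrelation_perm]
  rw [Finset.sum_const, Finset.card_univ, Fintype.card_perm, Fintype.card_fin, nsmul_eq_mul,
    inv_mul_cancel_left₀ (Nat.cast_ne_zero.mpr (Nat.factorial_ne_zero m))]

end Correlation

/-! ### Integrals over chains -/

namespace Chain

variable {m n : ℕ} {Γ : Chain m n} {Z : Set (Fin n → ℂ)}

lemma IsTwisted.integral_congr (hΓ : Γ.IsTwisted Z) {z : Fin n → ℂ} (hz : z ∈ Z)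
    {g g' : Pts m n → (Fin m ⊕ Fin n → Fin m ⊕ Fin n → ℂ) → ℂ}
    (hg : ∀ w l, Function.Injective w → g w l = g' w l) : Γ.integral z g = Γ.integral z g' := by
  refine Finset.sum_congr rfl fun i _ => ?_
  congr 1
  refine setIntegral_congr_fun (hΓ.measurable i) fun s hs => ?_
  simp only [integrand]
  rw [hg _ _ (hΓ.distinct i z hz s hs)]

lemma integral_sum_mul {z : Fin n → ℂ} {ι : Type*} (S : Finset ι) (a : ι → ℂ)
    (g : ι → Pts m n → (Fin m ⊕ Fin n → Fin m ⊕ Fin n → ℂ) → ℂ)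
    (hg : ∀ c ∈ S, Γ.Converges z (g c)) :
    Γ.integral z (fun w l => ∑ c ∈ S, a c * g c w l) = ∑ c ∈ S, a c * Γ.integral z (g c) := by
  simp only [integral, Finset.mul_sum]
  rw [Finset.sum_comm]
  refine Finset.sum_congr rfl fun i _ => ?_
  have h1 : ∀ s, Γ.integrand z (fun w l => ∑ c ∈ S, a c * g c w l) i s =
      ∑ c ∈ S, a c * Γ.integrand z (g c) i s := by
    intro s
    simp only [integrand, Finset.sum_mul, mul_assoc]
  simp only [h1]
  rw [integral_finsetSum S fun c hc => (hg c hc i).const_mul (a c), Finset.mul_sum]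
  refine Finset.sum_congr rfl fun c _ => ?_
  rw [integral_const_mul]
  ring

end Chain

/-! ### The integral of `Ψ ω` as a pairing -/

section Pairing

variable {m n : ℕ} {r : Fin n → ℕ} {lam : Weights r}
  {bra : ∀ a, Module.Dual ℂ (Verma (lam a))}
  {D : ∀ a, Verma (lam a) →ₗ[ℂ] Module.Dual ℂ (Verma (lam a))}

lemma dualVector_tprod (D : ∀ a, Verma (lam a) →ₗ[ℂ] Module.Dual ℂ (Verma (lam a)))
    (y v : ∀ a, Verma (lam a)) :
    dualVector D (PiTensorProduct.tprod ℂ y) (PiTensorProduct.tprod ℂ v) = ∏ a, D a (y a) (v a) := by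
  rw [dualVector, PiTensorProduct.map_tprod, PiTensorProduct.dualDistrib_apply]

/-- `dualVector` as a linear map. -/
def dualVectorL (D : ∀ a, Verma (lam a) →ₗ[ℂ] Module.Dual ℂ (Verma (lam a))) :
    TensorVerma lam →ₗ[ℂ] Module.Dual ℂ (TensorVerma lam) :=
  PiTensorProduct.dualDistrib ∘ₗ PiTensorProduct.map D

lemma dualVectorL_apply (D : ∀ a, Verma (lam a) →ₗ[ℂ] Module.Dual ℂ (Verma (lam a)))
    (y : TensorVerma lam) : dualVectorL D y = dualVector D y := rfl

/-- The adjointness of `f[p]` and `e[p]` under `D`, transported to one tensor factor; linearity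
reduces it to pure tensors. -/
lemma dualVector_siteOp_f (hD : ∀ a, IsDualMap (lam a) (bra a) (D a)) (a : Fin n)
    (p : Fin (r a + 1)) (y : TensorVerma lam) (v : ∀ a, Verma (lam a)) :
    dualVector D (siteOp lam a f p y) (PiTensorProduct.tprod ℂ v) =
      dualVector D y (PiTensorProduct.tprod ℂ
        (Function.update v a (act (lam a) (cur (r a) e p) (v a)))) := by
  have key : (LinearMap.applyₗ (PiTensorProduct.tprod ℂ v)) ∘ₗ dualVectorL D ∘ₗ siteOp lam a f p =
      (LinearMap.applyₗ (PiTensorProduct.tprod ℂ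
        (Function.update v a (act (lam a) (cur (r a) e p) (v a))))) ∘ₗ dualVectorL D := by
    refine PiTensorProduct.ext (MultilinearMap.ext fun y => ?_)
    change dualVector D (siteOp lam a f p (PiTensorProduct.tprod ℂ y)) (PiTensorProduct.tprod ℂ v) =
      dualVector D (PiTensorProduct.tprod ℂ y) (PiTensorProduct.tprod ℂ
        (Function.update v a (act (lam a) (cur (r a) e p) (v a))))
    rw [siteOp_tprod, dualVector_tprod, dualVector_tprod]
    refine Finset.prod_congr rfl fun b _ => ?_
    by_cases hb : b = a
    · subst hb
      rw [Function.update_self, Function.update_self, (hD b).map_f, LinearMap.comp_apply]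
    · rw [Function.update_of_ne hb, Function.update_of_ne hb]
  exact LinearMap.congr_fun key y

/-- The variable `s` occurs in the factor of its own site only, and there the derivative acts on the
vector by `e[p]`. -/
lemma pderiv_prod_rename (s : Σ a : Fin n, Fin (r a + 1)) (v : ∀ a, Verma (lam a)) :
    MvPolynomial.pderiv s (∏ a, MvPolynomial.rename (Sigma.mk a) (matZ (lam a) (bra a) (v a))) =
      ∏ a, MvPolynomial.rename (Sigma.mk a) (matZ (lam a) (bra a)
        (Function.update v s.1 (act (lam s.1) (cur (r s.1) e s.2) (v s.1)) a)) := by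
  obtain ⟨b, p⟩ := s
  rw [derivation_apply_prod, Finset.sum_eq_single b]
  · refine Finset.prod_congr rfl fun a _ => ?_
    split_ifs with hab
    · subst hab
      rw [Function.update_self, ← screen_matZ,
        MvPolynomial.pderiv_rename sigma_mk_injective]
      rfl
    · rw [Function.update_of_ne (fun h => hab h.symm)]
  · intro c _ hc
    refine Finset.prod_eq_zero (Finset.mem_univ c) ?_
    rw [if_pos rfl]
    refine MvPolynomial.pderiv_eq_zero_of_notMem_vars fun h => ?_
    obtain ⟨q, _, hq⟩ := Finset.mem_image.mp (MvPolynomial.vars_rename _ _ h)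
    exact hc (congrArg Sigma.fst hq)
  · simp

/-- The rightmost derivative acts first. It replaces `v_a` with `e[p] v_a`, which is matched by one
more factor `f[p]` in the vector to be dualized. Without derivatives both sides are `∏ ⟨λ|v_a⟩`. -/
lemma constantCoeff_prod_pderiv (hD : ∀ a, IsDualMap (lam a) (bra a) (D a)) (l : List (Σ a : Fin n, Fin (r a + 1)))
    (v : ∀ a, Verma (lam a)) :
    MvPolynomial.constantCoeff ((l.map fun s =>
      ((MvPolynomial.pderiv s : Derivation ℂ (FPoly r) (FPoly r)) : FPoly r →ₗ[ℂ] FPoly r)).prod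
        (∏ a, MvPolynomial.rename (Sigma.mk a) (matZ (lam a) (bra a) (v a)))) =
      dualVector D (toVermaL lam (l.map MvPolynomial.X).prod) (PiTensorProduct.tprod ℂ v) := by
  induction l using List.reverseRecOn generalizing v with
  | nil =>
    rw [List.map_nil, List.map_nil, List.prod_nil, List.prod_nil, Module.End.one_apply,
      toVermaL_one, vac, dualVector_tprod, map_prod]
    refine Finset.prod_congr rfl fun a _ => ?_
    rw [MvPolynomial.constantCoeff_rename, constantCoeff_matZ, (hD a).map_ket]
  | append_singleton l s ih =>
    rw [List.map_append, List.prod_append, Module.End.mul_apply, List.map_append, List.prod_append,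
      mul_comm, List.map_singleton, List.prod_singleton, List.map_singleton, List.prod_singleton,
      ← siteOp_f_toVermaL, dualVector_siteOp_f hD, ← ih, Derivation.coeFn_coe, pderiv_prod_rename]

lemma betaDer_eq_sum (t : Fin m → ℂ) (z : Fin n → ℂ) (i : Fin m) :
    (betaDer r t z i : FPoly r →ₗ[ℂ] FPoly r) = ∑ s, kernel t z i s •
      ((MvPolynomial.pderiv s : Derivation ℂ (FPoly r) (FPoly r)) : FPoly r →ₗ[ℂ] FPoly r) := by
  refine LinearMap.ext fun P => ?_
  have hR : ∀ Q : FPoly r, (∑ s, kernel t z i s • ((MvPolynomial.pderiv s :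
      Derivation ℂ (FPoly r) (FPoly r)) : FPoly r →ₗ[ℂ] FPoly r)) Q =
      ∑ s, kernel t z i s • MvPolynomial.pderiv s Q := fun Q => by
    rw [LinearMap.sum_apply]; rfl
  rw [Derivation.coeFn_coe, hR]
  induction P using MvPolynomial.induction_on with
  | C c => simp only [MvPolynomial.derivation_C, smul_zero, Finset.sum_const_zero]
  | add P Q hP hQ => simp only [map_add, hP, hQ, smul_add, Finset.sum_add_distrib]
  | mul_X Q s hQ =>
    simp only [Derivation.leibniz, hQ, betaDer_X, smul_add, Finset.sum_add_distrib]
    congr 1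
    · rw [Finset.sum_eq_single s]
      · rw [MvPolynomial.pderiv_X_self, smul_eq_mul, smul_eq_mul, mul_one,
          MvPolynomial.smul_eq_C_mul, mul_comm]
      · intro q _ hq
        rw [MvPolynomial.pderiv_X_of_ne hq.symm, smul_zero, smul_zero]
      · simp
    · rw [Finset.smul_sum]
      exact Finset.sum_congr rfl fun q _ => smul_comm _ _ _

/-- The identity to be integrated: `ω` is, pointwise, the pairing of `v` with the dual of `∏
f(t_j)|λ⟩`, expanded over the choices of a site and a mode for each `j`. -/
theorem bgCorrelation_matZ (hD : ∀ a, IsDualMap (lam a) (bra a) (D a)) (v : ∀ a, Verma (lam a)) (t : Fin m → ℂ)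
    (z : Fin n → ℂ) : bgCorrelation (fun a => matZ (lam a) (bra a) (v a)) t z =
      ∑ c : Fin m → Σ a : Fin n, Fin (r a + 1), dualVector D
        (toVermaL lam (∏ j, MvPolynomial.X (c j))) (PiTensorProduct.tprod ℂ v) *
          ∏ j, kernel t z j (c j) := by
  rw [bgCorrelation]
  simp only [betaDer_eq_sum]
  rw [← List.ofFn_eq_map, prod_ofFn_sum_smul, LinearMap.sum_apply, map_sum]
  refine Finset.sum_congr rfl fun c _ => ?_
  rw [LinearMap.smul_apply, MvPolynomial.constantCoeff_smul, constantCoeff_prod_pderiv hD,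
    smul_eq_mul, mul_comm, List.map_ofFn, List.prod_ofFn]
  rfl

theorem integral_psi_mul_eq_dualVector (κ : ℂ) (hD : ∀ a, IsDualMap (lam a) (bra a) (D a)) (v : ∀ a, Verma (lam a)) (ω : Pts m n → ℂ)
    (hω : IsBGCorrelation (fun a => matZ (lam a) (bra a) (v a)) ω) (z : Fin n → ℂ) (Γ : Chain m n)
    (hΓ : Γ.IsTwisted {z})
    (hconv : ∀ c : Fin m → (Σ a : Fin n, Fin (r a + 1)), Γ.Converges z (fun w l => psi κ lam w l *
      ∏ j, 1 / (w (Sum.inl j) - w (Sum.inr (c j).1)) ^ (((c j).2 : ℕ) + 1))) :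
    Γ.integral z (fun w l => psi κ lam w l * ω w) = dualVector D
      (toVerma lam (jnsIntegral κ Γ (z, lam))) (PiTensorProduct.tprod ℂ v) := by
  have h1 : Γ.integral z (fun w l => psi κ lam w l * ω w) = Γ.integral z (fun w l =>
      ∑ c : Fin m → Σ a : Fin n, Fin (r a + 1), dualVector D
        (toVermaL lam (∏ j, MvPolynomial.X (c j))) (PiTensorProduct.tprod ℂ v) *
          (psi κ lam w l *
            ∏ j, 1 / (w (Sum.inl j) - w (Sum.inr (c j).1)) ^ (((c j).2 : ℕ) + 1))) := by
    refine hΓ.integral_congr rfl fun w l hw => ?_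
    have helim : Sum.elim (fun i => w (Sum.inl i)) (fun a => w (Sum.inr a)) = w :=
      Sum.elim_comp_inl_inr w
    have h2 := (isBGCorrelation_iff _ ω).mp hω (fun i => w (Sum.inl i)) (fun a => w (Sum.inr a))
      (by rwa [helim])
    rw [helim, ← bgCorrelation_eq_partitionSum, bgCorrelation_matZ hD] at h2
    rw [h2, Finset.mul_sum]
    refine Finset.sum_congr rfl fun c _ => ?_
    simp only [kernel]
    ring
  rw [h1, Chain.integral_sum_mul _ _ _ fun c _ => hconv c, toVerma_eq, jnsIntegral, map_sum,
    ← dualVectorL_apply, map_sum, LinearMap.sum_apply]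
  refine Finset.sum_congr rfl fun c _ => ?_
  rw [← MvPolynomial.smul_eq_C_mul, map_smul, map_smul, LinearMap.smul_apply, smul_eq_mul, mul_comm,
    dualVectorL_apply]
  congr 1
  refine hΓ.integral_congr rfl fun w l hw => ?_
  rw [psi_eq_master κ lam hw]

end Pairing

/-! ### The logarithmic derivatives of `Ψ` -/

section Exponent

variable {m n : ℕ} {r : Fin n → ℕ}

/-- The derivative of the propagator in its first argument. -/
def propDeriv (p q : ℕ) (x : ℂ) : ℂ := (-1) ^ p * ((p + q).choose p : ℂ) / x ^ (p + q + 1)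

lemma propDeriv_swap (p q : ℕ) (x : ℂ) : propDeriv q p (-x) = -propDeriv p q x := by
  rw [propDeriv, propDeriv, add_comm q p, neg_pow x, ← Nat.choose_symm_add]
  have h1 : ((-1 : ℂ) ^ q) / (-1) ^ (p + q + 1) = -(-1) ^ p := by
    rw [div_eq_iff (pow_ne_zero _ (by norm_num)), neg_mul, ← pow_add,
      show p + (p + q + 1) = 2 * p + (q + 1) by ring, pow_add, pow_mul, pow_succ]
    simp [pow_succ]
  rw [mul_div_mul_comm, h1]
  ring

lemma propValue_swap (l x : ℂ) (p q : ℕ) : propValue l (-x) q p = propValue l x p q := by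
  rw [propValue, propValue, add_comm q p, neg_pow x, ← Nat.choose_symm_add]
  split_ifs with h
  · rfl
  have h1 : ((-1 : ℂ) ^ (q + 1)) / (-1) ^ (p + q) = (-1) ^ (p + 1) := by
    rw [div_eq_iff (pow_ne_zero _ (by norm_num)), ← pow_add,
      show p + 1 + (p + q) = 2 * p + (q + 1) by ring, pow_add _ (2 * p), pow_mul]
    simp
  rw [← h1]
  field_simp

/-- This identity makes the vector fields `∑ p λ_{p+k} ∂/∂λ_p` behave like derivatives in `z_a`: the
factor `p` turns the propagator of order `p` into a derivative of that of order `p - 1`. -/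
lemma mul_propValue (l x : ℂ) (p q : ℕ) :
    ((p + 1 : ℕ) : ℂ) * propValue l x (p + 1) q = propDeriv p q x := by
  rw [propValue, if_neg (by omega), propDeriv, show p + 1 + q = p + q + 1 by ring]
  have h1 : ((p + q + 1 : ℕ) : ℂ) * ((p + q).choose p : ℂ) =
      ((p + q + 1).choose (p + 1) : ℂ) * ((p + 1 : ℕ) : ℂ) := by
    exact_mod_cast Nat.add_one_mul_choose_eq (p + q) p
  have h2 : ((p + q + 1 : ℕ) : ℂ) ≠ 0 := Nat.cast_ne_zero.mpr (Nat.succ_ne_zero _)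
  have h3 : ((-1 : ℂ)) ^ (p + 1 + 1) = (-1) ^ p := by rw [pow_succ, pow_succ]; ring
  rw [h3]
  have h4 : ((p + q).choose p : ℂ) =
      ((p + q + 1).choose (p + 1) : ℂ) * ((p + 1 : ℕ) : ℂ) / ((p + q + 1 : ℕ) : ℂ) := by
    rw [eq_div_iff h2, ← h1, mul_comm]
  rw [h4]
  ring

lemma hasDerivAt_propValue {l x : ℂ → ℂ} {x' s : ℂ} (hx : HasDerivAt x x' s) (hx0 : x s ≠ 0)
    (hl : HasDerivAt l (x' / x s) s) (p q : ℕ) :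
    HasDerivAt (fun s => propValue (l s) (x s) p q) (x' * propDeriv p q (x s)) s := by
  by_cases hpq : p + q = 0
  · obtain ⟨rfl, rfl⟩ : p = 0 ∧ q = 0 := by omega
    simp only [propValue, if_true, add_zero]
    refine hl.congr_deriv ?_
    simp [propDeriv, div_eq_mul_inv]
  · obtain ⟨k, hk⟩ := Nat.exists_eq_succ_of_ne_zero hpq
    simp only [propValue, if_neg hpq]
    have h1 := ((hx.pow (p + q)).inv (pow_ne_zero _ hx0)).const_mul
      ((-1) ^ (p + 1) * ((p + q).choose p : ℂ) / (p + q : ℕ))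
    have h2 : ((p + q : ℕ) : ℂ) ≠ 0 := Nat.cast_ne_zero.mpr hpq
    refine (h1.congr_deriv ?_).congr_of_eventuallyEq
      (Filter.Eventually.of_forall fun y => by simp [div_eq_mul_inv])
    rw [propDeriv]
    simp only [Pi.pow_apply]
    rw [hk] at h2 ⊢
    rw [Nat.succ_sub_one]
    simp only [Nat.succ_eq_add_one] at h2 ⊢
    field_simp
    ring

/-- The derivative of the charges when the weights vary with velocity `lam'`. -/
def chargeDeriv (lam' : Weights r) : Fin m ⊕ Fin n → ℕ → ℂ
  | Sum.inl _, _ => 0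
  | Sum.inr a, p => ext0 (lam' a) p / 2

lemma hasDerivAt_charge {lam : ℂ → Weights r} {lam' : Weights r} {s : ℂ}
    (hlam : ∀ a p, HasDerivAt (fun s => lam s a p) (lam' a p) s) (j : Fin m ⊕ Fin n) (p : ℕ) :
    HasDerivAt (fun s => charge (lam s) j p) (chargeDeriv lam' j p) s := by
  rcases j with j | a
  · exact hasDerivAt_const _ _
  · simp only [charge_inr, chargeDeriv, ext0]
    split_ifs with hp
    · exact (hlam a ⟨p, hp⟩).div_const 2
    · simpa using hasDerivAt_const s (0 : ℂ)

open Classical in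
/-- The derivative of `psiExponent`, when the weights vary with velocity `lam'` and the points with
velocity `w'`. -/
def exponentDeriv (κ : ℂ) (lam lam' : Weights r) (w w' : Pts m n)
    (l : Fin m ⊕ Fin n → Fin m ⊕ Fin n → ℂ) : ℂ :=
  ∑ j : Fin m ⊕ Fin n, ∑ k : Fin m ⊕ Fin n, if toLex j < toLex k then
    ∑ p ∈ Finset.range (order r j + 1), ∑ q ∈ Finset.range (order r k + 1),
      ((form (chargeDeriv lam' j p) (charge lam k q) + form (charge lam j p) (chargeDeriv lam' k q)) / κ *
        propValue (l j k) (w j - w k) p q +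
      form (charge lam j p) (charge lam k q) / κ * ((w' j - w' k) * propDeriv p q (w j - w k))) else 0

lemma hasDerivAt_psiExponent (κ : ℂ) {lam : ℂ → Weights r} {lam' : Weights r} {w : ℂ → Pts m n}
    {w' : Pts m n} {l : ℂ → Fin m ⊕ Fin n → Fin m ⊕ Fin n → ℂ} {s : ℂ}
    (hlam : ∀ a p, HasDerivAt (fun s => lam s a p) (lam' a p) s)
    (hw : ∀ j, HasDerivAt (fun s => w s j) (w' j) s) (hinj : Function.Injective (w s))
    (hl : ∀ j k, toLex j < toLex k →
      HasDerivAt (fun s => l s j k) ((w' j - w' k) / (w s j - w s k)) s) :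
    HasDerivAt (fun s => psiExponent κ (lam s) (w s) (l s))
      (exponentDeriv κ (lam s) lam' (w s) w' (l s)) s := by
  rw [exponentDeriv]
  simp only [psiExponent]
  refine HasDerivAt.fun_sum fun j _ => HasDerivAt.fun_sum fun k _ => ?_
  split_ifs with hjk
  · refine HasDerivAt.fun_sum fun p _ => HasDerivAt.fun_sum fun q _ => ?_
    have hne : w s j - w s k ≠ 0 :=
      sub_ne_zero.mpr (hinj.ne fun h => hjk.ne (congrArg toLex h))
    have h1 := hasDerivAt_propValue ((hw j).sub (hw k)) hne (hl j k hjk) p q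
    have h2 := (((hasDerivAt_charge hlam j p).const_mul 2).mul (hasDerivAt_charge hlam k q)).div_const κ
    refine ((h2.mul h1).congr_deriv ?_)
    simp only [form]
    rfl
  · exact hasDerivAt_const _ _

open Classical in
-- Each pair containing `v` is counted once, in one of the two orders; as `A` and `B` agree, the
-- order does not matter.
lemma sum_sum_lt_eq {J : Type*} [Fintype J] [LinearOrder J] (v : J) (A B : J → ℂ)
    (hAB : ∀ k, k ≠ v → A k = B k) :
    ∑ j : J, ∑ k : J, (if j < k then (if j = v then A k else 0) + (if k = v then B j else 0) else 0) =
      ∑ k ∈ Finset.univ.erase v, A k := by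
  have h1 : ∀ j k : J,
      (if j < k then (if j = v then A k else 0) + (if k = v then B j else 0) else 0) =
      (if j = v then (if v < k then A k else 0) else 0) +
        if k = v then (if j < v then B j else 0) else 0 := by
    intro j k
    by_cases hj : j = v <;> by_cases hk : k = v
    · subst hj; subst hk; simp
    · subst hj; simp [hk]
    · subst hk; simp [hj]
    · simp [hj, hk]
  simp only [h1, Finset.sum_add_distrib]
  rw [Finset.sum_comm]
  simp only [Finset.sum_ite_eq', Finset.mem_univ, if_true]
  rw [← Finset.sum_add_distrib, ← Finset.add_sum_erase _ _ (Finset.mem_univ v)]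
  simp only [lt_irrefl, if_false, zero_add]
  refine Finset.sum_congr rfl fun k hk => ?_
  have hk := Finset.ne_of_mem_erase hk
  rcases lt_or_gt_of_ne hk with h | h
  · simp [h, h.not_gt, hAB k hk]
  · simp [h, h.not_gt]

/-- The sum over the other points which appears in the logarithmic derivatives of `Ψ` at the point
with the number `v`. -/
def logDeriv (lam : Weights r) (w : Pts m n) (v : Fin m ⊕ Fin n) (K : ℕ) : ℂ :=
  ∑ k ∈ Finset.univ.erase v, ∑ p ∈ Finset.Icc K (order r v), ∑ q ∈ Finset.range (order r k + 1),
    form (charge lam v p) (charge lam k q) * propDeriv (p - K) q (w v - w k)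

lemma form_comm (c d : ℂ) : form c d = form d c := by simp only [form]; ring

lemma chargeDeriv_zero (j : Fin m ⊕ Fin n) (p : ℕ) : chargeDeriv (0 : Weights r) j p = 0 := by
  rcases j with j | a
  · rfl
  · simp [chargeDeriv, ext0]

lemma sum_lex_eq (v : Fin m ⊕ Fin n) (A B : Fin m ⊕ Fin n → ℂ) (hAB : ∀ k, k ≠ v → A k = B k)
    (F : Fin m ⊕ Fin n → Fin m ⊕ Fin n → ℂ)
    (hF : ∀ j k, j ≠ k → F j k = (if j = v then A k else 0) + (if k = v then B j else 0)) :
    (open Classical in ∑ j : Fin m ⊕ Fin n, ∑ k : Fin m ⊕ Fin n, if toLex j < toLex k then F j k else 0) =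
      ∑ k ∈ Finset.univ.erase v, A k := by
  classical
  have h1 := sum_sum_lt_eq (J := Fin m ⊕ₗ Fin n) (toLex v) (fun k => A (ofLex k)) (fun k => B (ofLex k))
    (fun k hk => hAB _ hk)
  refine Eq.trans ?_ (h1.trans ?_)
  · refine Finset.sum_congr rfl fun j _ => Finset.sum_congr rfl fun k _ => ?_
    by_cases hjk : toLex j < toLex k
    · have h2 := hF j k (fun h => hjk.ne (congrArg toLex h))
      rw [if_pos hjk, h2]
      exact (if_pos hjk).symm
    · rw [if_neg hjk]
      exact (if_neg hjk).symm
  · refine Finset.sum_equiv ofLex (fun k => ?_) fun _ _ => rfl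
    rw [Finset.mem_erase, Finset.mem_erase]
    simp only [Finset.mem_univ, and_true]
    rfl

/-- Only the pairs that contain the moving point contribute; `propDeriv_swap` brings them all into
the form with this point first. -/
lemma exponentDeriv_points (κ : ℂ) (lam : Weights r) (w : Pts m n) (v : Fin m ⊕ Fin n)
    (l : Fin m ⊕ Fin n → Fin m ⊕ Fin n → ℂ) :
    exponentDeriv κ lam 0 w (Pi.single v 1) l = κ⁻¹ * logDeriv lam w v 0 := by
  rw [exponentDeriv, logDeriv, Finset.mul_sum]
  refine sum_lex_eq v _ (fun j => κ⁻¹ * ∑ p ∈ Finset.range (order r j + 1),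
    ∑ q ∈ Finset.range (order r v + 1), form (charge lam j p) (charge lam v q) *
      -propDeriv p q (w j - w v)) ?_ _ ?_
  · intro k hk
    congr 1
    rw [Finset.sum_comm]
    refine Finset.sum_congr rfl fun q _ => ?_
    rw [← Nat.range_succ_eq_Icc_zero]
    refine Finset.sum_congr rfl fun p _ => ?_
    rw [form_comm, Nat.sub_zero, ← propDeriv_swap, neg_sub]
  · intro j k hjk
    simp only [chargeDeriv_zero]
    by_cases hj : j = v
    · subst hj
      rw [if_pos rfl, if_neg hjk.symm, add_zero, ← Nat.range_succ_eq_Icc_zero, Finset.mul_sum]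
      refine Finset.sum_congr rfl fun p _ => ?_
      rw [Finset.mul_sum]
      refine Finset.sum_congr rfl fun q _ => ?_
      rw [Pi.single_eq_same, Pi.single_eq_of_ne hjk.symm, Nat.sub_zero]
      simp only [form]
      ring
    · rw [if_neg hj, zero_add, Pi.single_eq_of_ne hj]
      split_ifs with hk
      · subst hk
        rw [Finset.mul_sum]
        refine Finset.sum_congr rfl fun p _ => ?_
        rw [Finset.mul_sum]
        refine Finset.sum_congr rfl fun q _ => ?_
        rw [Pi.single_eq_same]
        simp only [form]
        ring
      · rw [Pi.single_eq_of_ne hk]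
        simp [form]

lemma chargeDeriv_update (a : Fin n) (c : Fin (r a + 1) → ℂ)
    (j : Fin m ⊕ Fin n) (hj : j ≠ Sum.inr a) (p : ℕ) :
    chargeDeriv (Function.update (0 : Weights r) a c) j p = 0 := by
  rcases j with j | b
  · rfl
  · have : b ≠ a := fun h => hj (by rw [h])
    simp [chargeDeriv, ext0, Function.update_of_ne this]

/-- By `mul_propValue` the velocity `p λ_{p+K-1}` yields `λ_{K+p-1}` times a derivative of the
propagator of order `p - 1`. After reindexing this is the same sum as for a moving point, with the
orders lowered by `K`. -/
lemma exponentDeriv_weights (κ : ℂ) (lam : Weights r) (w : Pts m n) (a : Fin n) {K : ℕ} (hK : K ≠ 0)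
    (l : Fin m ⊕ Fin n → Fin m ⊕ Fin n → ℂ) :
    exponentDeriv κ lam (Function.update 0 a fun p => (p : ℕ) * ext0 (lam a) ((p : ℕ) + (K - 1))) w 0 l =
      κ⁻¹ * logDeriv lam w (Sum.inr a) K := by
  set lam' : Weights r := Function.update 0 a fun p => (p : ℕ) * ext0 (lam a) ((p : ℕ) + (K - 1))
    with hlam'
  set v : Fin m ⊕ Fin n := Sum.inr a with hv
  have hA : ∀ p, p < r a + 1 → chargeDeriv lam' v p = p * charge (m := m) lam v (p + (K - 1)) := by
    intro p hp
    rw [hv, chargeDeriv, charge_inr, hlam', Function.update_self, ext0, dif_pos hp]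
    ring
  have hsum : ∀ k, k ≠ v → ∀ l₀ : ℂ, ∑ p ∈ Finset.Icc K (order r v), ∑ q ∈ Finset.range (order r k + 1),
      form (charge lam v p) (charge lam k q) * propDeriv (p - K) q (w v - w k) =
      ∑ p ∈ Finset.range (order r v + 1), ∑ q ∈ Finset.range (order r k + 1),
        form (chargeDeriv lam' v p) (charge lam k q) * propValue l₀ (w v - w k) p q := by
    intro k hk l₀
    have hr : order (m := m) r v = r a := rfl
    rw [hr, Finset.sum_range_succ']
    -- The factor `p` in the velocity removes the order `p = 0`, and with it the only value of the
    -- propagator that depends on the branch of the logarithm.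
    have h0 : ∑ q ∈ Finset.range (order r k + 1),
        form (chargeDeriv lam' v 0) (charge lam k q) * propValue l₀ (w v - w k) 0 q = 0 := by
      rw [hA 0 (Nat.succ_pos _)]
      simp [form]
    rw [h0, add_zero]
    have h1 : Finset.Icc K (r a) = Finset.Ico K (r a + 1) := by ext; simp
    rw [h1, Finset.sum_Ico_eq_sum_range]
    have h2 : ∀ p ∈ Finset.range (r a), ∑ q ∈ Finset.range (order r k + 1),
        form (chargeDeriv lam' v (p + 1)) (charge lam k q) * propValue l₀ (w v - w k) (p + 1) q =
        ∑ q ∈ Finset.range (order r k + 1),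
          form (charge lam v (K + p)) (charge lam k q) * propDeriv (K + p - K) q (w v - w k) := by
      intro p hp
      rw [Finset.mem_range] at hp
      refine Finset.sum_congr rfl fun q _ => ?_
      rw [hA (p + 1) (by omega), show p + 1 + (K - 1) = K + p by omega, Nat.add_sub_cancel_left,
        ← mul_propValue l₀]
      simp only [form]
      ring
    rw [Finset.sum_congr rfl h2]
    refine Finset.sum_subset (by intro p; simp only [Finset.mem_range]; omega) fun p _ hp => ?_
    rw [Finset.mem_range] at hp
    refine Finset.sum_eq_zero fun q _ => ?_
    rw [hv, charge_inr, ext0, dif_neg (by omega)]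
    simp [form]
  rw [exponentDeriv, logDeriv, Finset.mul_sum]
  refine sum_lex_eq v _ (fun j => κ⁻¹ * ∑ p ∈ Finset.range (order r j + 1),
    ∑ q ∈ Finset.range (order r v + 1), form (charge lam j p) (chargeDeriv lam' v q) *
      propValue (l j v) (w j - w v) p q) ?_ _ ?_
  · intro k hk
    congr 1
    rw [hsum k hk (l k v), Finset.sum_comm]
    refine Finset.sum_congr rfl fun q _ => Finset.sum_congr rfl fun p _ => ?_
    rw [form_comm, ← propValue_swap, neg_sub]
  · intro j k hjk
    by_cases hj : j = v
    · subst hj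
      rw [if_pos rfl, if_neg hjk.symm, add_zero, hsum k hjk.symm (l _ k), Finset.mul_sum]
      refine Finset.sum_congr rfl fun p _ => ?_
      rw [Finset.mul_sum]
      refine Finset.sum_congr rfl fun q _ => ?_
      have h1 : chargeDeriv lam' k q = 0 := chargeDeriv_update a _ k hjk.symm q
      rw [h1]
      simp only [form, Pi.zero_apply]
      ring
    · have h1 : ∀ p, chargeDeriv lam' j p = 0 := chargeDeriv_update a _ j hj
      rw [if_neg hj, zero_add]
      simp only [h1]
      split_ifs with hk
      · subst hk
        rw [Finset.mul_sum]
        refine Finset.sum_congr rfl fun p _ => ?_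
        rw [Finset.mul_sum]
        refine Finset.sum_congr rfl fun q _ => ?_
        simp only [form, Pi.zero_apply]
        ring
      · have h2 : ∀ p, chargeDeriv lam' k p = 0 := chargeDeriv_update a _ k hk
        simp [h2, form]

lemma univ_erase_inr (a : Fin n) : (Finset.univ : Finset (Fin m ⊕ Fin n)).erase (Sum.inr a) =
    Finset.univ.disjSum (Finset.univ.erase a) := by
  ext k; rcases k with k | k <;> simp

lemma univ_erase_inl (j : Fin m) : (Finset.univ : Finset (Fin m ⊕ Fin n)).erase (Sum.inl j) =
    (Finset.univ.erase j).disjSum Finset.univ := by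
  ext k; rcases k with k | k <;> simp

/-- The logarithmic derivative of `Ψ` along the KZ vector field, times `κ`, is the scalar
coefficient in the off-shell Bethe equation up to `selfTerm`. -/
lemma logDeriv_inr (x : Params r) (t : Fin m → ℂ) (a : Fin n) (K : ℕ) :
    logDeriv x.2 (Sum.elim t x.1) (Sum.inr a) K = crossTerm x a K +
      ∑ j, current r (shifted a K fun b q => ext0 (x.2 b) q) (invDist x.1 (t j)) := by
  rw [logDeriv, univ_erase_inr, Finset.sum_disjSum, add_comm]
  congr 1
  · rw [crossTerm]
    refine Finset.sum_congr rfl fun b _ => Finset.sum_congr rfl fun p _ =>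
      Finset.sum_congr rfl fun q _ => ?_
    rw [charge_inr, charge_inr, propDeriv, form, Sum.elim_inr, Sum.elim_inr, Nat.choose_symm_add]
    ring
  · refine Finset.sum_congr rfl fun j _ => ?_
    have h1 : Finset.Icc K (r a) = Finset.Ico K (r a + 1) := by ext; simp
    rw [current_shifted, show order (m := m) r (Sum.inr a) = r a from rfl, h1, Finset.sum_Ico_eq_sum_range]
    refine Eq.trans (Finset.sum_congr rfl fun p _ => ?_)
      (Finset.sum_subset (by intro p; simp only [Finset.mem_range]; omega) fun p _ hp => ?_)
    · rw [order, zero_add, Finset.sum_range_one, charge_inr, Nat.add_sub_cancel_left, Sum.elim_inr,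
        Sum.elim_inl, invDist, ← neg_sub (t j), propDeriv_swap, propDeriv, smul_eq_mul]
      simp [charge, form]
      ring
    · rw [Finset.mem_range] at hp
      rw [ext0, dif_neg (by omega), smul_zero]

/-- Similarly, `κ ∂ log Ψ/∂t_j` is minus the coefficient subtracted with the unwanted term of number
`j`. -/
lemma logDeriv_inl (lam : Weights r) (t : Fin m → ℂ) (z : Fin n → ℂ) (j : Fin m) :
    logDeriv lam (Sum.elim t z) (Sum.inl j) 0 =
      -(current r (fun b q => ext0 (lam b) q) (invDist z (t j)) -
        ∑ i ∈ Finset.univ.erase j, 2 * (t j - t i)⁻¹) := by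
  rw [logDeriv, univ_erase_inl, Finset.sum_disjSum, neg_sub, sub_eq_add_neg]
  congr 1
  · refine Finset.sum_congr rfl fun i _ => ?_
    simp [order, charge, form, propDeriv]
  · rw [current, ← Finset.sum_neg_distrib]
    refine Finset.sum_congr rfl fun b _ => ?_
    rw [order, Finset.Icc_self, Finset.sum_singleton, ← Finset.sum_neg_distrib]
    refine Finset.sum_congr rfl fun q _ => ?_
    rw [charge_inr]
    simp [charge, form, propDeriv, invDist]
    ring

end Exponent

/-! ### Convergence and holomorphy of integrals over twisted cycles -/

section Analysis

variable {m n : ℕ} {r : Fin n → ℕ}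

/-- Near `s` the values of `L` vary by less than `π`, so there `L` is `L s` plus the principal
logarithm of `φ / φ s`. Thus a continuous branch is differentiable, and chains need only carry
continuous logarithms. -/
lemma hasDerivAt_of_exp_eq {L φ : ℂ → ℂ} {φ' s : ℂ} (hL : ContinuousAt L s)
    (hexp : ∀ᶠ y in 𝓝 s, Complex.exp (L y) = φ y) (hφ : HasDerivAt φ φ' s) :
    HasDerivAt L (φ' / φ s) s := by
  have h0 : Complex.exp (L s) = φ s := hexp.self_of_nhds
  have hne : φ s ≠ 0 := h0 ▸ Complex.exp_ne_zero _
  have h1 : ∀ᶠ y in 𝓝 s, ‖L y - L s‖ < Real.pi := by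
    have h2 : Filter.Tendsto (fun y => ‖L y - L s‖) (𝓝 s) (𝓝 0) := by
      have := (hL.tendsto.sub_const (L s)).norm
      simpa using this
    exact h2.eventually_lt_const Real.pi_pos
  have h3 : L =ᶠ[𝓝 s] fun y => L s + Complex.log (φ y / φ s) := by
    filter_upwards [h1, hexp] with y hy hy'
    have h4 := (Complex.abs_im_le_norm (L y - L s)).trans_lt hy
    rw [← hy', ← h0, ← Complex.exp_sub, Complex.log_exp (abs_lt.mp h4).1 (abs_lt.mp h4).2.le]
    ring
  have h5 : φ s / φ s ∈ Complex.slitPlane := by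
    rw [div_self hne]; exact Complex.one_mem_slitPlane
  have h6 := ((hφ.div_const (φ s)).clog h5).const_add (L s)
  refine (h6.congr_deriv ?_).congr_of_eventuallyEq h3
  field_simp

lemma eventually_injective_update {w : Pts m n} (hw : Function.Injective w) (v : Fin m ⊕ Fin n) :
    ∀ᶠ ζ in 𝓝 (w v), Function.Injective (Function.update w v ζ) := by
  have h1 : ∀ᶠ ζ in 𝓝 (w v), ∀ k, k ≠ v → ζ ≠ w k := by
    rw [Filter.eventually_all]
    intro k
    by_cases hk : k = v
    · simp [hk]
    · filter_upwards [eventually_ne_nhds (hw.ne hk).symm] with ζ hζ _ using hζ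
  filter_upwards [h1] with ζ hζ j k hjk
  by_cases hj : j = v <;> by_cases hk : k = v
  · rw [hj, hk]
  · subst hj
    rw [Function.update_self, Function.update_of_ne hk] at hjk
    exact absurd hjk (hζ k hk)
  · subst hk
    rw [Function.update_self, Function.update_of_ne hj] at hjk
    exact absurd hjk.symm (hζ j hj)
  · rw [Function.update_of_ne hk, Function.update_of_ne hj] at hjk
    exact hw hjk

lemma derivPsi_eq (κ : ℂ) (lam : Weights r) {η : Pts m n → ℂ} {η' : ℂ} (i : Fin m) {w : Pts m n}
    (hw : Function.Injective w) (l : Fin m ⊕ Fin n → Fin m ⊕ Fin n → ℂ)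
    (hη : HasDerivAt (fun ζ => η (Function.update w (Sum.inl i) ζ)) η' (w (Sum.inl i))) :
    derivPsi κ lam η i w l =
      psi κ lam w l * (κ⁻¹ * logDeriv lam w (Sum.inl i) 0 * η w + η') := by
  set v : Fin m ⊕ Fin n := Sum.inl i with hv
  have hup : Function.update w v (w v) = w := Function.update_eq_self v w
  have hwd : ∀ j, HasDerivAt (fun ζ => Function.update w v ζ j) ((Pi.single v 1 : Pts m n) j) (w v) :=
    fun j => hasDerivAt_pi.mp (hasDerivAt_update w v (w v)) j
  have h1 := hasDerivAt_psiExponent κ (lam := fun _ => lam) (lam' := 0) (w := Function.update w v)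
    (w' := Pi.single v 1) (l := fun ζ j k => logNear (w j - w k) (l j k)
      (Function.update w v ζ j - Function.update w v ζ k)) (s := w v)
    (fun _ _ => hasDerivAt_const _ _) hwd (by rwa [hup]) (by
      intro j k hjk
      have hne : w j - w k ≠ 0 := sub_ne_zero.mpr (hw.ne fun h => hjk.ne (congrArg toLex h))
      have h5 : (Function.update w v (w v) j - Function.update w v (w v) k) / (w j - w k) ∈
          Complex.slitPlane := by
        rw [hup, div_self hne]; exact Complex.one_mem_slitPlane
      have h6 := ((((hwd j).sub (hwd k)).div_const (w j - w k)).clog h5).const_add (l j k)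
      refine (h6.congr_deriv ?_)
      simp only [Pi.sub_apply]
      rw [hup]
      field_simp)
  have h2 := h1.cexp.mul hη
  have hl : (fun j k => logNear (w j - w k) (l j k)
      (Function.update w v (w v) j - Function.update w v (w v) k)) =
      fun j k => logNear (w j - w k) (l j k) (w j - w k) := by rw [hup]
  -- At the base point the continued branch takes the prescribed value for `j` before `k`; the other
  -- pairs do not enter the exponent.
  have hlt : ∀ j k, toLex j < toLex k → logNear (w j - w k) (l j k) (w j - w k) = l j k := by
    intro j k hjk
    have hne : w j - w k ≠ 0 := sub_ne_zero.mpr (hw.ne fun h => hjk.ne (congrArg toLex h))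
    rw [logNear, div_self hne, Complex.log_one, add_zero]
  have hE : psiExponent κ lam w (fun j k => logNear (w j - w k) (l j k) (w j - w k)) =
      psiExponent κ lam w l := by
    rw [psiExponent, psiExponent]
    refine Finset.sum_congr rfl fun j _ => Finset.sum_congr rfl fun k _ => ?_
    split_ifs with hjk
    · rw [hlt j k hjk]
    · rfl
  rw [hup, exponentDeriv_points, hE, ← psi_eq_exp κ lam hw] at h2
  rw [derivPsi]
  refine (HasDerivAt.deriv (f' := psi κ lam w l * (κ⁻¹ * logDeriv lam w v 0) * η w +
    psi κ lam w l * η') ?_).trans (by ring)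
  refine h2.congr_of_eventuallyEq ?_
  filter_upwards [eventually_injective_update hw v] with ζ hζ
  rw [psi_eq_exp κ lam hζ]
  rfl

lemma IsRegular.continuousOn {η : Pts m n → ℂ} (hη : IsRegular η) :
    ContinuousOn η {w | Function.Injective w} := by
  obtain ⟨p, q, hpq⟩ := hη
  refine ContinuousOn.congr (f := fun w => MvPolynomial.eval w p / MvPolynomial.eval w q) ?_
    fun w hw => (hpq w hw).2
  exact ContinuousOn.div (MvPolynomial.continuous_eval p).continuousOn
    (MvPolynomial.continuous_eval q).continuousOn fun w hw => (hpq w hw).1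

variable {Γ : Chain m n} {Z : Set (Fin n → ℂ)} {κ : ℂ} {U : Set (Params r)}

lemma Chain.IsTwisted.continuousOn_jac (hΓ : Γ.IsTwisted Z) (i : Fin Γ.N) :
    ContinuousOn (Γ.jac i) (Γ.dom i) := by
  refine (Continuous.matrix_det continuous_id).comp_continuousOn (f := fun s =>
    Matrix.of fun j k : Fin m => fderiv ℝ (Γ.map i) s (Pi.single k 1) j) ?_
  refine continuousOn_pi.mpr fun j => continuousOn_pi.mpr fun k => ?_
  intro s hs
  refine ContinuousAt.continuousWithinAt ?_
  have h1 : ContinuousAt (fderiv ℝ (Γ.map i)) s :=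
    ((hΓ.smooth i s hs).fderiv_right (m := 0) (by norm_num)).continuousAt
  exact (continuous_apply j).continuousAt.comp (h1.clm_apply continuousAt_const)

lemma Chain.IsTwisted.aestronglyMeasurable (hΓ : Γ.IsTwisted Z) {z : Fin n → ℂ} (hz : z ∈ Z)
    (κ : ℂ) (lam : Weights r) {η : Pts m n → ℂ} (hη : IsRegular η) (i : Fin Γ.N) :
    AEStronglyMeasurable (Γ.integrand z (fun w l => psi κ lam w l * η w) i)
      (volume.restrict (Γ.dom i)) := by
  refine ContinuousOn.aestronglyMeasurable ?_ (hΓ.measurable i)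
  have hpts : ContinuousOn (Γ.pts i z) (Γ.dom i) := by
    refine continuousOn_pi.mpr fun j => ?_
    rcases j with j | a
    · exact fun s hs => ((continuous_apply j).continuousAt.comp
        (hΓ.smooth i s hs).continuousAt).continuousWithinAt
    · exact continuousOn_const
  have hlog : ∀ j k, toLex j < toLex k → ContinuousOn (fun s => Γ.log i z s j k) (Γ.dom i) :=
    fun j k hjk => (hΓ.continuous_log i j k hjk).comp (f := fun s => (z, s))
      (by fun_prop) fun s hs => ⟨hz, hs⟩
  have hexp : ContinuousOn (fun s => psiExponent κ lam (Γ.pts i z s) (Γ.log i z s)) (Γ.dom i) := by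
    simp only [psiExponent]
    refine continuousOn_finsetSum _ fun j _ => continuousOn_finsetSum _ fun k _ => ?_
    split_ifs with hjk
    · refine continuousOn_finsetSum _ fun p _ => continuousOn_finsetSum _ fun q _ => ?_
      refine ContinuousOn.mul continuousOn_const ?_
      unfold propValue
      split_ifs with hpq
      · exact hlog j k hjk
      · refine ContinuousOn.div continuousOn_const (ContinuousOn.pow (ContinuousOn.sub
          (continuousOn_pi.mp hpts j) (continuousOn_pi.mp hpts k)) _) fun s hs => ?_
        exact pow_ne_zero _ (sub_ne_zero.mpr ((hΓ.distinct i z hz s hs).ne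
          fun h => hjk.ne (congrArg toLex h)))
    · exact continuousOn_const
  refine ContinuousOn.mul (ContinuousOn.mul (ContinuousOn.congr hexp.cexp fun s hs => ?_)
    (hη.continuousOn.comp hpts fun s hs => hΓ.distinct i z hz s hs)) (hΓ.continuousOn_jac i)
  exact psi_eq_exp κ lam (hΓ.distinct i z hz s hs) _

lemma Chain.IsCycle.converges (hΓ : Γ.IsCycle κ U) {x : Params r} (hx : x ∈ U) {η : Pts m n → ℂ}
    (hη : IsRegular η) : Γ.Converges x.1 (fun w l => psi κ x.2 w l * η w) := by
  intro i
  obtain ⟨V, hV, g, hg, hle⟩ := hΓ.dominated η hη i x hx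
  refine Integrable.mono' hg
    (hΓ.toIsTwisted.aestronglyMeasurable (Set.mem_image_of_mem _ hx) κ x.2 hη i) ?_
  exact (ae_restrict_iff' (hΓ.measurable i)).mpr
    (Filter.Eventually.of_forall fun s hs => hle x ⟨mem_of_mem_nhds hV, hx⟩ s hs)

end Analysis

/-! ### Differentiation of the integrals along the KZ vector fields -/

section Shift

variable {m n : ℕ} {r : Fin n → ℕ}

/-- The velocity of the points along `shift`. -/
def pointVelocity (m : ℕ) {n : ℕ} (a : Fin n) (K : ℕ) : Pts m n :=
  if K = 0 then Pi.single (Sum.inr a) 1 else 0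

/-- The velocity of the weights along `shift`. -/
def weightVelocity (x : Params r) (a : Fin n) (K : ℕ) : Weights r :=
  if K = 0 then 0 else Function.update 0 a fun p => (p : ℕ) * ext0 (x.2 a) ((p : ℕ) + (K - 1))

lemma shift_snd (x : Params r) (a : Fin n) (K : ℕ) (s : ℂ) (b : Fin n) (p : Fin (r b + 1)) :
    (shift x a K s).2 b p = x.2 b p + s * weightVelocity x a K b p := by
  rw [shift, weightVelocity]
  split_ifs with hK
  · simp
  · by_cases hb : b = a
    · subst hb; simp
    · simp [Function.update_of_ne hb]

lemma elim_shift (t : Fin m → ℂ) (x : Params r) (a : Fin n) (K : ℕ) (s : ℂ) :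
    (Sum.elim t (shift x a K s).1 : Pts m n) = Sum.elim t x.1 + s • pointVelocity m a K := by
  rw [shift, pointVelocity]
  split_ifs with hK
  · funext j
    rcases j with j | b
    · simp
    · by_cases hb : b = a
      · subst hb; simp
      · have : (Sum.inr b : Fin m ⊕ Fin n) ≠ Sum.inr a := fun h => hb (Sum.inr_injective h)
        simp [Function.update_of_ne hb, Pi.single_eq_of_ne this]
  · simp

lemma shift_zero (x : Params r) (a : Fin n) (K : ℕ) : shift x a K 0 = x := by
  rw [shift]
  split_ifs <;> simp

lemma weightVelocity_zero (x : Params r) (a : Fin n) (K : ℕ) (b : Fin n) :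
    weightVelocity x a K b 0 = 0 := by
  rw [weightVelocity]
  split_ifs
  · rfl
  · by_cases hb : b = a
    · subst hb; simp
    · simp [Function.update_of_ne hb]

lemma continuous_shift (x : Params r) (a : Fin n) (K : ℕ) : Continuous (shift x a K) := by
  suffices h : Continuous (fun s => (shift x a K s).1) ∧ Continuous fun s => (shift x a K s).2 from
    h.1.prodMk h.2
  refine ⟨?_, ?_⟩
  · have h1 : (fun s => (shift x a K s).1) = fun s b =>
        (Sum.elim (fun i : Fin 0 => i.elim0) x.1 + s • pointVelocity 0 a K : Pts 0 n) (Sum.inr b) := by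
      funext s b
      rw [← elim_shift]
      rfl
    rw [h1]
    fun_prop
  · refine continuous_pi fun b => continuous_pi fun p => ?_
    simp only [shift_snd]
    fun_prop

/-- The vector fields leave every `λ_0` unchanged, so openness in the remaining parameters suffices.
-/
lemma IsOpenFor.eventually_shift_mem {U : Set (Params r)} (hU : IsOpenFor U) {x : Params r}
    (hx : x ∈ U) (a : Fin n) (K : ℕ) : ∀ᶠ s in 𝓝 (0 : ℂ), shift x a K s ∈ U := by
  have h1 : Filter.Tendsto (shift x a K) (𝓝 0) (𝓝 x) := by
    have := (continuous_shift x a K).tendsto 0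
    rwa [shift_zero] at this
  filter_upwards [h1.eventually (hU x hx)] with s hs
  refine hs fun b => ?_
  rw [shift_snd, weightVelocity_zero, mul_zero, add_zero]

lemma exponentDeriv_velocity (κ : ℂ) (x : Params r) (a : Fin n) (K : ℕ) (w : Pts m n)
    (l : Fin m ⊕ Fin n → Fin m ⊕ Fin n → ℂ) :
    exponentDeriv κ x.2 (weightVelocity x a K) w (pointVelocity m a K) l =
      κ⁻¹ * logDeriv x.2 w (Sum.inr a) K := by
  rw [weightVelocity, pointVelocity]
  split_ifs with hK
  · subst hK
    exact exponentDeriv_points κ x.2 w _ l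
  · exact exponentDeriv_weights κ x.2 w a hK l

variable {Γ : Chain m n} {κ : ℂ} {U : Set (Params r)}

/-- The integrand of `∫ Ψ η` along `shift`. -/
def shiftIntegrand (Γ : Chain m n) (κ : ℂ) (x : Params r) (a : Fin n) (K : ℕ) (η : Pts m n → ℂ)
    (i : Fin Γ.N) (s : ℂ) (σ : Fin m → ℝ) : ℂ :=
  Γ.integrand (shift x a K s).1 (fun w l => psi κ (shift x a K s).2 w l * η w) i σ

/-- The chain stays fixed while the parameters move. The logarithms along it are continuous
branches, hence differentiable by `hasDerivAt_of_exp_eq`, and the rest is the derivative of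
`psiExponent`. -/
lemma Chain.IsTwisted.hasDerivAt_shiftIntegrand (hΓ : Γ.IsTwisted (Prod.fst '' U)) {x : Params r}
    (a : Fin n) (K : ℕ) {η η' : Pts m n → ℂ}
    (hd : ∀ w, Function.Injective w →
      HasDerivAt (fun s : ℂ => η (w + s • pointVelocity m a K)) (η' w) 0)
    (i : Fin Γ.N) {σ : Fin m → ℝ} (hσ : σ ∈ Γ.dom i) {s₀ : ℂ}
    (hs : ∀ᶠ s in 𝓝 s₀, shift x a K s ∈ U) :
    HasDerivAt (fun s => shiftIntegrand Γ κ x a K η i s σ)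
      (Γ.integrand (shift x a K s₀).1 (fun w l => psi κ (shift x a K s₀).2 w l *
        (exponentDeriv κ (shift x a K s₀).2 (weightVelocity x a K) w (pointVelocity m a K) l * η w +
          η' w)) i σ) s₀ := by
  have hw : ∀ s, Γ.pts i (shift x a K s).1 σ = Γ.pts i x.1 σ + s • pointVelocity m a K :=
    fun s => elim_shift _ _ _ _ _
  have hinj : ∀ s, shift x a K s ∈ U → Function.Injective (Γ.pts i (shift x a K s).1 σ) :=
    fun s hs => hΓ.distinct i _ (Set.mem_image_of_mem _ hs) σ hσ
  have hwd : ∀ j, HasDerivAt (fun s => Γ.pts i (shift x a K s).1 σ j) (pointVelocity m a K j) s₀ := by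
    intro j
    simp only [hw, Pi.add_apply, Pi.smul_apply, smul_eq_mul]
    exact (((hasDerivAt_id s₀).mul_const (pointVelocity m a K j)).const_add _).congr_deriv
      (one_mul _)
  have hlog : ∀ j k, toLex j < toLex k →
      HasDerivAt (fun s => Γ.log i (shift x a K s).1 σ j k)
        ((pointVelocity m a K j - pointVelocity m a K k) /
          (Γ.pts i (shift x a K s₀).1 σ j - Γ.pts i (shift x a K s₀).1 σ k)) s₀ := by
    intro j k hjk
    refine hasDerivAt_of_exp_eq (φ := fun s => Γ.pts i (shift x a K s).1 σ j -
      Γ.pts i (shift x a K s).1 σ k) ?_ ?_ ((hwd j).sub (hwd k))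
    · have h1 := (hΓ.continuous_log i j k hjk) ((shift x a K s₀).1, σ)
        ⟨Set.mem_image_of_mem _ hs.self_of_nhds, hσ⟩
      have h2 : Filter.Tendsto (fun s => ((shift x a K s).1, σ)) (𝓝 s₀)
          (𝓝[(Prod.fst '' U) ×ˢ Γ.dom i] ((shift x a K s₀).1, σ)) := by
        refine tendsto_nhdsWithin_iff.mpr ⟨?_, ?_⟩
        · exact (((continuous_shift x a K).fst).prodMk continuous_const).tendsto s₀
        · filter_upwards [hs] with s hs using ⟨Set.mem_image_of_mem _ hs, hσ⟩
      exact h1.tendsto.comp h2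
    · filter_upwards [hs] with s hs
      exact hΓ.exp_log i _ (Set.mem_image_of_mem _ hs) σ hσ j k hjk
  have h1 := hasDerivAt_psiExponent κ (lam := fun s => (shift x a K s).2)
    (lam' := weightVelocity x a K) (fun b p => by
      simp only [shift_snd]
      exact (((hasDerivAt_id s₀).mul_const _).const_add _).congr_deriv (one_mul _))
    hwd (hinj s₀ hs.self_of_nhds) hlog
  have h2 : HasDerivAt (fun s => η (Γ.pts i (shift x a K s).1 σ))
      (η' (Γ.pts i (shift x a K s₀).1 σ)) s₀ := by
    have h3 := hd _ (hinj s₀ hs.self_of_nhds)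
    rw [← sub_self s₀] at h3
    refine (HasDerivAt.comp_sub_const s₀ s₀ h3).congr_of_eventuallyEq
      (Filter.Eventually.of_forall fun s => ?_)
    simp only [hw]
    congr 1
    module
  refine ((h1.cexp.mul h2).mul_const (Γ.jac i σ)).congr_of_eventuallyEq ?_ |>.congr_deriv ?_
  · filter_upwards [hs] with s hs
    rw [shiftIntegrand, Chain.integrand, psi_eq_exp κ _ (hinj s hs)]
    rfl
  · rw [Chain.integrand, psi_eq_exp κ _ (hinj s₀ hs.self_of_nhds)]
    ring

/-- The integrand is holomorphic in the shift parameter and dominated on a disc, so Cauchy's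
estimate dominates its derivative on a smaller disc. No bound on the derivative has to be assumed.
-/
theorem Chain.IsCycle.hasDerivAt_integral (hU : IsOpenFor U) (hΓ : Γ.IsCycle κ U) {x : Params r}
    (hx : x ∈ U) (a : Fin n) (K : ℕ) {η η' : Pts m n → ℂ} (hη : IsRegular η)
    (hη' : IsRegular fun w => κ⁻¹ * logDeriv x.2 w (Sum.inr a) K * η w + η' w)
    (hd : ∀ w, Function.Injective w →
      HasDerivAt (fun s : ℂ => η (w + s • pointVelocity m a K)) (η' w) 0) :
    HasDerivAt (fun s => Γ.integral (shift x a K s).1 fun w l => psi κ (shift x a K s).2 w l * η w)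
      (Γ.integral x.1 fun w l => psi κ x.2 w l *
        (κ⁻¹ * logDeriv x.2 w (Sum.inr a) K * η w + η' w)) 0 := by
  refine HasDerivAt.fun_sum fun i _ => HasDerivAt.const_mul _ ?_
  obtain ⟨V, hV, g, hg, hle⟩ := hΓ.dominated η hη i x hx
  have hsV : ∀ᶠ s in 𝓝 (0 : ℂ), shift x a K s ∈ V := by
    refine (continuous_shift x a K).continuousAt.eventually_mem ?_
    rwa [shift_zero]
  obtain ⟨ε, hε, hball⟩ := Metric.eventually_nhds_iff_ball.mp
    (hsV.and (hU.eventually_shift_mem hx a K))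
  have hev : ∀ s ∈ Metric.ball (0 : ℂ) ε, ∀ᶠ s' in 𝓝 s, shift x a K s' ∈ U := fun s hs => by
    filter_upwards [Metric.isOpen_ball.mem_nhds hs] with s' hs' using (hball s' hs').2
  have hdiff : ∀ σ ∈ Γ.dom i, DifferentiableOn ℂ (fun s => shiftIntegrand Γ κ x a K η i s σ)
      (Metric.ball 0 ε) := fun σ hσ s hs =>
    (hΓ.toIsTwisted.hasDerivAt_shiftIntegrand a K hd i hσ
      (hev s hs)).differentiableAt.differentiableWithinAt
  have hderiv0 : ∀ σ ∈ Γ.dom i, deriv (fun s => shiftIntegrand Γ κ x a K η i s σ) 0 =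
      Γ.integrand x.1 (fun w l => psi κ x.2 w l *
        (κ⁻¹ * logDeriv x.2 w (Sum.inr a) K * η w + η' w)) i σ := by
    intro σ hσ
    have h1 := (hΓ.toIsTwisted.hasDerivAt_shiftIntegrand (κ := κ) a K hd i hσ
      (hev 0 (Metric.mem_ball_self hε))).deriv
    rw [shift_zero] at h1
    simp only [exponentDeriv_velocity] at h1
    exact h1
  have hae : ∀ {p : (Fin m → ℝ) → Prop}, (∀ σ ∈ Γ.dom i, p σ) →
      ∀ᵐ σ ∂(volume.restrict (Γ.dom i)), p σ := fun h =>
    (ae_restrict_iff' (hΓ.measurable i)).mpr (Filter.Eventually.of_forall h)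
  have hmeas : ∀ s ∈ Metric.ball (0 : ℂ) ε,
      AEStronglyMeasurable (shiftIntegrand Γ κ x a K η i s) (volume.restrict (Γ.dom i)) :=
    fun s hs => hΓ.toIsTwisted.aestronglyMeasurable
      (Set.mem_image_of_mem _ (hball s hs).2) κ _ hη i
  have hbound : ∀ s ∈ Metric.ball (0 : ℂ) ε, ∀ σ ∈ Γ.dom i,
      ‖shiftIntegrand Γ κ x a K η i s σ‖ ≤ g σ := fun s hs σ hσ => hle _ (hball s hs) σ hσ
  have key := hasDerivAt_integral_of_dominated_loc_of_deriv_le (μ := volume.restrict (Γ.dom i))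
    (F := shiftIntegrand Γ κ x a K η i) (x₀ := (0 : ℂ)) (s := Metric.ball 0 (ε / 2))
    (F' := fun s σ => deriv (fun s => shiftIntegrand Γ κ x a K η i s σ) s)
    (bound := fun σ => g σ / (ε / 4))
    (Metric.ball_mem_nhds 0 (half_pos hε))
    (by filter_upwards [Metric.ball_mem_nhds (0 : ℂ) hε] with s hs using hmeas s hs)
    (Integrable.mono' hg (hmeas 0 (Metric.mem_ball_self hε))
      (hae (hbound 0 (Metric.mem_ball_self hε))))
    ((hΓ.toIsTwisted.aestronglyMeasurable (Set.mem_image_of_mem _ hx) κ x.2 hη' i).congr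
      (hae fun σ hσ => (hderiv0 σ hσ).symm))
    -- A circle of radius `ε / 4` about a point of the disc of radius `ε / 2` stays inside the disc
    -- of radius `ε`, on which the integrand is bounded by `g`.
    (hae fun σ hσ s hs => by
      have hsub : Metric.closedBall s (ε / 4) ⊆ Metric.ball 0 ε := by
        intro y hy
        rw [Metric.mem_closedBall] at hy
        rw [Metric.mem_ball] at hs ⊢
        have := dist_triangle y s 0
        linarith
      exact Complex.norm_deriv_le_of_forall_mem_sphere_norm_le (by linarith)
        ((hdiff σ hσ).diffContOnCl_ball hsub)
        fun y hy => hbound y (hsub (Metric.sphere_subset_closedBall hy)) σ hσ)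
    (hg.div_const _)
    (hae fun σ hσ s hs => ((hdiff σ hσ).differentiableAt (Metric.isOpen_ball.mem_nhds
      (Metric.ball_subset_ball (by linarith) hs))).hasDerivAt)
  refine key.2.congr_deriv ?_
  exact setIntegral_congr_fun (hΓ.measurable i) hderiv0

end Shift

/-! ### The currents at the integration variables as rational functions -/

section Currents

variable {m n : ℕ} {r : Fin n → ℕ}

/-- A function of the points with values in the polynomials in the `f^{(a)}[p]`, all of whose
linear functionals are regular. -/
def IsRegularPoly (G : Pts m n → FPoly r) : Prop :=
  ∀ L : FPoly r →ₗ[ℂ] ℂ, IsRegular fun w => L (G w)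

/-- The current at the point `t_j`. -/
def currentAt (x : Fin n → ℕ → FPoly r) (j : Fin m) (w : Pts m n) : FPoly r :=
  current r x (invDist (fun b => w (Sum.inr b)) (w (Sum.inl j)))

lemma isRegular_invDist (j : Fin m) (b : Fin n) :
    IsRegular fun w : Pts m n => invDist (fun b => w (Sum.inr b)) (w (Sum.inl j)) b :=
  IsRegular.inv_sub Sum.inl_ne_inr

lemma IsRegularPoly.currentAt_mul (x : Fin n → ℕ → FPoly r) (j : Fin m) {G : Pts m n → FPoly r}
    (hG : IsRegularPoly G) : IsRegularPoly fun w => currentAt x j w * G w := by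
  intro L
  simp only [currentAt, current, Finset.sum_mul, map_sum, smul_mul_assoc, LinearMap.map_smul,
    smul_eq_mul]
  exact IsRegular.sum _ fun b _ => IsRegular.sum _ fun q _ =>
    ((isRegular_invDist j b).pow _).mul (hG (L ∘ₗ LinearMap.mulLeft ℂ (x b q)))

lemma isRegularPoly_prod (x : Fin n → ℕ → FPoly r) (S : Finset (Fin m)) :
    IsRegularPoly fun w => ∏ j ∈ S, currentAt x j w := by
  classical
  induction S using Finset.induction_on with
  | empty => exact fun L => by simpa using IsRegular.const (L 1)
  | insert j S hj ih =>
    simp only [Finset.prod_insert hj]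
    exact ih.currentAt_mul x j

lemma isRegular_logDeriv (lam : Weights r) (v : Fin m ⊕ Fin n) (K : ℕ) :
    IsRegular fun w => logDeriv lam w v K := by
  simp only [logDeriv, propDeriv, div_eq_mul_inv, ← inv_pow]
  exact IsRegular.sum _ fun k hk => IsRegular.sum _ fun p _ => IsRegular.sum _ fun q _ =>
    (((IsRegular.inv_sub (Finset.ne_of_mem_erase hk).symm).pow _).const_mul _).const_mul _

/-- The coefficient of `f^{(a)}[p]` in the current at the point `t_i`. -/
def kernelAt (i : Fin m) (s : Σ a : Fin n, Fin (r a + 1)) (w : Pts m n) : ℂ :=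
  1 / (w (Sum.inl i) - w (Sum.inr s.1)) ^ ((s.2 : ℕ) + 1)

/-- The derivative of `kernelAt` along `shift`. -/
def kernelDeriv (a : Fin n) (K : ℕ) (i : Fin m) (s : Σ a : Fin n, Fin (r a + 1)) (w : Pts m n) : ℂ :=
  if K = 0 ∧ s.1 = a then ((s.2 : ℕ) + 1 : ℂ) * (w (Sum.inl i) - w (Sum.inr s.1))⁻¹ ^ ((s.2 : ℕ) + 2)
  else 0

lemma isRegular_kernelAt (i : Fin m) (s : Σ a : Fin n, Fin (r a + 1)) :
    IsRegular fun w : Pts m n => kernelAt i s w := by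
  simp only [kernelAt, one_div, ← inv_pow]
  exact (IsRegular.inv_sub Sum.inl_ne_inr).pow _

lemma isRegular_kernelDeriv (a : Fin n) (K : ℕ) (i : Fin m) (s : Σ a : Fin n, Fin (r a + 1)) :
    IsRegular fun w : Pts m n => kernelDeriv a K i s w := by
  simp only [kernelDeriv]
  split_ifs
  · exact ((IsRegular.inv_sub Sum.inl_ne_inr).pow _).const_mul _
  · exact IsRegular.const 0

lemma hasDerivAt_kernelAt (a : Fin n) (K : ℕ) (i : Fin m) (s : Σ a : Fin n, Fin (r a + 1))
    {w : Pts m n} (hw : Function.Injective w) :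
    HasDerivAt (fun ζ : ℂ => kernelAt i s (w + ζ • pointVelocity m a K)) (kernelDeriv a K i s w) 0 := by
  have hne : w (Sum.inl i) - w (Sum.inr s.1) ≠ 0 := sub_ne_zero.mpr (hw.ne Sum.inl_ne_inr)
  have hl : pointVelocity m a K (Sum.inl i) = 0 := by
    rw [pointVelocity]
    split_ifs
    · exact Pi.single_eq_of_ne Sum.inl_ne_inr _
    · rfl
  have hr : pointVelocity m a K (Sum.inr s.1) = if K = 0 ∧ s.1 = a then 1 else 0 := by
    rw [pointVelocity]
    by_cases hK : K = 0
    · by_cases hs : s.1 = a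
      · rw [if_pos hK, if_pos ⟨hK, hs⟩, hs, Pi.single_eq_same]
      · rw [if_pos hK, if_neg fun h => hs h.2,
          Pi.single_eq_of_ne fun h => hs (Sum.inr_injective h)]
    · rw [if_neg hK, if_neg fun h => hK h.1]
      rfl
  simp only [kernelAt, Pi.add_apply, Pi.smul_apply, hl, hr, smul_eq_mul, mul_zero, add_zero]
  have h1 : HasDerivAt (fun ζ : ℂ => w (Sum.inl i) -
      (w (Sum.inr s.1) + ζ * if K = 0 ∧ s.1 = a then 1 else 0))
      (-(if K = 0 ∧ s.1 = a then 1 else 0)) 0 := by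
    have := (((hasDerivAt_id (0 : ℂ)).mul_const (if K = 0 ∧ s.1 = a then (1 : ℂ) else 0)).const_add
      (w (Sum.inr s.1))).const_sub (w (Sum.inl i))
    exact this.congr_deriv (by rw [one_mul])
  have h2 := (h1.fun_pow ((s.2 : ℕ) + 1)).fun_inv (by
    rw [zero_mul, add_zero]; exact pow_ne_zero _ hne)
  simp only [one_div]
  refine h2.congr_deriv ?_
  rw [kernelDeriv, zero_mul, add_zero, Nat.add_sub_cancel]
  split_ifs
  · rw [inv_pow]
    push_cast
    field_simp
    ring
  · simp

lemma currentAt_fVar (i : Fin m) (w : Pts m n) :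
    currentAt (fVar r) i w = ∑ s, kernelAt i s w • MvPolynomial.X s := by
  rw [currentAt, current, Fintype.sum_sigma]
  refine Finset.sum_congr rfl fun b _ => ?_
  rw [Finset.sum_range]
  refine Finset.sum_congr rfl fun q _ => ?_
  rw [fVar, dif_pos q.2, invDist, kernelAt, one_div, inv_pow]

/-- Minus the derivative in `t_i` of the current with the modes shifted by `K`. -/
def currentDeriv (r : Fin n → ℕ) (a : Fin n) (K : ℕ) (i : Fin m) (w : Pts m n) : FPoly r :=
  ∑ q ∈ Finset.range (r a + 1),
    (((q : ℂ) + 1) * (w (Sum.inl i) - w (Sum.inr a))⁻¹ ^ (q + 2)) • fVar r a (K + q)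

/-- For `K = 0` only the coefficients of the current move, with `z_a`; for `K ≥ 1` only the
derivation `d_k` acts. Both cases give the same expression, minus the `t_i`-derivative of the
current with modes shifted by `K`. -/
lemma sum_kernelDeriv_add_dDer (a : Fin n) (K : ℕ) (i : Fin m) (w : Pts m n) :
    ∑ s, kernelDeriv a K i s w • MvPolynomial.X s + dDer r a K (currentAt (fVar r) i w) =
      currentDeriv r a K i w := by
  have hd : dDer r a K (currentAt (fVar r) i w) =
      ∑ s, kernelAt i s w • dDer r a K (MvPolynomial.X s) := by
    rw [currentAt_fVar, map_sum]
    exact Finset.sum_congr rfl fun s _ => Derivation.map_smul _ _ _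
  rw [hd, currentDeriv]
  by_cases hK : K = 0
  · subst hK
    have h1 : ∀ s, dDer r a 0 (MvPolynomial.X s) = 0 := fun s => by
      rw [dDer, MvPolynomial.mkDerivation_X, if_neg (by omega)]
    simp only [h1, smul_zero, Finset.sum_const_zero, add_zero]
    rw [Fintype.sum_sigma, Finset.sum_eq_single a, Finset.sum_range]
    · refine Finset.sum_congr rfl fun q _ => ?_
      rw [kernelDeriv, if_pos ⟨rfl, rfl⟩, fVar, dif_pos (by omega)]
      simp only [zero_add]
    · intro b _ hb
      refine Finset.sum_eq_zero fun q _ => ?_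
      rw [kernelDeriv, if_neg fun h => hb h.2, zero_smul]
    · simp
  · have h1 : ∀ s : Σ a : Fin n, Fin (r a + 1), kernelDeriv a K i s w = 0 := fun s => by
      rw [kernelDeriv, if_neg fun h => hK h.1]
    simp only [h1, zero_smul, Finset.sum_const_zero, zero_add]
    rw [Fintype.sum_sigma, Finset.sum_eq_single a]
    · have h2 : ∀ p : Fin (r a + 1), kernelAt i ⟨a, p⟩ w • dDer r a K (MvPolynomial.X ⟨a, p⟩) =
          ((p : ℕ) * (w (Sum.inl i) - w (Sum.inr a))⁻¹ ^ ((p : ℕ) + 1)) • fVar r a ((p : ℕ) + (K - 1)) := by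
        intro p
        rw [dDer, MvPolynomial.mkDerivation_X, if_pos ⟨rfl, Nat.one_le_iff_ne_zero.mpr hK⟩, fVar,
          kernelAt, one_div, inv_pow]
        split_ifs with hp
        · rw [← MvPolynomial.smul_eq_C_mul, smul_smul, mul_comm]
        · rw [smul_zero, smul_zero]
      simp only [h2]
      -- The summand `p = 0` vanishes because of the factor `p`, and the top summand on the other
      -- side because its mode exceeds the truncation; the remaining ones match under `p = q + 1`.
      rw [← Finset.sum_range fun p => ((p : ℂ) * (w (Sum.inl i) - w (Sum.inr a))⁻¹ ^ (p + 1)) •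
        fVar r a (p + (K - 1)), Finset.sum_range_succ', Finset.sum_range_succ]
      have h3 : fVar r a (K + r a) = 0 := by rw [fVar, dif_neg (by omega)]
      rw [h3, smul_zero, Nat.cast_zero, zero_mul, zero_smul]
      congr 1
      refine Finset.sum_congr rfl fun q _ => ?_
      rw [show q + 1 + (K - 1) = K + q by omega, Nat.cast_add, Nat.cast_one]
    · intro b _ hb
      refine Finset.sum_eq_zero fun q _ => ?_
      rw [dDer, MvPolynomial.mkDerivation_X, if_neg fun h => hb h.1, smul_zero]
    · simp

lemma prod_ite_eq_mul_prod_erase {ι A : Type*} [Fintype ι] [DecidableEq ι] [CommMonoid A] (j : ι)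
    (R R' : ι → A) : ∏ i, (if j = i then R' i else R i) = R' j * ∏ i ∈ Finset.univ.erase j, R i := by
  rw [← Finset.mul_prod_erase _ _ (Finset.mem_univ j), if_pos rfl]
  congr 1
  refine Finset.prod_congr rfl fun i hi => ?_
  rw [if_neg (Finset.ne_of_mem_erase hi).symm]

lemma prod_sum_smul_X {σ : Type*} [Fintype σ] (g : Fin m → σ → ℂ) :
    ∏ i, ∑ s, g i s • (MvPolynomial.X s : MvPolynomial σ ℂ) =
      ∑ c : Fin m → σ, (∏ i, g i (c i)) • ∏ i, MvPolynomial.X (c i) := by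
  rw [Finset.prod_univ_sum, Fintype.piFinset_univ]
  exact Finset.sum_congr rfl fun c _ => Finset.prod_smul _ _ _

/-- The derivative along `shift` of the product of the coefficients `kernelAt`. -/
def prodKernelDeriv (a : Fin n) (K : ℕ) (c : Fin m → Σ a : Fin n, Fin (r a + 1)) (w : Pts m n) : ℂ :=
  ∑ j, ∏ i, if j = i then kernelDeriv a K i (c i) w else kernelAt i (c i) w

lemma hasDerivAt_prod_kernelAt (a : Fin n) (K : ℕ) (c : Fin m → Σ a : Fin n, Fin (r a + 1))
    {w : Pts m n} (hw : Function.Injective w) :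
    HasDerivAt (fun ζ : ℂ => ∏ i, kernelAt i (c i) (w + ζ • pointVelocity m a K))
      (prodKernelDeriv a K c w) 0 := by
  refine (HasDerivAt.fun_finsetProd fun i _ => hasDerivAt_kernelAt a K i (c i) hw).congr_deriv ?_
  refine Finset.sum_congr rfl fun j _ => ?_
  rw [prod_ite_eq_mul_prod_erase, smul_eq_mul, mul_comm]
  simp

lemma isRegular_prodKernelDeriv (a : Fin n) (K : ℕ) (c : Fin m → Σ a : Fin n, Fin (r a + 1)) :
    IsRegular fun w => prodKernelDeriv a K c w := by
  refine IsRegular.sum _ fun j _ => IsRegular.prod _ fun i _ => ?_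
  split_ifs
  · exact isRegular_kernelDeriv a K i (c i)
  · exact isRegular_kernelAt i (c i)

lemma sum_prodKernelDeriv_add_dDer (a : Fin n) (K : ℕ) (w : Pts m n) :
    ∑ c : Fin m → Σ a : Fin n, Fin (r a + 1), prodKernelDeriv a K c w • ∏ i, MvPolynomial.X (c i) +
      dDer r a K (∏ i, currentAt (fVar r) i w) =
      ∑ j, currentDeriv r a K j w * ∏ i ∈ Finset.univ.erase j, currentAt (fVar r) i w := by
  have h1 : ∑ c : Fin m → Σ a : Fin n, Fin (r a + 1),
      prodKernelDeriv a K c w • ∏ i, (MvPolynomial.X (c i) : FPoly r) =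
      ∑ j, ∏ i, if j = i then ∑ s, kernelDeriv a K i s w • MvPolynomial.X s
        else currentAt (fVar r) i w := by
    simp only [prodKernelDeriv, Finset.sum_smul]
    rw [Finset.sum_comm]
    refine Finset.sum_congr rfl fun j _ => ?_
    rw [← prod_sum_smul_X fun i s => if j = i then kernelDeriv a K i s w else kernelAt i s w]
    refine Finset.prod_congr rfl fun i _ => ?_
    split_ifs
    · rfl
    · rw [currentAt_fVar]
  rw [h1, derivation_apply_prod, ← Finset.sum_add_distrib]
  refine Finset.sum_congr rfl fun j _ => ?_
  rw [prod_ite_eq_mul_prod_erase, prod_ite_eq_mul_prod_erase, ← add_mul, sum_kernelDeriv_add_dDer]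

/-- The factors with `i ≠ j` do not involve `t_j`, so only the shifted current is differentiated. -/
lemma hasDerivAt_shifted_mul (a : Fin n) (K : ℕ) (j : Fin m) (L : FPoly r →ₗ[ℂ] ℂ) {w : Pts m n}
    (hw : Function.Injective w) :
    HasDerivAt (fun ζ => L (currentAt (shifted a K (fVar r)) j (Function.update w (Sum.inl j) ζ) *
        ∏ i ∈ Finset.univ.erase j, currentAt (fVar r) i (Function.update w (Sum.inl j) ζ)))
      (-L (currentDeriv r a K j w * ∏ i ∈ Finset.univ.erase j, currentAt (fVar r) i w))
      (w (Sum.inl j)) := by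
  have hne : w (Sum.inl j) - w (Sum.inr a) ≠ 0 := sub_ne_zero.mpr (hw.ne Sum.inl_ne_inr)
  have hr : ∀ (ζ : ℂ) (b : Fin n), Function.update w (Sum.inl j) ζ (Sum.inr b) = w (Sum.inr b) :=
    fun ζ b => Function.update_of_ne Sum.inr_ne_inl _ _
  have h1 : ∀ ζ, ∏ i ∈ Finset.univ.erase j, currentAt (fVar r) i (Function.update w (Sum.inl j) ζ) =
      ∏ i ∈ Finset.univ.erase j, currentAt (fVar r) i w := by
    intro ζ
    refine Finset.prod_congr rfl fun i hi => ?_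
    simp only [currentAt, hr]
    rw [Function.update_of_ne fun h => Finset.ne_of_mem_erase hi (Sum.inl_injective h)]
  simp only [h1]
  simp only [currentAt, current_shifted, hr, Function.update_self, invDist, Finset.sum_mul, map_sum,
    smul_mul_assoc, LinearMap.map_smul, smul_eq_mul, currentDeriv]
  rw [← Finset.sum_neg_distrib]
  refine HasDerivAt.fun_sum fun q _ => ?_
  have h2 := (((hasDerivAt_id (w (Sum.inl j))).sub_const (w (Sum.inr a))).fun_inv hne).fun_pow (q + 1)
  refine (h2.mul_const _).congr_deriv ?_
  rw [← neg_mul]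
  congr 1
  simp only [id]
  push_cast
  generalize w (Sum.inl j) - w (Sum.inr a) = y
  ring

end Currents

/-! ### The confluent Knizhnik-Zamolodchikov equations -/

section KZ

attribute [local instance] tensorVermaAddCommGroup

variable {m n : ℕ} {r : Fin n → ℕ} {Γ : Chain m n} {κ : ℂ} {U : Set (Params r)}

/-- The integral of `Ψ θ` over the chain. -/
def psiIntegral (κ : ℂ) (Γ : Chain m n) (x : Params r) (θ : Pts m n → ℂ) : ℂ :=
  Γ.integral x.1 fun w l => psi κ x.2 w l * θ w

lemma Chain.IsCycle.psiIntegral_sum (hΓ : Γ.IsCycle κ U) {x : Params r} (hx : x ∈ U) {ι : Type*}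
    (S : Finset ι) (a : ι → ℂ) {θ : ι → Pts m n → ℂ} (hθ : ∀ i, IsRegular (θ i)) :
    psiIntegral κ Γ x (fun w => ∑ i ∈ S, a i * θ i w) = ∑ i ∈ S, a i * psiIntegral κ Γ x (θ i) := by
  simp only [psiIntegral]
  rw [← Chain.integral_sum_mul S a _ fun i _ => hΓ.converges hx (hθ i)]
  simp only [Finset.mul_sum, mul_left_comm]

lemma Chain.IsCycle.psiIntegral_add (hΓ : Γ.IsCycle κ U) {x : Params r} (hx : x ∈ U)
    {θ θ' : Pts m n → ℂ} (hθ : IsRegular θ) (hθ' : IsRegular θ') :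
    psiIntegral κ Γ x (fun w => θ w + θ' w) = psiIntegral κ Γ x θ + psiIntegral κ Γ x θ' := by
  have := hΓ.psiIntegral_sum hx Finset.univ (fun _ => 1) (θ := ![θ, θ']) (by
    intro i; fin_cases i <;> assumption)
  simpa [Fin.sum_univ_two] using this

lemma Chain.IsCycle.psiIntegral_const_mul (hΓ : Γ.IsCycle κ U) {x : Params r} (hx : x ∈ U)
    (c : ℂ) {θ : Pts m n → ℂ} (hθ : IsRegular θ) :
    psiIntegral κ Γ x (fun w => c * θ w) = c * psiIntegral κ Γ x θ := by
  have := hΓ.psiIntegral_sum hx {()} (fun _ => c) (θ := fun _ => θ) fun _ => hθ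
  simpa using this

lemma Chain.IsCycle.psiIntegral_congr (hΓ : Γ.IsCycle κ U) {x : Params r} (hx : x ∈ U)
    {θ θ' : Pts m n → ℂ}
    (h : ∀ t, Function.Injective (Sum.elim t x.1) → θ (Sum.elim t x.1) = θ' (Sum.elim t x.1)) :
    psiIntegral κ Γ x θ = psiIntegral κ Γ x θ' := by
  unfold psiIntegral Chain.integral
  refine Finset.sum_congr rfl fun i _ => ?_
  congr 1
  refine setIntegral_congr_fun (hΓ.measurable i) fun s hs => ?_
  simp only [Chain.integrand]
  rw [Chain.pts, h _ (hΓ.distinct i x.1 (Set.mem_image_of_mem _ hx) s hs)]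

lemma Chain.IsCycle.jnsIntegral_eq (hΓ : Γ.IsCycle κ U) {x : Params r} (hx : x ∈ U) :
    jnsIntegral κ Γ x = ∑ c : Fin m → Σ a : Fin n, Fin (r a + 1),
      psiIntegral κ Γ x (fun w => ∏ i, kernelAt i (c i) w) • ∏ i, MvPolynomial.X (c i) := by
  refine Finset.sum_congr rfl fun c _ => ?_
  rw [MvPolynomial.smul_eq_C_mul, psiIntegral]
  congr 2
  refine hΓ.toIsTwisted.integral_congr (Set.mem_image_of_mem _ hx) fun w l hw => ?_
  rw [psi_eq_master κ _ hw]
  rfl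

lemma isRegular_prod_kernelAt (c : Fin m → Σ a : Fin n, Fin (r a + 1)) :
    IsRegular fun w => ∏ i, kernelAt i (c i) w :=
  IsRegular.prod _ fun i _ => isRegular_kernelAt i (c i)

lemma Chain.IsCycle.apply_sum_psiIntegral (hΓ : Γ.IsCycle κ U) {x : Params r} (hx : x ∈ U)
    {ι : Type*} [Fintype ι] (P : ι → FPoly r) {θ : ι → Pts m n → ℂ} (hθ : ∀ i, IsRegular (θ i))
    (L : FPoly r →ₗ[ℂ] ℂ) : L (∑ i, psiIntegral κ Γ x (θ i) • P i) =
      psiIntegral κ Γ x fun w => L (∑ i, θ i w • P i) := by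
  simp only [map_sum, LinearMap.map_smul, smul_eq_mul]
  have := hΓ.psiIntegral_sum hx Finset.univ (fun i => L (P i)) hθ
  simp only [mul_comm (L _)] at this
  exact this.symm

lemma Chain.IsCycle.apply_jnsIntegral (hΓ : Γ.IsCycle κ U) {x : Params r} (hx : x ∈ U)
    (L : FPoly r →ₗ[ℂ] ℂ) : L (jnsIntegral κ Γ x) =
      psiIntegral κ Γ x fun w => L (∏ i, currentAt (fVar r) i w) := by
  rw [hΓ.jnsIntegral_eq hx, hΓ.apply_sum_psiIntegral hx _ isRegular_prod_kernelAt]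
  simp only [currentAt_fVar, prod_sum_smul_X]

/-- The logarithmic derivative along `shift` of `Ψ` times a monomial of the product of currents. -/
def integrandDeriv (κ : ℂ) (x : Params r) (a : Fin n) (K : ℕ)
    (c : Fin m → Σ a : Fin n, Fin (r a + 1)) (w : Pts m n) : ℂ :=
  κ⁻¹ * logDeriv x.2 w (Sum.inr a) K * ∏ i, kernelAt i (c i) w + prodKernelDeriv a K c w

lemma isRegular_integrandDeriv (x : Params r) (a : Fin n) (K : ℕ)
    (c : Fin m → Σ a : Fin n, Fin (r a + 1)) : IsRegular fun w => integrandDeriv κ x a K c w :=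
  (((isRegular_logDeriv x.2 (Sum.inr a) K).const_mul κ⁻¹).mul (isRegular_prod_kernelAt c)).add
    (isRegular_prodKernelDeriv a K c)

lemma Chain.IsCycle.hasDerivAt_coeff_jnsIntegral (hU : IsOpenFor U) (hΓ : Γ.IsCycle κ U)
    {x : Params r} (hx : x ∈ U) (a : Fin n) (K : ℕ) (d : (Σ a : Fin n, Fin (r a + 1)) →₀ ℕ) :
    HasDerivAt (fun s : ℂ => MvPolynomial.coeff d (jnsIntegral κ Γ (shift x a K s)))
      (MvPolynomial.coeff d (∑ c : Fin m → Σ a : Fin n, Fin (r a + 1),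
        psiIntegral κ Γ x (integrandDeriv κ x a K c) • ∏ i, MvPolynomial.X (c i))) 0 := by
  have h1 : (fun s : ℂ => MvPolynomial.coeff d (jnsIntegral κ Γ (shift x a K s))) =ᶠ[𝓝 0]
      fun s => ∑ c : Fin m → Σ a : Fin n, Fin (r a + 1),
        psiIntegral κ Γ (shift x a K s) (fun w => ∏ i, kernelAt i (c i) w) *
          MvPolynomial.coeff d (∏ i, MvPolynomial.X (c i)) := by
    filter_upwards [hU.eventually_shift_mem hx a K] with s hs
    rw [hΓ.jnsIntegral_eq hs, MvPolynomial.coeff_sum]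
    simp only [MvPolynomial.coeff_smul, smul_eq_mul]
  refine HasDerivAt.congr_of_eventuallyEq ?_ h1
  rw [MvPolynomial.coeff_sum]
  simp only [MvPolynomial.coeff_smul, smul_eq_mul]
  refine HasDerivAt.fun_sum fun c _ => HasDerivAt.mul_const ?_ _
  exact hΓ.hasDerivAt_integral hU hx a K (isRegular_prod_kernelAt c)
    (isRegular_integrandDeriv x a K c) fun w hw => hasDerivAt_prod_kernelAt a K c hw

/-- The integrand is the `t_j`-derivative of `Ψ` times the unwanted term, divided by `Ψ`. -/
lemma Chain.IsCycle.psiIntegral_stokes (hΓ : Γ.IsCycle κ U) {x : Params r} (hx : x ∈ U)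
    (a : Fin n) (K : ℕ) (L : FPoly r →ₗ[ℂ] ℂ) (j : Fin m) :
    psiIntegral κ Γ x (fun w => κ⁻¹ * logDeriv x.2 w (Sum.inl j) 0 *
      L (currentAt (shifted a K (fVar r)) j w * ∏ i ∈ Finset.univ.erase j, currentAt (fVar r) i w) -
      L (currentDeriv r a K j w * ∏ i ∈ Finset.univ.erase j, currentAt (fVar r) i w)) = 0 := by
  rw [← hΓ.stokes _ ((isRegularPoly_prod (fVar r) (Finset.univ.erase j)).currentAt_mul
    (shifted a K (fVar r)) j L) j x hx]
  refine hΓ.toIsTwisted.integral_congr (Set.mem_image_of_mem _ hx) fun w l hw => ?_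
  rw [derivPsi_eq κ x.2 j hw l (hasDerivAt_shifted_mul a K j L hw)]
  simp only [sub_eq_add_neg]

lemma isRegularPoly_currentDeriv_mul (a : Fin n) (K : ℕ) (j : Fin m) {G : Pts m n → FPoly r}
    (hG : IsRegularPoly G) : IsRegularPoly fun w => currentDeriv r a K j w * G w := by
  intro L
  simp only [currentDeriv, Finset.sum_mul, map_sum, smul_mul_assoc, LinearMap.map_smul, smul_eq_mul]
  exact IsRegular.sum _ fun q _ =>
    (((IsRegular.inv_sub Sum.inl_ne_inr).pow _).const_mul _).mul
      (hG (L ∘ₗ LinearMap.mulLeft ℂ (fVar r a (K + q))))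

/-- The off-shell Bethe equation with all its coefficients expressed through the logarithmic
derivatives of `Ψ`, so that total derivatives can be recognized. -/
lemma hamiltonian_toVermaL_currentAt (x : Params r) {w : Pts m n} {t : Fin m → ℂ}
    (hwt : w = Sum.elim t x.1) (hw : Function.Injective w) (a : Fin n) {K : ℕ} (hK : K ≤ r a) :
    hamiltonian x a K (toVermaL x.2 (∏ i, currentAt (fVar r) i w)) =
      toVermaL x.2 ((selfTerm (x.2 a) K + logDeriv x.2 w (Sum.inr a) K) •
        ∏ i, currentAt (fVar r) i w + ∑ j, logDeriv x.2 w (Sum.inl j) 0 •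
          (currentAt (shifted a K (fVar r)) j w *
            ∏ i ∈ Finset.univ.erase j, currentAt (fVar r) i w)) := by
  subst hwt
  have h1 := hamiltonian_toVermaL x t hw a hK
  rw [logDeriv_inr, ← add_assoc]
  simp only [logDeriv_inl]
  simp only [neg_smul, Finset.sum_neg_distrib, ← sub_eq_add_neg]
  exact h1

theorem Chain.IsCycle.solvesKZ (hκ : κ ≠ 0) (hU : IsOpenFor U) (hΓ : Γ.IsCycle κ U) :
    SolvesKZ κ U (jnsIntegral κ Γ) := by
  intro x hx a K hK
  refine ⟨_, hΓ.hasDerivAt_coeff_jnsIntegral hU hx a K, ?_⟩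
  set u' : FPoly r := ∑ c : Fin m → Σ a : Fin n, Fin (r a + 1),
    psiIntegral κ Γ x (integrandDeriv κ x a K c) • ∏ i, MvPolynomial.X (c i) with hu'
  simp only [toVerma_eq]
  -- The vector identity is tested by all linear functionals, so that only scalar integrals are
  -- involved.
  rw [← sub_eq_zero, ← Module.forall_dual_apply_eq_zero_iff ℂ]
  intro ℓ
  set L : FPoly r →ₗ[ℂ] ℂ := ℓ ∘ₗ toVermaL x.2 with hL
  set M : FPoly r →ₗ[ℂ] ℂ := ℓ ∘ₗ hamiltonian x a K ∘ₗ toVermaL x.2 with hM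
  have hgoal : κ * (L u' + L (dDer r a K (jnsIntegral κ Γ x))) =
      M (jnsIntegral κ Γ x) - selfTerm (x.2 a) K * L (jnsIntegral κ Γ x) := by
    set D : Fin m → Pts m n → ℂ := fun j w => κ⁻¹ * logDeriv x.2 w (Sum.inl j) 0 *
      L (currentAt (shifted a K (fVar r)) j w * ∏ i ∈ Finset.univ.erase j, currentAt (fVar r) i w) -
      L (currentDeriv r a K j w * ∏ i ∈ Finset.univ.erase j, currentAt (fVar r) i w) with hD
    have hDr : ∀ j, IsRegular (D j) := fun j => by
      have h1 := isRegularPoly_prod (fVar r) (Finset.univ.erase j)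
      simp only [hD, sub_eq_add_neg, ← map_neg]
      exact (((isRegular_logDeriv x.2 (Sum.inl j) 0).const_mul κ⁻¹).mul
        (h1.currentAt_mul (shifted a K (fVar r)) j L)).add
        (by simpa using isRegularPoly_currentDeriv_mul a K j h1 (-L))
    have hΦ : IsRegularPoly fun w : Pts m n => ∏ i, currentAt (fVar r) i w :=
      isRegularPoly_prod (fVar r) Finset.univ
    have hu'r : IsRegular fun w => L (∑ c : Fin m → Σ a : Fin n, Fin (r a + 1),
        integrandDeriv κ x a K c w • ∏ i, MvPolynomial.X (c i)) := by
      simp only [map_sum, LinearMap.map_smul, smul_eq_mul]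
      exact IsRegular.sum _ fun c _ => (isRegular_integrandDeriv x a K c).mul (IsRegular.const _)
    have h1 := hΓ.apply_jnsIntegral hx (L ∘ₗ (dDer r a K).toLinearMap)
    -- The equation holds under the integral sign up to the terms `κ * D j`, each of which is `κ`
    -- times a total derivative in `t_j` divided by `Ψ`. This combines the off-shell Bethe equation
    -- with `sum_prodKernelDeriv_add_dDer`.
    have h2 : psiIntegral κ Γ x (fun w => M (∏ i, currentAt (fVar r) i w)) =
        psiIntegral κ Γ x fun w => selfTerm (x.2 a) K * L (∏ i, currentAt (fVar r) i w) +
          (κ * (L (∑ c : Fin m → Σ a : Fin n, Fin (r a + 1),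
            integrandDeriv κ x a K c w • ∏ i, MvPolynomial.X (c i)) +
            (L ∘ₗ (dDer r a K).toLinearMap) (∏ i, currentAt (fVar r) i w)) +
          ∑ j, κ * D j w) := by
      refine hΓ.psiIntegral_congr hx fun t ht => ?_
      set w : Pts m n := Sum.elim t x.1 with hw
      have h3 : M (∏ i, currentAt (fVar r) i w) = L ((selfTerm (x.2 a) K +
          logDeriv x.2 w (Sum.inr a) K) • ∏ i, currentAt (fVar r) i w +
          ∑ j, logDeriv x.2 w (Sum.inl j) 0 • (currentAt (shifted a K (fVar r)) j w *
            ∏ i ∈ Finset.univ.erase j, currentAt (fVar r) i w)) :=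
        congrArg ℓ (hamiltonian_toVermaL_currentAt x hw ht a hK)
      have h4 : ∑ c : Fin m → Σ a : Fin n, Fin (r a + 1),
          integrandDeriv κ x a K c w • ∏ i, (MvPolynomial.X (c i) : FPoly r) =
          (κ⁻¹ * logDeriv x.2 w (Sum.inr a) K) • ∏ i, currentAt (fVar r) i w +
          ∑ c : Fin m → Σ a : Fin n, Fin (r a + 1),
            prodKernelDeriv a K c w • ∏ i, MvPolynomial.X (c i) := by
        simp only [integrandDeriv, add_smul, Finset.sum_add_distrib, currentAt_fVar, prod_sum_smul_X,
          Finset.smul_sum, smul_smul]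
      have h5 := congrArg L (sum_prodKernelDeriv_add_dDer a K w)
      rw [map_add] at h5
      have h6 : ∑ j, κ * D j w = ∑ j, logDeriv x.2 w (Sum.inl j) 0 *
          L (currentAt (shifted a K (fVar r)) j w *
            ∏ i ∈ Finset.univ.erase j, currentAt (fVar r) i w) - κ * L (∑ j,
          currentDeriv r a K j w * ∏ i ∈ Finset.univ.erase j, currentAt (fVar r) i w) := by
        rw [map_sum, Finset.mul_sum, ← Finset.sum_sub_distrib]
        refine Finset.sum_congr rfl fun j _ => ?_
        simp only [hD]
        field_simp
      rw [h3, h4, h6, map_add, map_add, LinearMap.map_smul, LinearMap.map_smul, map_sum, ← h5]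
      have h8 : (L ∘ₗ (dDer r a K).toLinearMap) (∏ i, currentAt (fVar r) i w) =
        L (dDer r a K (∏ i, currentAt (fVar r) i w)) := rfl
      simp only [h8, LinearMap.map_smul, smul_eq_mul]
      field_simp
      ring
    rw [hΓ.apply_jnsIntegral hx M, h2, hΓ.psiIntegral_add hx ((hΦ L).const_mul _)
      (((hu'r.add (hΦ _)).const_mul κ).add (IsRegular.sum _ fun j _ => (hDr j).const_mul κ)),
      hΓ.psiIntegral_add hx ((hu'r.add (hΦ _)).const_mul κ)
        (IsRegular.sum _ fun j _ => (hDr j).const_mul κ),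
      hΓ.psiIntegral_const_mul hx _ (hΦ L), hΓ.psiIntegral_const_mul hx _ (hu'r.add (hΦ _)),
      hΓ.psiIntegral_add hx hu'r (hΦ _), hΓ.psiIntegral_sum hx _ _ hDr, ← h1,
      ← hΓ.apply_jnsIntegral hx L, hu', hΓ.apply_sum_psiIntegral hx _ (isRegular_integrandDeriv x a K)]
    have h7 : ∀ j, psiIntegral κ Γ x (D j) = 0 := hΓ.psiIntegral_stokes hx a K L
    simp only [h7, mul_zero, Finset.sum_const_zero, add_zero, add_sub_cancel_left]
    rfl
  simp only [map_sub, LinearMap.map_smul, map_add, smul_eq_mul]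
  exact sub_eq_zero.mpr hgoal

end KZ

end ConfluentSl2

end

/-! ### Assembly of the theorem -/

theorem mainTheorem5 {m n : ℕ} (r : Fin n → ℕ) (κ : ℂ) (hκ : κ ≠ 0) :
    (∀ lam : ConfluentSl2.Weights r,
      -- the dual highest weight vectors and the correspondence between vectors and dual vectors
      (∀ a, (∃! bra, ConfluentSl2.IsBra (lam a) bra) ∧
        ∀ bra, ConfluentSl2.IsBra (lam a) bra →
          ∃! D, ConfluentSl2.IsDualMap (lam a) bra D) ∧
      -- the matrix elements
      (∀ a bra, ConfluentSl2.IsBra (lam a) bra →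
        ∀ (ps : List (Fin (r a + 1))) (v : ConfluentSl2.Verma (lam a)),
          ConfluentSl2.screenWord ps (ConfluentSl2.matZ (lam a) bra v) =
            ConfluentSl2.matZ (lam a) (bra ∘ₗ ConfluentSl2.act (lam a)
              (ConfluentSl2.word (r a) ConfluentSl2.e ps.reverse)) v ∧
          MvPolynomial.constantCoeff
              (ConfluentSl2.screenWord ps (ConfluentSl2.matZ (lam a) bra v)) =
            bra (ConfluentSl2.act (lam a)
              (ConfluentSl2.word (r a) ConfluentSl2.e ps.reverse) v)) ∧
      (∀ a bra, ConfluentSl2.IsBra (lam a) bra →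
        ∀ ps qs : List (Fin (r a + 1)),
          MvPolynomial.constantCoeff (ConfluentSl2.screenWord ps
            (ConfluentSl2.matZ (lam a) bra (ConfluentSl2.act (lam a)
              (ConfluentSl2.word (r a) ConfluentSl2.f qs) (ConfluentSl2.ket (lam a))))) =
            bra (ConfluentSl2.act (lam a)
              (ConfluentSl2.word (r a) ConfluentSl2.e ps.reverse *
                ConfluentSl2.word (r a) ConfluentSl2.f qs) (ConfluentSl2.ket (lam a)))) ∧
      -- the correlation function `ω`
      (∀ bra : ∀ a, Module.Dual ℂ (ConfluentSl2.Verma (lam a)),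
        (∀ a, ConfluentSl2.IsBra (lam a) (bra a)) →
        ∀ (v : ∀ a, ConfluentSl2.Verma (lam a)) (ω : ConfluentSl2.Pts m n → ℂ),
          ConfluentSl2.IsBGCorrelation
              (fun a => ConfluentSl2.matZ (lam a) (bra a) (v a)) ω ↔
            ∀ (t : Fin m → ℂ) (z : Fin n → ℂ), Function.Injective (Sum.elim t z) →
              ω (Sum.elim t z) = ((m.factorial : ℂ)⁻¹) * ∑ σ : Equiv.Perm (Fin m),
                ConfluentSl2.partitionSum
                  (fun a => ConfluentSl2.matZ (lam a) (bra a) (v a)) (t ∘ σ) z) ∧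
      -- the correlation function `Ψ`
      (∀ (w : ConfluentSl2.Pts m n) (l : Fin m ⊕ Fin n → ℂ),
        (∀ j, Complex.exp (l j) = w j) →
        (∀ j k, toLex j < toLex k → ‖w k‖ < ‖w j‖) →
          ConfluentSl2.bosonVev κ lam w l =
            ConfluentSl2.psi κ lam w (fun j k => l j + Complex.log (1 - w k / w j))) ∧
      (∀ (w : ConfluentSl2.Pts m n) (l : Fin m ⊕ Fin n → Fin m ⊕ Fin n → ℂ),
        Function.Injective w →
          ConfluentSl2.psi κ lam w l = ConfluentSl2.master κ lam w l) ∧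
      -- the integral as a pairing
      (∀ bra : ∀ a, Module.Dual ℂ (ConfluentSl2.Verma (lam a)),
        (∀ a, ConfluentSl2.IsBra (lam a) (bra a)) →
        ∀ D : ∀ a, ConfluentSl2.Verma (lam a) →ₗ[ℂ] Module.Dual ℂ (ConfluentSl2.Verma (lam a)),
        (∀ a, ConfluentSl2.IsDualMap (lam a) (bra a) (D a)) →
        ∀ (v : ∀ a, ConfluentSl2.Verma (lam a)) (ω : ConfluentSl2.Pts m n → ℂ),
        ConfluentSl2.IsBGCorrelation
          (fun a => ConfluentSl2.matZ (lam a) (bra a) (v a)) ω →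
        ∀ (z : Fin n → ℂ) (Γ : ConfluentSl2.Chain m n), Γ.IsTwisted {z} →
        (∀ c : Fin m → (Σ a : Fin n, Fin (r a + 1)),
          Γ.Converges z (fun w l => ConfluentSl2.psi κ lam w l *
            ∏ j, 1 / (w (Sum.inl j) - w (Sum.inr (c j).1)) ^ (((c j).2 : ℕ) + 1))) →
          Γ.integral z (fun w l => ConfluentSl2.psi κ lam w l * ω w) =
            ConfluentSl2.dualVector D
              (ConfluentSl2.toVerma lam (ConfluentSl2.jnsIntegral κ Γ (z, lam)))
              (PiTensorProduct.tprod ℂ v))) ∧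
    -- the vector solves the confluent KZ equations
    (∀ (U : Set (ConfluentSl2.Params r)) (Γ : ConfluentSl2.Chain m n),
      ConfluentSl2.IsOpenFor U → Γ.IsCycle κ U →
        ConfluentSl2.SolvesKZ κ U (ConfluentSl2.jnsIntegral κ Γ)) := by
  refine ⟨fun lam => ⟨fun a => ⟨ConfluentSl2.existsUnique_isBra (lam a), fun bra hbra =>
    ConfluentSl2.existsUnique_isDualMap (lam a) hbra⟩, ?_, ?_, ?_, ?_, ?_, ?_⟩, ?_⟩
  · intro a bra _ ps v
    exact ⟨ConfluentSl2.screenWord_matZ (lam a) bra ps v,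
      ConfluentSl2.constantCoeff_screenWord_matZ (lam a) bra ps v⟩
  · intro a bra _ ps qs
    rw [ConfluentSl2.constantCoeff_screenWord_matZ, ConfluentSl2.act_mul]
  · intro bra _ v ω
    rw [ConfluentSl2.isBGCorrelation_iff]
    -- The partition sum is already symmetric, so the average over permutations equals it.
    simp only [ConfluentSl2.partitionSum_symm]
  · intro w l hl hw
    exact ConfluentSl2.bosonVev_eq_psi κ lam w l hl hw
  · intro w l hw
    exact ConfluentSl2.psi_eq_master κ lam hw l
  · intro bra _ D hD v ω hω z Γ hΓ hconv
    exact ConfluentSl2.integral_psi_mul_eq_dualVector κ hD v ω hω z Γ hΓ hconv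
  · intro U Γ hU hΓ
    exact hΓ.solvesKZ hκ hU
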